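/- Consider a star of mass $m_0>0$ and two planets of masses $\mu m_1,\mu m_2$ ($m_1,m_2,\mu>0$), and put $\mu_j=\frac{m_0m_j}{m_0+\mu m_j}$, $M_j=m_0+\mu m_j$. Let $\mathrm x_1,\mathrm x_2\in\mathbb R^3$ be the heliocentric positions and $\mathrm y_1,\mathrm y_2$ the conjugate (rescaled) momenta; the perturbing function is $f=\frac{\mathrm y_1\cdot \mathrm y_2}{m_0}-\frac{m_1m_2}{|\mathrm x_1-\mathrm x_2|}$. Planet 1 is the outer one and is retrograde. Write $\mathrm C_j=\mathrm x_j\times \mathrm y_j$, $\mathrm C=\mathrm C_1+\mathrm C_2$, $\Gamma_j=|\mathrm C_j|$, $C=|\mathrm C|$, $\Lambda_j=\mu_j\sqrt{M_ja_j}$ with $a_j$ the semi-major axes of the instantaneous Kepler ellipses of $\frac{|\mathrm y_j|^2}{2\mu_j}-\frac{\mu_jM_j}{|\mathrm x_j|}$, $\ell_j$ for the mean anomalies, $\gamma_j$ for the arguments of perihelion measured from the nodes $\nu_2=\mathrm C\times \mathrm C_2$ (planet 2) and $\nu_1=-\nu_2$ (planet 1), and $\psi$ for the longitude of $\nu_2$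 in the plane orthogonal to $\mathrm C$. Regularising coordinates $(\Lambda,\lambda,t,t^*)$, defined modulo rotations of the whole system, are given by $\lambda_1=\ell_1+\gamma_1-\psi$, $\lambda_2=\ell_2+\gamma_2+\psi$, $$t_1=-i\sqrt{\Lambda_1-\Gamma_1}\,e^{i(\psi-\gamma_1)},\quad t_2=\sqrt{\Lambda_2-\Gamma_2}\,e^{i(\psi+\gamma_2)},\quad t_3=-i\sqrt{C-\Gamma_2+\Gamma_1}\,e^{i\psi},$$ with real symplectic variables $z=((\eta_1,\eta_2,p),(\xi_1,\xi_2,q))\in\mathbb R^3\times\mathbb R^3$ such that $t_1=\frac{i\eta_1-\xi_1}{\sqrt2}$, $t_2=\frac{\eta_2-i\xi_2}{\sqrt2}$, $t_3=\frac{ip-q}{\sqrt2}$, $t_1^*=\frac{i\eta_1+\xi_1}{\sqrt2\,i}$, $t_2^*=\frac{\eta_2+i\xi_2}{\sqrt2\,i}$, $t_3^*=\frac{ip+q}{\sqrt2\,i}$. Let $f^{\rm av}(z)=f^{\rm av}(z;\Lambda)$ be the mean of $f$ over $(\lambda_1,\lambda_2)\in\mathbb T^2$. Assume $0<\Lambda_1<\Lambda_2$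 and $a_2<a_1$, where $a_j=\frac1{M_j}\left(\frac{\Lambda_j}{\mu_j}\right)^2$, and put $\alpha=a_2/a_1$. Let $$b^{(k)}_{s}(\alpha)=\frac1{2\pi}\int_0^{2\pi}\frac{\cos k\theta\,d\theta}{(1-2\alpha\cos\theta+\alpha^2)^{s}},\qquad \mathrm s=-m_1m_2\frac{\alpha}{2a_1}b^{(1)}_{3/2}(\alpha),\qquad \tilde{\mathrm s}=m_1m_2\frac{\alpha}{2a_1}b^{(2)}_{3/2}(\alpha),$$ $$\sigma(\Lambda)=\begin{pmatrix}-\frac{\mathrm s}{\Lambda_1}&-i\frac{\tilde{\mathrm s}}{\sqrt{\Lambda_1\Lambda_2}}\\-i\frac{\tilde{\mathrm s}}{\sqrt{\Lambda_1\Lambda_2}}&\frac{\mathrm s}{\Lambda_2}\end{pmatrix},\qquad \varsigma(\Lambda)=-\Big(\frac1{\Lambda_2}-\frac1{\Lambda_1}\Big)\mathrm s .$$ Then: 1. $\sigma(\Lambda)$ and $\varsigma(\Lambda)$ are the quadratic secular coefficients: for some $C_0=C_0(\Lambda)\in\mathbb R$, as $z\to0$, $$f^{\rm av}(z)=C_0+i\sum_{j,k=1}^2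 t_j\,\sigma_{jk}(\Lambda)\,t_k^*+i\,\varsigma(\Lambda)\,t_3t_3^*+O(|z|^4).$$ 2. $\sigma(\Lambda)$ is symmetric and not real, but all its eigenvalues are real. 3. The origin $z=0$, i.e. $(t,t^*)=(0,0)$, is an elliptic equilibrium of $f^{\rm av}$: $f^{\rm av}$ is $C^2$ near $0$, its differential vanishes at $0$, and the linearisation at $0$ of its Hamiltonian vector field is diagonalisable over $\mathbb C$ with nonzero purely imaginary eigenvalues. -/

import Mathlib

open Filter Topology Asymptotics

noncomputable section

namespace Retrograde

/-! ### Elliptic equilibria -/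

/-- The Hessian matrix of `f` at `z₀`. -/
def hessian {n : ℕ} (f : (Fin n ⊕ Fin n → ℝ) → ℝ) (z₀ : Fin n ⊕ Fin n → ℝ) :
    Matrix (Fin n ⊕ Fin n) (Fin n ⊕ Fin n) ℝ :=
  Matrix.of fun a b => fderiv ℝ (fderiv ℝ f) z₀ (Pi.single a 1) (Pi.single b 1)

/-- The matrix of the linearisation at `z₀` of the Hamiltonian vector field
`u' = - ∂f/∂v`, `v' = ∂f/∂u`, where `u` is the left and `v` the right block of variables. -/
def linearization {n : ℕ} (f : (Fin n ⊕ Fin n → ℝ) → ℝ) (z₀ : Fin n ⊕ Fin n → ℝ) :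
    Matrix (Fin n ⊕ Fin n) (Fin n ⊕ Fin n) ℝ :=
  Matrix.J (Fin n) ℝ * hessian f z₀

/-- `z₀` is an elliptic equilibrium of the Hamiltonian `f`: near `z₀` the function is twice
continuously differentiable, `z₀` is a critical point, and the linearised Hamiltonian vector field
is diagonalisable over `ℂ` with nonzero purely imaginary eigenvalues. -/
structure IsEllipticEquilibrium {n : ℕ} (f : (Fin n ⊕ Fin n → ℝ) → ℝ)
    (z₀ : Fin n ⊕ Fin n → ℝ) : Prop where
  contDiffAt : ContDiffAt ℝ 2 f z₀
  critical : fderiv ℝ f z₀ = 0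
  eigenvalue : ∀ w : ℂ,
    Module.End.HasEigenvalue
      (Matrix.toLin' ((linearization f z₀).map (fun r : ℝ => (r : ℂ)))) w → w.re = 0 ∧ w ≠ 0
  diagonalizable :
    (⨆ w : ℂ, Module.End.eigenspace
      (Matrix.toLin' ((linearization f z₀).map (fun r : ℝ => (r : ℂ)))) w) = ⊤

/-! ### Rotations and Kepler ellipses -/

/-- Rotation about the first axis. -/
def rot1 (i : ℝ) : Matrix (Fin 3) (Fin 3) ℝ :=
  !![1, 0, 0; 0, Real.cos i, -Real.sin i; 0, Real.sin i, Real.cos i]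

/-- Rotation about the third axis. -/
def rot3 (θ : ℝ) : Matrix (Fin 3) (Fin 3) ℝ :=
  !![Real.cos θ, -Real.sin θ, 0; Real.sin θ, Real.cos θ, 0; 0, 0, 1]

/-- The eccentric anomaly: the solution `u` of Kepler's equation `u - e sin u = l`
(which exists and is unique for `0 ≤ e < 1`). -/
def eccAnomaly (e l : ℝ) : ℝ := Function.invFun (fun u : ℝ => u - e * Real.sin u) l

/-- Position on the Kepler ellipse with semi-major axis `a` and eccentricity `e` at eccentric
anomaly `u`; perihelion on the first axis, angular momentum along the third. -/
def keplerPos (a e u : ℝ) : Fin 3 → ℝ :=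
  ![a * (Real.cos u - e), a * √(1 - e ^ 2) * Real.sin u, 0]

/-- Momentum `β dx/dt` along the Kepler motion of `|y|²/(2β) - β M/|x|`, with the mean motion
`dl/dt = √(M / a³)`. -/
def keplerMom (β M a e u : ℝ) : Fin 3 → ℝ :=
  (β * √(M / a) / (1 - e * Real.cos u)) •
    ![-Real.sin u, √(1 - e ^ 2) * Real.cos u, 0]

/-! ### The three-body problem in retrograde coordinates

Index `0` stands for the outer, retrograde planet (`1` in the usual labelling), index `1` for the
inner one (`2` in the usual labelling). `m₀` is the mass of the star, `μ * m j` are the planetary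
masses. -/

/-- Reduced masses. -/
def redMass (m₀ μ : ℝ) (m : Fin 2 → ℝ) (j : Fin 2) : ℝ := m₀ * m j / (m₀ + μ * m j)

/-- Total masses. -/
def totMass (m₀ μ : ℝ) (m : Fin 2 → ℝ) (j : Fin 2) : ℝ := m₀ + μ * m j

/-- Semi-major axes, as functions of the actions `Λ j = redMass j * √(totMass j * a j)`. -/
def semiAxis (m₀ μ : ℝ) (m Λ : Fin 2 → ℝ) (j : Fin 2) : ℝ :=
  (Λ j / redMass m₀ μ m j) ^ 2 / totMass m₀ μ m j

/-- The complex coordinates `t`, in terms of the real symplectic ones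
`z = ((η₁, η₂, p), (ξ₁, ξ₂, q))`. -/
def tCoord (z : Fin 3 ⊕ Fin 3 → ℝ) : Fin 3 → ℂ :=
  ![(Complex.I * z (.inl 0) - z (.inr 0)) / (√2 : ℝ),
    (z (.inl 1) - Complex.I * z (.inr 1)) / (√2 : ℝ),
    (Complex.I * z (.inl 2) - z (.inr 2)) / (√2 : ℝ)]

/-- The complex coordinates `t*`. -/
def tStar (z : Fin 3 ⊕ Fin 3 → ℝ) : Fin 3 → ℂ :=
  ![(Complex.I * z (.inl 0) + z (.inr 0)) / ((√2 : ℝ) * Complex.I),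
    (z (.inl 1) + Complex.I * z (.inr 1)) / ((√2 : ℝ) * Complex.I),
    (Complex.I * z (.inl 2) + z (.inr 2)) / ((√2 : ℝ) * Complex.I)]

/-- The lengths `Γ j` of the planets' angular momenta, `Λ j - Γ j = |t j|²`. -/
def angMom (Λ : Fin 2 → ℝ) (z : Fin 3 ⊕ Fin 3 → ℝ) (j : Fin 2) : ℝ :=
  Λ j - ‖tCoord z j.castSucc‖ ^ 2

/-- The length `C` of the total angular momentum, `C - Γ₂ + Γ₁ = |t₃|²`. -/
def totAngMom (Λ : Fin 2 → ℝ) (z : Fin 3 ⊕ Fin 3 → ℝ) : ℝ :=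
  angMom Λ z 1 - angMom Λ z 0 + ‖tCoord z 2‖ ^ 2

/-- Eccentricities, `Γ j = Λ j √(1 - e j ²)`. -/
def ecc (Λ : Fin 2 → ℝ) (z : Fin 3 ⊕ Fin 3 → ℝ) (j : Fin 2) : ℝ :=
  √(1 - (angMom Λ z j / Λ j) ^ 2)

/-- The angle `ψ = γ + ζ` of the node `ν₂ = C × C₂`, from `t₃ = -i √(C - Γ₂ + Γ₁) exp(i ψ)`. -/
def nodeAngle (z : Fin 3 ⊕ Fin 3 → ℝ) : ℝ := Complex.arg (Complex.I * tCoord z 2)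

/-- The arguments of perihelion `γ₁`, `γ₂`, measured from the nodes `ν₁ = -ν₂` and `ν₂`, from
`t₁ = -i √(Λ₁ - Γ₁) exp(i (-γ₁ + ψ))` and `t₂ = √(Λ₂ - Γ₂) exp(i (γ₂ + ψ))`. -/
def periArg (z : Fin 3 ⊕ Fin 3 → ℝ) : Fin 2 → ℝ :=
  ![nodeAngle z - Complex.arg (Complex.I * tCoord z 0), Complex.arg (tCoord z 1) - nodeAngle z]

/-- The mean anomalies, from `λ₁ = ℓ₁ + γ₁ - ψ` and `λ₂ = ℓ₂ + γ₂ + ψ`. -/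
def meanAnomaly (l : Fin 2 → ℝ) (z : Fin 3 ⊕ Fin 3 → ℝ) : Fin 2 → ℝ :=
  ![l 0 - periArg z 0 + nodeAngle z, l 1 - periArg z 1 - nodeAngle z]

/-- The convex angles between `C` and `C_j`, read off the triangle with sides `C`, `Γ₁`, `Γ₂`. -/
def inclination (Λ : Fin 2 → ℝ) (z : Fin 3 ⊕ Fin 3 → ℝ) (j : Fin 2) : ℝ :=
  Real.arccos ((totAngMom Λ z ^ 2 + angMom Λ z j ^ 2 - angMom Λ z (1 - j) ^ 2) /
    (2 * totAngMom Λ z * angMom Λ z j))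

/-- The rotation carrying the standard orbital frame (perihelion on the first axis) to the
position of the orbit of planet `j`; the third axis is along the total angular momentum. The
nodes of the two planets are opposite. -/
def orbitRotation (Λ : Fin 2 → ℝ) (z : Fin 3 ⊕ Fin 3 → ℝ) (j : Fin 2) :
    Matrix (Fin 3) (Fin 3) ℝ :=
  rot3 (nodeAngle z + ![Real.pi, 0] j) * rot1 (inclination Λ z j) * rot3 (periArg z j)

/-- Heliocentric positions. -/
def position (m₀ μ : ℝ) (m Λ l : Fin 2 → ℝ) (z : Fin 3 ⊕ Fin 3 → ℝ) (j : Fin 2) : Fin 3 → ℝ :=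
  (orbitRotation Λ z j).mulVec
    (keplerPos (semiAxis m₀ μ m Λ j) (ecc Λ z j) (eccAnomaly (ecc Λ z j) (meanAnomaly l z j)))

/-- The momenta conjugated to the heliocentric positions. -/
def momentum (m₀ μ : ℝ) (m Λ l : Fin 2 → ℝ) (z : Fin 3 ⊕ Fin 3 → ℝ) (j : Fin 2) : Fin 3 → ℝ :=
  (orbitRotation Λ z j).mulVec
    (keplerMom (redMass m₀ μ m j) (totMass m₀ μ m j) (semiAxis m₀ μ m Λ j) (ecc Λ z j)
      (eccAnomaly (ecc Λ z j) (meanAnomaly l z j)))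

/-- The perturbing function `y₁ · y₂ / m₀ - m₁ m₂ / |x₁ - x₂|` in the retrograde coordinates. By
rotation invariance it does not depend on the pair `(T, T*)`, which fixes the direction of the
total angular momentum; it is evaluated here with that direction on the third axis. -/
def perturbation (m₀ μ : ℝ) (m Λ l : Fin 2 → ℝ) (z : Fin 3 ⊕ Fin 3 → ℝ) : ℝ :=
  dotProduct (momentum m₀ μ m Λ l z 0) (momentum m₀ μ m Λ l z 1) / m₀ -
    m 0 * m 1 /
      √(∑ k : Fin 3, (position m₀ μ m Λ l z 0 k - position m₀ μ m Λ l z 1 k) ^ 2)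

/-- The averaged perturbing function: the mean over `(λ₁, λ₂)` in the torus. -/
def averaged (m₀ μ : ℝ) (m Λ : Fin 2 → ℝ) (z : Fin 3 ⊕ Fin 3 → ℝ) : ℝ :=
  1 / (2 * Real.pi) ^ 2 *
    ∫ l₁ in (0 : ℝ)..(2 * Real.pi), ∫ l₂ in (0 : ℝ)..(2 * Real.pi),
      perturbation m₀ μ m Λ ![l₁, l₂] z

/-! ### The quadratic secular coefficients -/

/-- Laplace coefficients `b_s^{(k)}(α)`: the Fourier coefficients of
`(1 - 2 α cos θ + α²)^(-s)`. -/
def laplaceCoeff (s : ℝ) (k : ℤ) (α : ℝ) : ℝ :=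
  1 / (2 * Real.pi) * ∫ θ in (0 : ℝ)..(2 * Real.pi),
    Real.cos (k * θ) / (1 - 2 * α * Real.cos θ + α ^ 2) ^ s

/-- The semi-axes ratio `α = a₂ / a₁`. -/
def axisRatio (m₀ μ : ℝ) (m Λ : Fin 2 → ℝ) : ℝ := semiAxis m₀ μ m Λ 1 / semiAxis m₀ μ m Λ 0

/-- `s = - m₁ m₂ α / (2 a₁) b_{3/2}^{(1)}(α)`. -/
def secS (m₀ μ : ℝ) (m Λ : Fin 2 → ℝ) : ℝ :=
  -(m 0 * m 1 * (axisRatio m₀ μ m Λ / (2 * semiAxis m₀ μ m Λ 0)) *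
    laplaceCoeff (3 / 2) 1 (axisRatio m₀ μ m Λ))

/-- `s̃ = m₁ m₂ α / (2 a₁) b_{3/2}^{(2)}(α)`. -/
def secST (m₀ μ : ℝ) (m Λ : Fin 2 → ℝ) : ℝ :=
  m 0 * m 1 * (axisRatio m₀ μ m Λ / (2 * semiAxis m₀ μ m Λ 0)) *
    laplaceCoeff (3 / 2) 2 (axisRatio m₀ μ m Λ)

/-- The matrix `σ(Λ)`. -/
def sigma (m₀ μ : ℝ) (m Λ : Fin 2 → ℝ) : Matrix (Fin 2) (Fin 2) ℂ :=
  !![((-(secS m₀ μ m Λ / Λ 0) : ℝ) : ℂ),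
      -Complex.I * ((secST m₀ μ m Λ / √(Λ 0 * Λ 1) : ℝ) : ℂ);
    -Complex.I * ((secST m₀ μ m Λ / √(Λ 0 * Λ 1) : ℝ) : ℂ),
      ((secS m₀ μ m Λ / Λ 1 : ℝ) : ℂ)]

/-- The coefficient `ς(Λ)`. -/
def varsigma (m₀ μ : ℝ) (m Λ : Fin 2 → ℝ) : ℝ := -((1 / Λ 1 - 1 / Λ 0) * secS m₀ μ m Λ)

/-- The quadratic part `i t_h · σ(Λ) t_h* + i ς(Λ) t₃ t₃*`. -/
def secularQuadratic (m₀ μ : ℝ) (m Λ : Fin 2 → ℝ) (z : Fin 3 ⊕ Fin 3 → ℝ) : ℂ :=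
  Complex.I * (∑ j : Fin 2, ∑ k : Fin 2,
      tCoord z j.castSucc * sigma m₀ μ m Λ j k * tStar z k.castSucc) +
    Complex.I * (varsigma m₀ μ m Λ : ℂ) * tCoord z 2 * tStar z 2

end Retrograde

end

noncomputable section

namespace Retrograde

/-! ### Integrals depending on parameters -/

/-! The perihelia and the node are arguments of complex numbers, with no geometric meaning at `z =
0`. The average is smooth there all the same, because these angles disappear when one integrates
over true longitudes (node plus angle along the orbit, counted backwards for the retrograde planet)
instead of mean ones. The area law gives the weights `(r/a)²/√(1-e²)`. If `f` is the true anomaly,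
`e cos f` is a smooth factor times a linear form in `(η, ξ)`, and the mutual inclination enters only
through `|t₃|²` times two sines counted from the node, a quadratic polynomial in `(p, q)`. The term
`y₁ · y₂ / m₀` averages to zero, a Kepler momentum being the derivative of a periodic function. The
outcome is `averaged_eq_integral`: near the origin the average is a double integral of
`orbitDensity`, smooth because circular coplanar orbits of different radii do not meet.

Changing `z` into `-z` turns both orbits by half a turn, so the average is even and its Taylor
remainder after the quadratic part is `O(|z|⁴)` (`isBigO_even_taylor`). The quadratic part is read
off from second derivatives along lines through the origin, taken under the integral with
second-order jets (`hasJet_orbitDensity`). Averaging over common rotations of both planets leaves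
integrals over the difference `θ` of the longitudes (`integral_densityCoeff_rotation`). Integrations
by parts reduce them to the integrals of `cos θ K³` and `cos 2θ K³`, where `K` is the inverse
distance on circular orbits; these are the two Laplace coefficients up to factors
(`integral_integral_densityCoeff`).

The spectral claims all rest on `0 < s̃ < -s` (`secST_pos_and_lt`), which holds because `K`
increases with `cos θ`. Put `A = s/Λ₁`, `D = s/Λ₂`, `g = s̃/√(Λ₁Λ₂)`; then `g² < AD`. The
characteristic polynomial of `σ` is real with discriminant `(A+D)² - 4g² = (A-D)² + 4(AD-g²) > 0`.
The characteristic polynomial of the linearised field on the `(η, ξ)` variables is quadratic in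
`w²`, with negative roots, distinct since `A ≠ D`; the `(p, q)` plane adds the eigenvalues `±iς`,
with `ς ≠ 0`. -/

theorem isOpen_setOf_forall_prod_mem {X Y : Type*} [TopologicalSpace X] [TopologicalSpace Y]
    {W : Set (X × Y)} (hW : IsOpen W) {K : Set Y} (hK : IsCompact K) :
    IsOpen {x | ∀ y ∈ K, (x, y) ∈ W} := by
  rw [isOpen_iff_mem_nhds]
  intro x hx
  exact hK.eventually_forall_of_forall_eventually (P := fun x y => (x, y) ∈ W)
    fun y hy => hW.mem_nhds (hx y hy)

section Parametric

variable {E F : Type} [NormedAddCommGroup E] [NormedSpace ℝ E] [FiniteDimensional ℝ E]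
  [NormedAddCommGroup F] [NormedSpace ℝ F]

theorem continuousOn_section {X F : Type*} [TopologicalSpace X] [TopologicalSpace F]
    {W : Set (X × ℝ)} {f : X × ℝ → F}
    (hf : ContinuousOn f W) {a b : ℝ} {z : X} (hz : ∀ v ∈ Set.Icc a b, (z, v) ∈ W) :
    ContinuousOn (fun v => f (z, v)) (Set.Icc a b) :=
  hf.comp (by fun_prop) hz

theorem intervalIntegrable_section {X F : Type*} [TopologicalSpace X] [NormedAddCommGroup F]
    {W : Set (X × ℝ)} {f : X × ℝ → F}
    (hf : ContinuousOn f W) {a b : ℝ} (hab : a ≤ b) {z : X}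
    (hz : ∀ v ∈ Set.Icc a b, (z, v) ∈ W) :
    IntervalIntegrable (fun v => f (z, v)) MeasureTheory.volume a b :=
  ContinuousOn.intervalIntegrable_of_Icc hab (continuousOn_section hf hz)

/-- Smoothness is only available on an open `W`. By the tube lemma the points whose whole fibre lies
in `W` form an open set, and compactness of a closed ball times `[a, b]` bounds the derivative, so
dominated differentiation applies. -/
theorem hasFDerivAt_integral_of_contDiffOn {W : Set (E × ℝ)} (hW : IsOpen W) {f : E × ℝ → F}
    (hf : ContDiffOn ℝ 1 f W) {a b : ℝ} (hab : a ≤ b) {z₀ : E}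
    (hz₀ : ∀ v ∈ Set.Icc a b, (z₀, v) ∈ W) :
    HasFDerivAt (fun z => ∫ v in a..b, f (z, v))
      (∫ v in a..b, (fderiv ℝ f (z₀, v)).comp (ContinuousLinearMap.inl ℝ E ℝ)) z₀ := by
  have hU := isOpen_setOf_forall_prod_mem hW (isCompact_Icc (a := a) (b := b))
  obtain ⟨ε, hε, hball⟩ := Metric.nhds_basis_closedBall.mem_iff.1 (hU.mem_nhds hz₀)
  have hf' : ContinuousOn
      (fun p => (fderiv ℝ f p).comp (ContinuousLinearMap.inl ℝ E ℝ)) W :=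
    (hf.continuousOn_fderiv_of_isOpen hW le_rfl).clm_comp continuousOn_const
  have hsub : Metric.closedBall z₀ ε ×ˢ Set.Icc a b ⊆ W := fun p hp => hball hp.1 p.2 hp.2
  obtain ⟨C, hC⟩ := ((isCompact_closedBall z₀ ε).prod isCompact_Icc).exists_bound_of_continuousOn
    (hf'.mono hsub)
  have hI : ∀ {v}, v ∈ Set.uIoc a b → v ∈ Set.Icc a b := fun {v} hv => by
    rw [Set.uIoc_of_le hab] at hv; exact ⟨hv.1.le, hv.2⟩
  refine intervalIntegral.hasFDerivAt_integral_of_dominated_of_fderiv_le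
    (F := fun z v => f (z, v))
    (F' := fun z v => (fderiv ℝ f (z, v)).comp (ContinuousLinearMap.inl ℝ E ℝ))
    (bound := fun _ => C) (Metric.closedBall_mem_nhds z₀ hε) ?_
    (intervalIntegrable_section hf.continuousOn hab hz₀) ?_ ?_ (by simp) ?_
  · filter_upwards [hU.mem_nhds hz₀] with z hz
    exact ((intervalIntegrable_section hf.continuousOn hab hz).def').aestronglyMeasurable
  · exact ((intervalIntegrable_section hf' hab hz₀).def').aestronglyMeasurable
  · exact Eventually.of_forall fun v hv z hz => hC (z, v) ⟨hz, hI hv⟩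
  · refine Eventually.of_forall fun v hv z hz => ?_
    have h1 : HasFDerivAt f (fderiv ℝ f (z, v)) (z, v) :=
      ((hf.differentiableOn one_ne_zero).differentiableAt
        (hW.mem_nhds (hsub (Set.mk_mem_prod hz (hI hv))))).hasFDerivAt
    exact h1.comp z (hasFDerivAt_prodMk_left z v)

/-- The codomain is quantified inside the induction because the derivative of the integral is again
such an integral, with values in a space of linear maps. -/
theorem contDiffOn_integral {W : Set (E × ℝ)} (hW : IsOpen W) {a b : ℝ} (hab : a ≤ b)
    (n : ℕ) : ∀ {F : Type} [NormedAddCommGroup F] [NormedSpace ℝ F] {f : E × ℝ → F},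
    ContDiffOn ℝ n f W →
    ContDiffOn ℝ n (fun z => ∫ v in a..b, f (z, v)) {z | ∀ v ∈ Set.Icc a b, (z, v) ∈ W} := by
  have hU := isOpen_setOf_forall_prod_mem hW (isCompact_Icc (a := a) (b := b))
  induction n with
  | zero =>
    intro F _ _ f hf
    simp only [Nat.cast_zero, contDiffOn_zero] at hf ⊢
    intro z₀ hz₀
    refine ContinuousAt.continuousWithinAt ?_
    obtain ⟨ε, hε, hball⟩ := Metric.nhds_basis_closedBall.mem_iff.1 (hU.mem_nhds hz₀)
    have hsub : Metric.closedBall z₀ ε ×ˢ Set.Icc a b ⊆ W := fun p hp => hball hp.1 p.2 hp.2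
    obtain ⟨C, hC⟩ :=
      ((isCompact_closedBall z₀ ε).prod isCompact_Icc).exists_bound_of_continuousOn (hf.mono hsub)
    have hI : ∀ {v}, v ∈ Set.uIoc a b → v ∈ Set.Icc a b := fun {v} hv => by
      rw [Set.uIoc_of_le hab] at hv; exact ⟨hv.1.le, hv.2⟩
    refine intervalIntegral.continuousAt_of_dominated_interval (bound := fun _ => C) ?_ ?_
      (by simp) ?_
    · filter_upwards [hU.mem_nhds hz₀] with z hz
      exact ((intervalIntegrable_section hf hab hz).def').aestronglyMeasurable
    · filter_upwards [Metric.closedBall_mem_nhds z₀ hε] with z hz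
      exact Eventually.of_forall fun v hv => hC (z, v) ⟨hz, hI hv⟩
    · refine Eventually.of_forall fun v hv => ?_
      have h1 : ContinuousAt f (z₀, v) := hf.continuousAt (hW.mem_nhds (hz₀ v (hI hv)))
      exact ContinuousAt.comp (f := fun z => (z, v)) h1 (by fun_prop)
  | succ n ih =>
    intro F _ _ f hf
    have h1 : ContDiffOn ℝ 1 f W := hf.of_le (by exact_mod_cast Nat.le_add_left 1 n)
    rw [Nat.cast_add, Nat.cast_one] at hf ⊢
    rw [contDiffOn_succ_iff_fderiv_of_isOpen hU]
    refine ⟨fun z hz => (hasFDerivAt_integral_of_contDiffOn hW h1 hab hz).differentiableAt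
      |>.differentiableWithinAt, by simp, ?_⟩
    refine ContDiffOn.congr (ih (f := fun p =>
      (fderiv ℝ f p).comp (ContinuousLinearMap.inl ℝ E ℝ)) ?_)
      fun z hz => (hasFDerivAt_integral_of_contDiffOn hW h1 hab hz).fderiv
    exact (((contDiffOn_succ_iff_fderiv_of_isOpen hW).1 hf).2.2).clm_comp contDiffOn_const

theorem hasDerivAt_integral_of_contDiffOn {W : Set (ℝ × ℝ)} (hW : IsOpen W) {f : ℝ × ℝ → ℝ}
    (hf : ContDiffOn ℝ 1 f W) {a b : ℝ} (hab : a ≤ b) {r : ℝ}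
    (hr : ∀ v ∈ Set.Icc a b, (r, v) ∈ W) :
    HasDerivAt (fun r => ∫ v in a..b, f (r, v)) (∫ v in a..b, fderiv ℝ f (r, v) (1, 0)) r := by
  have h := (hasFDerivAt_integral_of_contDiffOn hW hf hab hr).hasDerivAt
  have hf' : ContinuousOn
      (fun p => (fderiv ℝ f p).comp (ContinuousLinearMap.inl ℝ ℝ ℝ)) W :=
    (hf.continuousOn_fderiv_of_isOpen hW le_rfl).clm_comp continuousOn_const
  have h1 := ContinuousLinearMap.intervalIntegral_apply
    (intervalIntegrable_section hf' hab hr) (1 : ℝ)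
  rw [h1] at h
  simpa using h

end Parametric

/-! ### Taylor expansion of even functions -/

section EvenTaylor

variable {E F : Type*} [NormedAddCommGroup E] [NormedSpace ℝ E]
  [NormedAddCommGroup F] [NormedSpace ℝ F]

theorem fderiv_comp_neg (f : E → F) (z : E) :
    fderiv ℝ (fun z => f (-z)) z = -fderiv ℝ f (-z) := by
  have h := (ContinuousLinearEquiv.neg ℝ (M := E)).comp_right_fderiv (f := f) (x := z)
  have h1 : f ∘ (ContinuousLinearEquiv.neg ℝ (M := E)) = fun z => f (-z) := rfl
  rw [h1] at h
  rw [h]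
  ext v
  simp

theorem fderiv_neg_eq_of_even {f : E → F} (hf : ∀ᶠ z in 𝓝 0, f (-z) = f z) :
    ∀ᶠ z in 𝓝 (0 : E), fderiv ℝ f (-z) = -fderiv ℝ f z := by
  filter_upwards [hf.eventually_nhds] with z hz
  have h : (fun z => f (-z)) =ᶠ[𝓝 z] f := hz
  have h2 := h.fderiv_eq (𝕜 := ℝ)
  rw [fderiv_comp_neg] at h2
  rw [← h2, neg_neg]

theorem fderiv_neg_eq_of_odd {f : E → F} (hf : ∀ᶠ z in 𝓝 0, f (-z) = -f z) :
    ∀ᶠ z in 𝓝 (0 : E), fderiv ℝ f (-z) = fderiv ℝ f z := by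
  filter_upwards [hf.eventually_nhds] with z hz
  have h : (fun z => f (-z)) =ᶠ[𝓝 z] fun z => -f z := hz
  have h2 := h.fderiv_eq (𝕜 := ℝ)
  rw [fderiv_comp_neg, fderiv_fun_neg] at h2
  exact neg_injective h2

omit [NormedSpace ℝ E] in
theorem eq_zero_of_odd {f : E → F} (hf : ∀ᶠ z in 𝓝 0, f (-z) = -f z) : f 0 = 0 := by
  have h := hf.self_of_nhds
  rw [neg_zero] at h
  have h2 : (2 : ℝ) • f 0 = 0 := by
    rw [two_smul]
    exact eq_neg_iff_add_eq_zero.1 h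
  simpa using h2

/-- The mean value inequality on the closed ball of radius `‖z‖`; each use gains one order. -/
theorem isBigO_pow_succ_of_fderiv {f : E → F} (hf : ∀ᶠ z in 𝓝 0, DifferentiableAt ℝ f z)
    (h0 : f 0 = 0) {k : ℕ} (h : fderiv ℝ f =O[𝓝 0] fun z => ‖z‖ ^ k) :
    f =O[𝓝 0] fun z => ‖z‖ ^ (k + 1) := by
  obtain ⟨C, hC⟩ := h.bound
  obtain ⟨ε, hε, hball⟩ := Metric.nhds_basis_ball.mem_iff.1 (hf.and hC)
  refine IsBigO.of_bound C ?_
  filter_upwards [Metric.ball_mem_nhds 0 hε] with z hz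
  have hz' : ‖z‖ < ε := by simpa using hz
  have hsub : ∀ w ∈ Metric.closedBall (0 : E) ‖z‖, ‖w‖ ≤ ‖z‖ := fun w hw => by simpa using hw
  have hmem : ∀ w ∈ Metric.closedBall (0 : E) ‖z‖, w ∈ Metric.ball (0 : E) ε := fun w hw => by
    simpa using (hsub w hw).trans_lt hz'
  have hC0 : 0 ≤ C * ‖z‖ ^ k := by
    have := (hball hz).2
    simp only [norm_pow, norm_norm] at this
    exact (norm_nonneg _).trans this
  have key := (convex_closedBall (0 : E) ‖z‖).norm_image_sub_le_of_norm_fderiv_le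
    (𝕜 := ℝ) (f := f) (C := C * ‖z‖ ^ k) (x := 0) (y := z)
    (fun w hw => (hball (hmem w hw)).1) (fun w hw => ?_) (by simp) (by simp)
  · rw [h0, sub_zero, sub_zero] at key
    simpa [pow_succ, mul_assoc] using key
  · have := (hball (hmem w hw)).2
    simp only [norm_pow, norm_norm] at this
    refine this.trans ?_
    -- The constant provided by `IsBigO` may be negative a priori; the bound at a nonzero point
    -- excludes this, so the origin is treated apart.
    rcases eq_or_ne w 0 with rfl | hw0
    · rcases k.eq_zero_or_pos with rfl | hk
      · simp
      · rw [norm_zero, zero_pow hk.ne', mul_zero]; exact hC0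
    · have hC1 : 0 ≤ C := by
        by_contra hneg
        have h1 : 0 < ‖w‖ ^ k := by positivity
        have := (norm_nonneg _).trans this
        nlinarith
      gcongr
      exact hsub w hw

set_option maxSynthPendingDepth 4 in
-- Subtract the quadratic Taylor polynomial. The third derivative of the difference is odd and `C¹`,
-- hence `O(‖z‖)`; three integrations give the fourth order, the first and second derivatives and
-- the difference itself being zero at the origin.
theorem isBigO_even_taylor {f : E → ℝ} (hf : ContDiffAt ℝ 4 f 0)
    (heven : ∀ᶠ z in 𝓝 0, f (-z) = f z) :
    (fun z => f z - f 0 - 1 / 2 * fderiv ℝ (fderiv ℝ f) 0 z z) =O[𝓝 0] fun z => ‖z‖ ^ 4 := by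
  set B := fderiv ℝ (fderiv ℝ f) 0 with hB
  have hsymm : ∀ u v, B u v = B v u := fun u v =>
    (hf.isSymmSndFDerivAt (by simp; norm_cast)) u v
  set h : E → ℝ := fun z => f z - f 0 - 1 / 2 * B z z with hh
  have hq : ∀ z, HasFDerivAt (fun z => 1 / 2 * B z z) (B z) z := fun z => by
    have h1 := (B.hasFDerivAt (x := z)).clm_apply (hasFDerivAt_id z)
    have h2 := h1.const_mul (1 / 2 : ℝ)
    refine h2.congr_fderiv ?_
    ext v
    simp [hsymm v z]
    ring
  have hqc : ContDiff ℝ 4 (fun z => 1 / 2 * B z z) := by fun_prop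
  have hc : ContDiffAt ℝ 4 h 0 := (hf.sub contDiffAt_const).sub hqc.contDiffAt
  have he : ∀ᶠ z in 𝓝 0, h (-z) = h z := by
    filter_upwards [heven] with z hz
    simp [hh, hz]
  have hdf : ∀ᶠ z in 𝓝 0, DifferentiableAt ℝ f z := by
    filter_upwards [hf.eventually (by simp)] with z hz
    exact hz.differentiableAt (by norm_num)
  have hd1 : fderiv ℝ h =ᶠ[𝓝 0] fun z => fderiv ℝ f z - B z := by
    filter_upwards [hdf] with z hz
    exact ((hz.hasFDerivAt.sub_const _).sub (hq z)).fderiv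
  have hc1 : ContDiffAt ℝ 3 (fderiv ℝ h) 0 := hc.fderiv_right (by norm_num)
  have hc2 : ContDiffAt ℝ 2 (fderiv ℝ (fderiv ℝ h)) 0 := hc1.fderiv_right (by norm_num)
  have hc3 : ContDiffAt ℝ 1 (fderiv ℝ (fderiv ℝ (fderiv ℝ h))) 0 := hc2.fderiv_right (by norm_num)
  have ho1 := fderiv_neg_eq_of_even he
  have he2 := fderiv_neg_eq_of_odd ho1
  have ho3 := fderiv_neg_eq_of_even he2
  have h20 : fderiv ℝ (fderiv ℝ h) 0 = 0 := by
    rw [hd1.fderiv_eq]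
    have hdd : DifferentiableAt ℝ (fderiv ℝ f) 0 :=
      (hf.fderiv_right (m := 3) (by norm_num)).differentiableAt (by norm_num)
    rw [fderiv_fun_sub hdd B.differentiableAt, B.fderiv, ← hB, sub_self]
  have hev : ∀ {G : Type _} [NormedAddCommGroup G] [NormedSpace ℝ G] {g : E → G} {n : ℕ},
      n ≠ 0 → ContDiffAt ℝ n g 0 → ∀ᶠ z in 𝓝 0, DifferentiableAt ℝ g z := by
    intro G _ _ g n hn hg
    filter_upwards [hg.eventually (by simp)] with z hz
    exact hz.differentiableAt (by exact_mod_cast hn)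
  have hO3 : fderiv ℝ (fderiv ℝ (fderiv ℝ h)) =O[𝓝 0] fun z => ‖z‖ ^ 1 := by
    have := (hc3.differentiableAt one_ne_zero).isBigO_sub
    simpa [eq_zero_of_odd ho3] using this.norm_right
  have hO2 := isBigO_pow_succ_of_fderiv (hev (n := 2) (by norm_num) hc2) h20 hO3
  have hO1 := isBigO_pow_succ_of_fderiv (hev (n := 3) (by norm_num) hc1) (eq_zero_of_odd ho1) hO2
  have h0 : h 0 = 0 := by simp [hh]
  refine isBigO_pow_succ_of_fderiv ?_ h0 hO1
  filter_upwards [hc.eventually (by simp)] with z hz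
  exact hz.differentiableAt (by norm_num)

theorem fderiv_zero_of_even {f : E → F} (heven : ∀ᶠ z in 𝓝 0, f (-z) = f z) :
    fderiv ℝ f 0 = 0 :=
  eq_zero_of_odd (fderiv_neg_eq_of_even heven)

/-- The Hessian as the second derivative along a line through the origin. -/
theorem deriv_deriv_line {f : E → ℝ} (hf : ContDiffAt ℝ 2 f 0) (u : E) :
    deriv (deriv fun r : ℝ => f (r • u)) 0 = fderiv ℝ (fderiv ℝ f) 0 u u := by
  have hline : ∀ r : ℝ, HasDerivAt (fun r : ℝ => r • u) u r := fun r => by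
    simpa using (hasDerivAt_id r).smul_const u
  have htend : Tendsto (fun r : ℝ => r • u) (𝓝 0) (𝓝 0) := by
    have : Continuous fun r : ℝ => r • u := by fun_prop
    simpa using this.tendsto 0
  have hev : ∀ᶠ z in 𝓝 0, DifferentiableAt ℝ f z := by
    filter_upwards [hf.eventually (by simp)] with z hz
    exact hz.differentiableAt (by norm_num)
  have h1 : deriv (fun r : ℝ => f (r • u)) =ᶠ[𝓝 0] fun r => fderiv ℝ f (r • u) u := by
    filter_upwards [htend.eventually hev] with r hr
    exact (hr.hasFDerivAt.comp_hasDerivAt r (hline r)).deriv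
  rw [h1.deriv_eq]
  have h2 : HasFDerivAt (fderiv ℝ f) (fderiv ℝ (fderiv ℝ f) 0) ((0 : ℝ) • u) := by
    rw [zero_smul]
    exact ((hf.fderiv_right (m := 1) (by norm_num)).differentiableAt one_ne_zero).hasFDerivAt
  have h3 := (h2.comp_hasDerivAt (0 : ℝ) (hline 0))
  have h4 := h3.clm_apply (hasDerivAt_const (0 : ℝ) u)
  simpa using h4.deriv

end EvenTaylor

/-! ### Kepler's equation -/

section Kepler

variable {e : ℝ}

theorem one_sub_mul_cos_pos (he0 : 0 ≤ e) (he1 : e < 1) (u : ℝ) : 0 < 1 - e * Real.cos u := by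
  nlinarith [Real.cos_le_one u, Real.neg_one_le_cos u]

theorem one_add_mul_cos_pos (he0 : 0 ≤ e) (he1 : e < 1) (u : ℝ) : 0 < 1 + e * Real.cos u := by
  nlinarith [Real.cos_le_one u, Real.neg_one_le_cos u]

theorem hasDerivAt_kepler (e u : ℝ) :
    HasDerivAt (fun u => u - e * Real.sin u) (1 - e * Real.cos u) u :=
  (hasDerivAt_id u).sub ((Real.hasDerivAt_sin u).const_mul e)

theorem strictMono_kepler (he0 : 0 ≤ e) (he1 : e < 1) :
    StrictMono fun u : ℝ => u - e * Real.sin u :=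
  strictMono_of_deriv_pos fun u => by
    rw [(hasDerivAt_kepler e u).deriv]; exact one_sub_mul_cos_pos he0 he1 u

theorem surjective_kepler (he0 : 0 ≤ e) :
    Function.Surjective fun u : ℝ => u - e * Real.sin u := by
  refine Continuous.surjective (by fun_prop) ?_ ?_
  · refine tendsto_atTop_mono (f := fun u => u + -e) (fun u => ?_)
      (tendsto_atTop_add_const_right _ _ tendsto_id)
    nlinarith [Real.sin_le_one u]
  · refine tendsto_atBot_mono (fun u => (?_ : u - e * Real.sin u ≤ u + e))
      (tendsto_atBot_add_const_right _ _ tendsto_id)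
    nlinarith [Real.neg_one_le_sin u]

theorem eccAnomaly_kepler (he0 : 0 ≤ e) (he1 : e < 1) (u : ℝ) :
    eccAnomaly e (u - e * Real.sin u) = u :=
  Function.leftInverse_invFun (strictMono_kepler he0 he1).injective u

theorem kepler_eccAnomaly (he0 : 0 ≤ e) (l : ℝ) :
    eccAnomaly e l - e * Real.sin (eccAnomaly e l) = l :=
  Function.invFun_eq (f := fun u : ℝ => u - e * Real.sin u) (surjective_kepler he0 l)

theorem eccAnomaly_add_two_pi (he0 : 0 ≤ e) (he1 : e < 1) (l : ℝ) :
    eccAnomaly e (l + 2 * Real.pi) = eccAnomaly e l + 2 * Real.pi := by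
  have h := eccAnomaly_kepler he0 he1 (eccAnomaly e l + 2 * Real.pi)
  rw [Real.sin_add_two_pi, add_sub_right_comm, kepler_eccAnomaly he0] at h
  exact h

/-- Averages over the mean anomaly as averages over the eccentric anomaly. -/
theorem integral_comp_eccAnomaly (he0 : 0 ≤ e) (he1 : e < 1) {h : ℝ → ℝ}
    (hh : Function.Periodic h (2 * Real.pi)) (c : ℝ) :
    ∫ l in (0 : ℝ)..(2 * Real.pi), h (eccAnomaly e (l + c)) =
      ∫ u in (0 : ℝ)..(2 * Real.pi), h u * (1 - e * Real.cos u) := by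
  have hper : Function.Periodic (fun l => h (eccAnomaly e l)) (2 * Real.pi) := fun l => by
    simp only [eccAnomaly_add_two_pi he0 he1]
    exact hh _
  -- Periodicity absorbs the phase `c`; then Kepler's equation `l = u - e sin u` is the
  -- substitution.
  rw [intervalIntegral.integral_comp_add_right (fun l => h (eccAnomaly e l)) c, zero_add,
    add_comm (2 * Real.pi) c, hper.intervalIntegral_add_eq c 0, zero_add]
  have key := intervalIntegral.integral_comp_mul_deriv_of_deriv_nonneg (a := 0)
    (b := 2 * Real.pi) (f := fun u => u - e * Real.sin u) (f' := fun u => 1 - e * Real.cos u)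
    (g := fun l => h (eccAnomaly e l)) (by fun_prop) (fun u _ => hasDerivAt_kepler e u)
    fun u _ => (one_sub_mul_cos_pos he0 he1 u).le
  simpa [eccAnomaly_kepler he0 he1] using key.symm

/-- The true anomaly as a function of the eccentric anomaly. -/
def trueAnomaly (e u : ℝ) : ℝ :=
  u + 2 * Real.arctan (e / (1 + √(1 - e ^ 2)) * Real.sin u /
    (1 - e / (1 + √(1 - e ^ 2)) * Real.cos u))

/-- `β` is the parameter in which both `e` and `√(1 - e²)` are rational. The properties of the true
anomaly become rational identities modulo `sin² + cos² = 1`. -/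
theorem exists_trueAnomaly_parameters (he0 : 0 ≤ e) (he1 : e < 1) :
    ∃ β s : ℝ, √(1 - e ^ 2) = s ∧ e / (1 + √(1 - e ^ 2)) = β ∧ 0 < s ∧ 0 ≤ β ∧ β < 1 ∧
      e = 2 * β / (1 + β ^ 2) ∧ s = (1 - β ^ 2) / (1 + β ^ 2) := by
  have h1 : 0 < 1 - e ^ 2 := by nlinarith
  have hs : 0 < √(1 - e ^ 2) := Real.sqrt_pos.2 h1
  have hs2 : √(1 - e ^ 2) ^ 2 = 1 - e ^ 2 := Real.sq_sqrt h1.le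
  refine ⟨_, _, rfl, rfl, hs, by positivity, ?_, ?_, ?_⟩
  · rw [div_lt_one (by positivity)]; linarith
  all_goals
    set s := √(1 - e ^ 2)
    have h3 : (1 + s) ^ 2 + e ^ 2 = 2 * (1 + s) := by linear_combination hs2
    have h4 : 1 + s ≠ 0 := by positivity
    have h5 : 1 + (e / (1 + s)) ^ 2 = 2 / (1 + s) := by
      field_simp
      linear_combination h3
    rw [h5]
    field_simp
  linear_combination hs2

/-- The arctangent is the argument of `1 - β exp(-iu)`, which stays in the right half-plane. Adding
its double to `u` therefore gives a branch of the true anomaly without jumps, unlike the half-angle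
tangent formula. -/
theorem trueAnomaly_spec (he0 : 0 ≤ e) (he1 : e < 1) (u : ℝ) :
    HasDerivAt (trueAnomaly e) (√(1 - e ^ 2) / (1 - e * Real.cos u)) u ∧
    Real.cos (trueAnomaly e u) = (Real.cos u - e) / (1 - e * Real.cos u) ∧
    Real.sin (trueAnomaly e u) = √(1 - e ^ 2) * Real.sin u / (1 - e * Real.cos u) := by
  obtain ⟨β, s, hs, hβ, hs0, hβ0, hβ1, hee, hse⟩ := exists_trueAnomaly_parameters he0 he1
  have hX : 0 < 1 - β * Real.cos u := one_sub_mul_cos_pos hβ0 hβ1 u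
  have hN : 0 < 1 + β ^ 2 - 2 * β * Real.cos u := by
    nlinarith [Real.sin_sq_add_cos_sq u, sq_nonneg (β * Real.sin u), mul_pos hX hX]
  have hsc := Real.sin_sq_add_cos_sq u
  have hr : 1 - e * Real.cos u = (1 + β ^ 2 - 2 * β * Real.cos u) / (1 + β ^ 2) := by
    rw [hee]; field_simp
  have hT : 1 + (β * Real.sin u / (1 - β * Real.cos u)) ^ 2 =
      (1 + β ^ 2 - 2 * β * Real.cos u) / (1 - β * Real.cos u) ^ 2 := by
    field_simp
    linear_combination β ^ 2 * hsc
  have hcosT : Real.cos (2 * Real.arctan (β * Real.sin u / (1 - β * Real.cos u))) =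
      ((1 - β * Real.cos u) ^ 2 - (β * Real.sin u) ^ 2) / (1 + β ^ 2 - 2 * β * Real.cos u) := by
    rw [Real.cos_two_mul, Real.cos_sq_arctan, hT]
    field_simp
    linear_combination β ^ 2 * hsc
  have hsinT : Real.sin (2 * Real.arctan (β * Real.sin u / (1 - β * Real.cos u))) =
      2 * (1 - β * Real.cos u) * (β * Real.sin u) / (1 + β ^ 2 - 2 * β * Real.cos u) := by
    have h1 : Real.sin (Real.arctan (β * Real.sin u / (1 - β * Real.cos u))) =
        β * Real.sin u / (1 - β * Real.cos u) *
          Real.cos (Real.arctan (β * Real.sin u / (1 - β * Real.cos u))) := by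
      rw [Real.sin_arctan, Real.cos_arctan]; ring
    rw [Real.sin_two_mul, h1, mul_assoc, mul_assoc, ← sq, Real.cos_sq_arctan, hT]
    field_simp
  have hdef : trueAnomaly e = fun u =>
      u + 2 * Real.arctan (β * Real.sin u / (1 - β * Real.cos u)) := by
    funext u; rw [trueAnomaly, hβ]
  rw [hs, hr, hdef]
  refine ⟨?_, ?_, ?_⟩
  · have h1 : HasDerivAt (fun u => β * Real.sin u / (1 - β * Real.cos u)) _ u :=
      ((Real.hasDerivAt_sin u).const_mul β).div
        (((Real.hasDerivAt_cos u).const_mul β).const_sub 1) hX.ne'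
    refine ((hasDerivAt_id u).add (h1.arctan.const_mul 2)).congr_deriv ?_
    rw [hT, hse]
    field_simp
    linear_combination (-2 * β ^ 2) * hsc
  · rw [Real.cos_add, hcosT, hsinT, hee]
    generalize 1 + β ^ 2 - 2 * β * Real.cos u = N at hN
    field_simp
    linear_combination (β ^ 2 * Real.cos u - 2 * β) * hsc
  · rw [Real.sin_add, hcosT, hsinT, hse]
    generalize 1 + β ^ 2 - 2 * β * Real.cos u = N at hN
    field_simp
    linear_combination (-β ^ 2) * Real.sin u * hsc

theorem trueAnomaly_zero (e : ℝ) : trueAnomaly e 0 = 0 := by simp [trueAnomaly]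

theorem trueAnomaly_two_pi (e : ℝ) : trueAnomaly e (2 * Real.pi) = 2 * Real.pi := by
  simp [trueAnomaly]

theorem continuous_trueAnomaly (he0 : 0 ≤ e) (he1 : e < 1) : Continuous (trueAnomaly e) :=
  continuous_iff_continuousAt.2 fun u => (trueAnomaly_spec he0 he1 u).1.continuousAt

/-- The polar equation of the ellipse. -/
theorem orbit_equation (he0 : 0 ≤ e) (he1 : e < 1) (u : ℝ) :
    (1 - e ^ 2) / (1 + e * Real.cos (trueAnomaly e u)) = 1 - e * Real.cos u := by
  have h := one_sub_mul_cos_pos he0 he1 u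
  have h1 : 0 < 1 - e ^ 2 := by nlinarith
  have h2 : 1 + e * Real.cos (trueAnomaly e u) = (1 - e ^ 2) / (1 - e * Real.cos u) := by
    rw [(trueAnomaly_spec he0 he1 u).2.1]
    field_simp
    ring
  rw [h2]
  field_simp

/-- Averages over the mean anomaly as weighted averages over the true anomaly. -/
theorem integral_comp_trueAnomaly (he0 : 0 ≤ e) (he1 : e < 1) {H : ℝ → ℝ} (hH : Continuous H) :
    ∫ u in (0 : ℝ)..(2 * Real.pi), H (trueAnomaly e u) * (1 - e * Real.cos u) =
      ∫ θ in (0 : ℝ)..(2 * Real.pi),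
        H θ * (((1 - e ^ 2) / (1 + e * Real.cos θ)) ^ 2 / √(1 - e ^ 2)) := by
  have hs : 0 < √(1 - e ^ 2) := Real.sqrt_pos.2 (by nlinarith)
  have hc : Continuous fun θ =>
      H θ * (((1 - e ^ 2) / (1 + e * Real.cos θ)) ^ 2 / √(1 - e ^ 2)) := by
    refine hH.mul (((continuous_const.div (by fun_prop) fun θ => ?_).pow 2).div_const _)
    exact (one_add_mul_cos_pos he0 he1 θ).ne'
  have key := intervalIntegral.integral_comp_mul_deriv (a := 0) (b := 2 * Real.pi)
    (f := trueAnomaly e) (f' := fun u => √(1 - e ^ 2) / (1 - e * Real.cos u))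
    (fun u _ => (trueAnomaly_spec he0 he1 u).1)
    (continuous_const.div (by fun_prop) fun u => (one_sub_mul_cos_pos he0 he1 u).ne').continuousOn
    hc
  rw [trueAnomaly_zero, trueAnomaly_two_pi] at key
  rw [← key]
  congr 1
  funext u
  have h := one_sub_mul_cos_pos he0 he1 u
  simp only [Function.comp_apply, orbit_equation he0 he1]
  field_simp

theorem keplerPos_eq (he0 : 0 ≤ e) (he1 : e < 1) (a u : ℝ) :
    keplerPos a e u = (a * (1 - e * Real.cos u)) •
      ![Real.cos (trueAnomaly e u), Real.sin (trueAnomaly e u), 0] := by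
  have h := one_sub_mul_cos_pos he0 he1 u
  obtain ⟨-, hc, hs⟩ := trueAnomaly_spec he0 he1 u
  rw [hc, hs, keplerPos]
  generalize 1 - e * Real.cos u = N at h
  ext i
  fin_cases i
  · simp; field_simp
  · simp; field_simp
  · simp

theorem keplerMom_weighted (he0 : 0 ≤ e) (he1 : e < 1) (β M a u : ℝ) (i : Fin 3) :
    keplerMom β M a e u i * (1 - e * Real.cos u) =
      β * √(M / a) * ![-Real.sin u, √(1 - e ^ 2) * Real.cos u, 0] i := by
  have h := one_sub_mul_cos_pos he0 he1 u
  simp only [keplerMom, Pi.smul_apply, smul_eq_mul]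
  field_simp

/-- The weight `dl/du = 1 - e cos u` cancels the denominator of the momentum and leaves a
combination of `sin u` and `cos u`. This is what removes the indirect term `y₁ · y₂ / m₀` from the
average. -/
theorem integral_mulVec_keplerMom (he0 : 0 ≤ e) (he1 : e < 1) (β M a : ℝ)
    (R : Matrix (Fin 3) (Fin 3) ℝ) (i : Fin 3) :
    ∫ u in (0 : ℝ)..(2 * Real.pi),
      R.mulVec (keplerMom β M a e u) i * (1 - e * Real.cos u) = 0 := by
  have h : ∀ u, R.mulVec (keplerMom β M a e u) i * (1 - e * Real.cos u) =
      -(R i 0 * (β * √(M / a))) * Real.sin u +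
        (R i 1 * (β * √(M / a)) * √(1 - e ^ 2)) * Real.cos u := fun u => by
    have h0 := keplerMom_weighted he0 he1 β M a u 0
    have h1 := keplerMom_weighted he0 he1 β M a u 1
    have h2 := keplerMom_weighted he0 he1 β M a u 2
    simp only [Matrix.mulVec, dotProduct, Fin.sum_univ_three]
    simp at h0 h1 h2
    rcases h2 with h2 | h2
    · rw [h2]; linear_combination R i 0 * h0 + R i 1 * h1
    · exact absurd h2 (one_sub_mul_cos_pos he0 he1 u).ne'
  simp_rw [h]
  rw [intervalIntegral.integral_add (Continuous.intervalIntegrable (by fun_prop) _ _)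
    (Continuous.intervalIntegrable (by fun_prop) _ _)]
  simp

end Kepler

/-! ### Orbits in terms of the true longitudes -/

/-- The sense of revolution of the planets in the plane orthogonal to `C`. -/
def orient (j : Fin 2) : ℝ := ![1, -1] j

/-- `√(1 - e j ²) = Γ j / Λ j`. -/
def circ (Λ : Fin 2 → ℝ) (z : Fin 3 ⊕ Fin 3 → ℝ) (j : Fin 2) : ℝ :=
  1 - (z (.inl j.castSucc) ^ 2 + z (.inr j.castSucc) ^ 2) / (2 * Λ j)

/-- `e j` times the cosine of the true anomaly, at true longitude `θ`. -/
def eccCos (Λ : Fin 2 → ℝ) (z : Fin 3 ⊕ Fin 3 → ℝ) (j : Fin 2) (θ : ℝ) : ℝ :=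
  √((1 + circ Λ z j) / (2 * Λ j)) *
    (z (.inl j.castSucc) * Real.cos θ + orient j * z (.inr j.castSucc) * Real.sin θ)

/-- The distance from the star at true longitude `θ`, in units of the semi-major axis. -/
def orbitRadius (Λ : Fin 2 → ℝ) (z : Fin 3 ⊕ Fin 3 → ℝ) (j : Fin 2) (θ : ℝ) : ℝ :=
  circ Λ z j ^ 2 / (1 + eccCos Λ z j θ)

/-- `|t₃|²`. -/
def nodeSq (z : Fin 3 ⊕ Fin 3 → ℝ) : ℝ := (z (.inl 2) ^ 2 + z (.inr 2) ^ 2) / 2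

/-- `1 - cos J` divided by `|t₃|²`, where `J` is the angle between the orbital planes. -/
def tilt (Λ : Fin 2 → ℝ) (z : Fin 3 ⊕ Fin 3 → ℝ) : ℝ :=
  (2 * (Λ 1 * circ Λ z 1 - Λ 0 * circ Λ z 0) + nodeSq z) /
    (2 * (Λ 0 * circ Λ z 0) * (Λ 1 * circ Λ z 1))

/-- `√2 |t₃|` times the sine of the angle from the node to the longitude `θ`. -/
def nodeSin (z : Fin 3 ⊕ Fin 3 → ℝ) (θ : ℝ) : ℝ :=
  z (.inr 2) * Real.cos θ - z (.inl 2) * Real.sin θ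

/-- The squared distance of the planets at true longitudes `θ₀`, `θ₁`. -/
def distSq (a Λ : Fin 2 → ℝ) (z : Fin 3 ⊕ Fin 3 → ℝ) (θ₀ θ₁ : ℝ) : ℝ :=
  (a 0 * orbitRadius Λ z 0 θ₀) ^ 2 + (a 1 * orbitRadius Λ z 1 θ₁) ^ 2 -
    2 * (a 0 * orbitRadius Λ z 0 θ₀) * (a 1 * orbitRadius Λ z 1 θ₁) *
      (Real.cos (θ₀ - θ₁) - tilt Λ z / 2 * nodeSin z θ₀ * nodeSin z θ₁)

/-- The inverse distance, weighted by the derivatives of the mean anomalies with respect to the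
true longitudes. -/
def orbitDensity (a Λ : Fin 2 → ℝ) (z : Fin 3 ⊕ Fin 3 → ℝ) (θ₀ θ₁ : ℝ) : ℝ :=
  orbitRadius Λ z 0 θ₀ ^ 2 * orbitRadius Λ z 1 θ₁ ^ 2 / (circ Λ z 0 * circ Λ z 1) /
    √(distSq a Λ z θ₀ θ₁)

/-! ### Eccentricity vectors and node without angles -/

section Coordinates

theorem norm_mul_cos_sub_arg (w : ℂ) (θ : ℝ) :
    ‖w‖ * Real.cos (θ - Complex.arg w) = w.re * Real.cos θ + w.im * Real.sin θ := by
  rw [Real.cos_sub, ← Complex.norm_mul_cos_arg w, ← Complex.norm_mul_sin_arg w]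
  simp only [Complex.norm_mul_cos_arg, Complex.norm_mul_sin_arg]
  linear_combination Real.cos θ * Complex.norm_mul_cos_arg w +
    Real.sin θ * Complex.norm_mul_sin_arg w

theorem norm_mul_sin_sub_arg (w : ℂ) (θ : ℝ) :
    ‖w‖ * Real.sin (θ - Complex.arg w) = w.re * Real.sin θ - w.im * Real.cos θ := by
  rw [Real.sin_sub]
  linear_combination Real.sin θ * Complex.norm_mul_cos_arg w -
    Real.cos θ * Complex.norm_mul_sin_arg w

variable (z : Fin 3 ⊕ Fin 3 → ℝ)

theorem I_mul_tCoord_zero : Complex.I * tCoord z 0 =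
    ⟨-z (.inl 0) / √2, -z (.inr 0) / √2⟩ := by
  apply Complex.ext <;> simp [tCoord, Complex.div_ofReal_re, Complex.div_ofReal_im, neg_div]

theorem tCoord_one : tCoord z 1 = ⟨z (.inl 1) / √2, -z (.inr 1) / √2⟩ := by
  apply Complex.ext <;> simp [tCoord, Complex.div_ofReal_re, Complex.div_ofReal_im, neg_div]

theorem I_mul_tCoord_two : Complex.I * tCoord z 2 =
    ⟨-z (.inl 2) / √2, -z (.inr 2) / √2⟩ := by
  apply Complex.ext <;> simp [tCoord, Complex.div_ofReal_re, Complex.div_ofReal_im, neg_div]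

theorem sq_norm_mk_div_sqrt_two (x y : ℝ) :
    ‖(⟨x / √2, y / √2⟩ : ℂ)‖ ^ 2 = (x ^ 2 + y ^ 2) / 2 := by
  rw [Complex.sq_norm, Complex.normSq_mk, div_mul_div_comm, div_mul_div_comm,
    Real.mul_self_sqrt zero_le_two]
  ring

theorem sq_norm_tCoord (j : Fin 3) :
    ‖tCoord z j‖ ^ 2 = (z (.inl j) ^ 2 + z (.inr j) ^ 2) / 2 := by
  have hI : ‖tCoord z j‖ = ‖Complex.I * tCoord z j‖ := by simp
  fin_cases j
  · rw [hI]
    simp only [Fin.zero_eta, I_mul_tCoord_zero, sq_norm_mk_div_sqrt_two]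
    ring
  · simp only [Fin.mk_one, tCoord_one, sq_norm_mk_div_sqrt_two]
    ring
  · rw [hI]
    simp only [Fin.reduceFinMk, I_mul_tCoord_two, sq_norm_mk_div_sqrt_two]
    ring

variable {Λ : Fin 2 → ℝ} {z}

theorem angMom_eq {j : Fin 2} (hΛ : 0 < Λ j) : angMom Λ z j = Λ j * circ Λ z j := by
  rw [angMom, sq_norm_tCoord, circ]
  field_simp

theorem totAngMom_eq (hΛ : ∀ j, 0 < Λ j) :
    totAngMom Λ z = Λ 1 * circ Λ z 1 - Λ 0 * circ Λ z 0 + nodeSq z := by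
  rw [totAngMom, angMom_eq (hΛ 0), angMom_eq (hΛ 1), sq_norm_tCoord, nodeSq]

theorem circ_le_one {j : Fin 2} (hΛ : 0 < Λ j) : circ Λ z j ≤ 1 := by
  rw [circ]
  have : 0 ≤ (z (.inl j.castSucc) ^ 2 + z (.inr j.castSucc) ^ 2) / (2 * Λ j) := by positivity
  linarith

theorem ecc_eq {j : Fin 2} (hΛ : 0 < Λ j) : ecc Λ z j = √(1 - circ Λ z j ^ 2) := by
  rw [ecc, angMom_eq hΛ, mul_div_cancel_left₀ _ hΛ.ne']

theorem one_sub_ecc_sq {j : Fin 2} (hΛ : 0 < Λ j) (hc : 0 < circ Λ z j) :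
    1 - ecc Λ z j ^ 2 = circ Λ z j ^ 2 := by
  rw [ecc_eq hΛ, Real.sq_sqrt]
  · ring
  · nlinarith [circ_le_one (z := z) hΛ]

theorem ecc_lt_one {j : Fin 2} (hΛ : 0 < Λ j) (hc : 0 < circ Λ z j) : ecc Λ z j < 1 := by
  have h := one_sub_ecc_sq hΛ hc
  nlinarith [pow_pos hc 2]

theorem ecc_nonneg (j : Fin 2) : 0 ≤ ecc Λ z j := Real.sqrt_nonneg _

/-- From `1 - c² = (1 + c)(1 - c)` and `1 - c = |t|²/Λ`, with `c` for `circ`. The only nonsmooth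
factor is the norm `|t|`, which combines with the cosine and sine of the argument of `t` into the
real coordinates. -/
theorem ecc_eq_norm_mul {j : Fin 2} (hΛ : 0 < Λ j) (hc : 0 < circ Λ z j) :
    ecc Λ z j = √((1 + circ Λ z j) / (2 * Λ j)) * (√2 * ‖tCoord z j.castSucc‖) := by
  rw [ecc_eq hΛ, ← Real.sqrt_sq (norm_nonneg (tCoord z j.castSucc)),
    ← Real.sqrt_mul zero_le_two, ← Real.sqrt_mul (by positivity), sq_norm_tCoord]
  congr 1
  have : (z (.inl j.castSucc) ^ 2 + z (.inr j.castSucc) ^ 2) = (1 - circ Λ z j) * (2 * Λ j) := by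
    rw [circ]; field_simp; ring
  rw [this]
  field_simp
  ring

/-- The angle on the left is the true anomaly at longitude `θ`; it decreases with `θ` because this
planet is retrograde. -/
theorem ecc_mul_cos_zero (hΛ : 0 < Λ 0) (hc : 0 < circ Λ z 0) (θ : ℝ) :
    ecc Λ z 0 * Real.cos (Real.pi + Complex.arg (Complex.I * tCoord z 0) - θ) =
      eccCos Λ z 0 θ := by
  have h := norm_mul_cos_sub_arg (Complex.I * tCoord z 0) θ
  have h1 : Real.pi + Complex.arg (Complex.I * tCoord z 0) - θ =
      Real.pi - (θ - Complex.arg (Complex.I * tCoord z 0)) := by ring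
  have hI : ‖Complex.I * tCoord z 0‖ = ‖tCoord z 0‖ := by simp
  rw [hI] at h
  rw [ecc_eq_norm_mul hΛ hc, h1, Real.cos_pi_sub, eccCos]
  rw [I_mul_tCoord_zero] at h ⊢
  have h2 : √2 * (√2)⁻¹ = 1 := mul_inv_cancel₀ (by positivity)
  simp only [Fin.castSucc_zero, orient, Matrix.cons_val_zero, div_eq_mul_inv] at h ⊢
  linear_combination (-√((1 + circ Λ z 0) * (2 * Λ 0)⁻¹) * √2) * h +
    √((1 + circ Λ z 0) * (2 * Λ 0)⁻¹) *
      (z (.inl 0) * Real.cos θ + z (.inr 0) * Real.sin θ) * h2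

theorem ecc_mul_cos_one (hΛ : 0 < Λ 1) (hc : 0 < circ Λ z 1) (θ : ℝ) :
    ecc Λ z 1 * Real.cos (θ - Complex.arg (tCoord z 1)) = eccCos Λ z 1 θ := by
  have h := norm_mul_cos_sub_arg (tCoord z 1) θ
  rw [ecc_eq_norm_mul hΛ hc, eccCos]
  have h3 : (Fin.castSucc (1 : Fin 2) : Fin 3) = 1 := rfl
  rw [h3, mul_assoc, mul_assoc, h]
  have h2 : √2 * (√2)⁻¹ = 1 := mul_inv_cancel₀ (by positivity)
  rw [tCoord_one]
  simp only [orient, Matrix.cons_val_one, Matrix.cons_val_fin_one, div_eq_mul_inv]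
  linear_combination √((1 + circ Λ z 1) * (2 * Λ 1)⁻¹) *
      (z (.inl 1) * Real.cos θ - z (.inr 1) * Real.sin θ) * h2

theorem norm_mul_sin_sub_nodeAngle (z : Fin 3 ⊕ Fin 3 → ℝ) (θ : ℝ) :
    √2 * (‖tCoord z 2‖ * Real.sin (θ - nodeAngle z)) = nodeSin z θ := by
  have h := norm_mul_sin_sub_arg (Complex.I * tCoord z 2) θ
  have hI : ‖Complex.I * tCoord z 2‖ = ‖tCoord z 2‖ := by simp
  rw [hI, ← nodeAngle, I_mul_tCoord_two] at h
  rw [h, nodeSin]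
  have h2 : √2 ≠ 0 := by positivity
  field_simp
  ring

/-- The factor `|t₃|²` makes up for the node being undefined at `t₃ = 0`: the product is a
polynomial in `(p, q)`. -/
theorem nodeSq_mul_sin_mul_sin (z : Fin 3 ⊕ Fin 3 → ℝ) (θ₀ θ₁ : ℝ) :
    nodeSq z * (Real.sin (θ₀ - nodeAngle z) * Real.sin (θ₁ - nodeAngle z)) =
      nodeSin z θ₀ * nodeSin z θ₁ / 2 := by
  rw [← norm_mul_sin_sub_nodeAngle, ← norm_mul_sin_sub_nodeAngle, nodeSq, ← sq_norm_tCoord]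
  have h2 : √2 * √2 = 2 := Real.mul_self_sqrt zero_le_two
  linear_combination (-‖tCoord z 2‖ ^ 2 * (Real.sin (θ₀ - nodeAngle z) *
    Real.sin (θ₁ - nodeAngle z)) / 2) * h2

end Coordinates

/-! ### The distance of the planets -/

/-- The conditions under which the coordinates describe two ellipses and a nondegenerate triangle
of angular momenta. -/
structure Admissible (Λ : Fin 2 → ℝ) (z : Fin 3 ⊕ Fin 3 → ℝ) : Prop where
  pos : ∀ j, 0 < Λ j
  circ_pos : ∀ j, 0 < circ Λ z j
  lt : Λ 0 * circ Λ z 0 < Λ 1 * circ Λ z 1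
  nodeSq_le : nodeSq z ≤ 2 * (Λ 0 * circ Λ z 0)

theorem nodeSq_nonneg (z : Fin 3 ⊕ Fin 3 → ℝ) : 0 ≤ nodeSq z := by rw [nodeSq]; positivity

/-- Two angles of a triangle determine the third. -/
theorem cos_arccos_add_arccos {a b c : ℝ} (ha : 0 < a) (hb : 0 < b) (hc : 0 < c)
    (h1 : c ≤ a + b) (h2 : a ≤ b + c) (h3 : b ≤ a + c) :
    Real.cos (Real.arccos ((c ^ 2 + a ^ 2 - b ^ 2) / (2 * c * a)) +
      Real.arccos ((c ^ 2 + b ^ 2 - a ^ 2) / (2 * c * b))) =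
      (c ^ 2 - a ^ 2 - b ^ 2) / (2 * a * b) := by
  -- Heron's expression, sixteen times the squared area of the triangle: its root is the numerator
  -- of both sines.
  have hS : 0 ≤ ((c + a) ^ 2 - b ^ 2) * (b ^ 2 - (c - a) ^ 2) := by
    apply mul_nonneg
    · nlinarith
    · nlinarith
  rw [Real.cos_add, Real.sin_arccos, Real.sin_arccos, Real.cos_arccos, Real.cos_arccos]
  · have e1 : 1 - ((c ^ 2 + a ^ 2 - b ^ 2) / (2 * c * a)) ^ 2 =
        (((c + a) ^ 2 - b ^ 2) * (b ^ 2 - (c - a) ^ 2)) / (2 * c * a) ^ 2 := by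
      field_simp; ring
    have e2 : 1 - ((c ^ 2 + b ^ 2 - a ^ 2) / (2 * c * b)) ^ 2 =
        (((c + a) ^ 2 - b ^ 2) * (b ^ 2 - (c - a) ^ 2)) / (2 * c * b) ^ 2 := by
      field_simp; ring
    rw [e1, e2, Real.sqrt_div hS, Real.sqrt_div hS, Real.sqrt_sq (by positivity),
      Real.sqrt_sq (by positivity), div_mul_div_comm (√_), Real.mul_self_sqrt hS]
    field_simp
    ring
  · rw [le_div_iff₀ (by positivity)]; nlinarith
  · rw [div_le_one (by positivity)]; nlinarith
  · rw [le_div_iff₀ (by positivity)]; nlinarith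
  · rw [div_le_one (by positivity)]; nlinarith

/-- The law of cosines in the triangle of angular momenta. Inserting `C = Γ₂ - Γ₁ + |t₃|²` makes the
factor `|t₃|²` explicit, so the value `-1` of opposite angular momenta is attained at the origin. -/
theorem Admissible.cos_inclination {Λ : Fin 2 → ℝ} {z : Fin 3 ⊕ Fin 3 → ℝ}
    (h : Admissible Λ z) :
    Real.cos (inclination Λ z 0 + inclination Λ z 1) = nodeSq z * tilt Λ z - 1 := by
  have h0 := mul_pos (h.pos 0) (h.circ_pos 0)
  have h1 := mul_pos (h.pos 1) (h.circ_pos 1)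
  have hlt := h.lt
  have hle := h.nodeSq_le
  have hn := nodeSq_nonneg z
  rw [inclination, inclination, sub_zero, sub_self, totAngMom_eq h.pos, angMom_eq (h.pos 0),
    angMom_eq (h.pos 1), tilt]
  generalize Λ 0 * circ Λ z 0 = a at *
  generalize Λ 1 * circ Λ z 1 = b at *
  rw [cos_arccos_add_arccos h0 h1 (by linarith) (by linarith) (by linarith) (by linarith)]
  field_simp
  ring

theorem rotation_mulVec (α i γ θ : ℝ) :
    (rot3 α * rot1 i * rot3 γ).mulVec ![Real.cos θ, Real.sin θ, 0] =
      ![Real.cos α * Real.cos (θ + γ) - Real.sin α * (Real.cos i * Real.sin (θ + γ)),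
        Real.sin α * Real.cos (θ + γ) + Real.cos α * (Real.cos i * Real.sin (θ + γ)),
        Real.sin i * Real.sin (θ + γ)] := by
  rw [← Matrix.mulVec_mulVec, ← Matrix.mulVec_mulVec]
  have h1 : (rot3 γ).mulVec ![Real.cos θ, Real.sin θ, 0] =
      ![Real.cos (θ + γ), Real.sin (θ + γ), 0] := by
    ext k
    fin_cases k <;>
      simp [rot3, Matrix.mulVec, dotProduct, Fin.sum_univ_three, Real.cos_add, Real.sin_add] <;>
      ring
  rw [h1]
  ext k
  fin_cases k <;>
    simp [rot3, rot1, Matrix.mulVec, dotProduct, Fin.sum_univ_three]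
  ring

/-- The nodes being opposite, both orbital planes contain the same node line and are tilted about it
to opposite sides, so only the sum of the inclinations survives. -/
theorem sum_sq_sub_rotation (ψ i₀ i₁ w₀ w₁ r₀ r₁ : ℝ) :
    ∑ k : Fin 3, ((r₀ • ![Real.cos (ψ + Real.pi) * Real.cos w₀ -
          Real.sin (ψ + Real.pi) * (Real.cos i₀ * Real.sin w₀),
        Real.sin (ψ + Real.pi) * Real.cos w₀ +
          Real.cos (ψ + Real.pi) * (Real.cos i₀ * Real.sin w₀),
        Real.sin i₀ * Real.sin w₀]) k -
      (r₁ • ![Real.cos ψ * Real.cos w₁ - Real.sin ψ * (Real.cos i₁ * Real.sin w₁),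
        Real.sin ψ * Real.cos w₁ + Real.cos ψ * (Real.cos i₁ * Real.sin w₁),
        Real.sin i₁ * Real.sin w₁]) k) ^ 2 =
      r₀ ^ 2 + r₁ ^ 2 + 2 * r₀ * r₁ *
        (Real.cos w₀ * Real.cos w₁ + Real.cos (i₀ + i₁) * (Real.sin w₀ * Real.sin w₁)) := by
  have hψ := Real.sin_sq_add_cos_sq ψ
  have h0 := Real.sin_sq_add_cos_sq i₀
  have h1 := Real.sin_sq_add_cos_sq i₁
  have k0 := Real.sin_sq_add_cos_sq w₀
  have k1 := Real.sin_sq_add_cos_sq w₁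
  simp only [Fin.sum_univ_three, Pi.smul_apply, smul_eq_mul, Matrix.cons_val_zero,
    Matrix.cons_val_one, Matrix.cons_val, Real.cos_add_pi, Real.sin_add_pi]
  rw [Real.cos_add]
  generalize Real.sin ψ = sψ at *
  generalize Real.cos ψ = cψ at *
  generalize Real.sin i₀ = s0 at *
  generalize Real.cos i₀ = c0 at *
  generalize Real.sin i₁ = s1 at *
  generalize Real.cos i₁ = c1 at *
  generalize Real.sin w₀ = S0 at *
  generalize Real.cos w₀ = C0 at *
  generalize Real.sin w₁ = S1 at *
  generalize Real.cos w₁ = C1 at *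
  linear_combination ((r₀ * C0 + r₁ * C1) ^ 2 + (r₀ * c0 * S0 + r₁ * c1 * S1) ^ 2) * hψ +
    r₀ ^ 2 * S0 ^ 2 * h0 + r₁ ^ 2 * S1 ^ 2 * h1 + r₀ ^ 2 * k0 + r₁ ^ 2 * k1

/-- The shift from the eccentric anomalies to the true longitudes. -/
def longitudeShift (z : Fin 3 ⊕ Fin 3 → ℝ) : Fin 2 → ℝ :=
  ![Real.pi + Complex.arg (Complex.I * tCoord z 0), Complex.arg (tCoord z 1)]

/-- In terms of longitudes the arguments of latitude are `π - (θ₀ - ψ)` and `θ₁ - ψ`. The part `-1`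
of the cosine of the mutual inclination then builds `cos (θ₀ - θ₁)`, and the part proportional to
`|t₃|²` gives the node term. -/
theorem Admissible.sum_sq_sub {Λ : Fin 2 → ℝ} {z : Fin 3 ⊕ Fin 3 → ℝ}
    (h : Admissible Λ z) (a : Fin 2 → ℝ) (u₀ u₁ : ℝ) :
    ∑ k : Fin 3, ((orbitRotation Λ z 0).mulVec (keplerPos (a 0) (ecc Λ z 0) u₀) k -
        (orbitRotation Λ z 1).mulVec (keplerPos (a 1) (ecc Λ z 1) u₁) k) ^ 2 =
      distSq a Λ z (longitudeShift z 0 - trueAnomaly (ecc Λ z 0) u₀)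
        (trueAnomaly (ecc Λ z 1) u₁ + longitudeShift z 1) := by
  have e0 := ecc_lt_one (h.pos 0) (h.circ_pos 0)
  have e1 := ecc_lt_one (h.pos 1) (h.circ_pos 1)
  have r0 : orbitRadius Λ z 0 (longitudeShift z 0 - trueAnomaly (ecc Λ z 0) u₀) =
      1 - ecc Λ z 0 * Real.cos u₀ := by
    rw [orbitRadius, ← ecc_mul_cos_zero (h.pos 0) (h.circ_pos 0),
      ← orbit_equation (ecc_nonneg 0) e0, one_sub_ecc_sq (h.pos 0) (h.circ_pos 0)]
    simp [longitudeShift]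
  have r1 : orbitRadius Λ z 1 (trueAnomaly (ecc Λ z 1) u₁ + longitudeShift z 1) =
      1 - ecc Λ z 1 * Real.cos u₁ := by
    rw [orbitRadius, ← ecc_mul_cos_one (h.pos 1) (h.circ_pos 1),
      ← orbit_equation (ecc_nonneg 1) e1, one_sub_ecc_sq (h.pos 1) (h.circ_pos 1)]
    simp [longitudeShift]
  rw [keplerPos_eq (ecc_nonneg 0) e0, keplerPos_eq (ecc_nonneg 1) e1, Matrix.mulVec_smul,
    Matrix.mulVec_smul, orbitRotation, orbitRotation, rotation_mulVec, rotation_mulVec]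
  have hadd : nodeAngle z + ![Real.pi, 0] 1 = nodeAngle z := by simp
  have hadd0 : nodeAngle z + ![Real.pi, 0] 0 = nodeAngle z + Real.pi := by simp
  rw [hadd, hadd0, sum_sq_sub_rotation, h.cos_inclination, distSq, r0, r1]
  generalize trueAnomaly (ecc Λ z 0) u₀ = θ₀
  generalize trueAnomaly (ecc Λ z 1) u₁ = θ₁
  have w0 : θ₀ + periArg z 0 = Real.pi - (longitudeShift z 0 - θ₀ - nodeAngle z) := by
    simp [longitudeShift, periArg]; ring
  have w1 : θ₁ + periArg z 1 = θ₁ + longitudeShift z 1 - nodeAngle z := by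
    simp [longitudeShift, periArg]; ring
  have key := nodeSq_mul_sin_mul_sin z (longitudeShift z 0 - θ₀) (θ₁ + longitudeShift z 1)
  rw [w0, w1, Real.cos_pi_sub, Real.sin_pi_sub]
  generalize longitudeShift z 0 - θ₀ = ϑ₀ at *
  generalize θ₁ + longitudeShift z 1 = ϑ₁ at *
  have hcos : Real.cos (ϑ₀ - ϑ₁) = Real.cos (ϑ₀ - nodeAngle z) * Real.cos (ϑ₁ - nodeAngle z) +
      Real.sin (ϑ₀ - nodeAngle z) * Real.sin (ϑ₁ - nodeAngle z) := by
    rw [← Real.cos_sub]; congr 1; ring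
  rw [hcos]
  linear_combination (2 * (a 0 * (1 - ecc Λ z 0 * Real.cos u₀)) *
    (a 1 * (1 - ecc Λ z 1 * Real.cos u₁)) * tilt Λ z) * key

/-! ### The average as an integral over the true longitudes -/

theorem orbitRotation_mulVec_keplerPos_periodic (R : Matrix (Fin 3) (Fin 3) ℝ) (a e : ℝ)
    (u : ℝ) : R.mulVec (keplerPos a e (u + 2 * Real.pi)) = R.mulVec (keplerPos a e u) := by
  simp [keplerPos]

theorem orbitRotation_mulVec_keplerMom_periodic (R : Matrix (Fin 3) (Fin 3) ℝ) (β M a e : ℝ)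
    (u : ℝ) : R.mulVec (keplerMom β M a e (u + 2 * Real.pi)) = R.mulVec (keplerMom β M a e u) := by
  simp [keplerMom]

theorem continuous_mulVec_keplerMom {e : ℝ} (he0 : 0 ≤ e) (he1 : e < 1)
    (R : Matrix (Fin 3) (Fin 3) ℝ) (β M a : ℝ) (k : Fin 3) :
    Continuous fun u => R.mulVec (keplerMom β M a e u) k := by
  have h : ∀ i, Continuous fun u => keplerMom β M a e u i := fun i => by
    have h1 : Continuous fun u : ℝ => β * √(M / a) / (1 - e * Real.cos u) :=
      continuous_const.div (by fun_prop) fun u => (one_sub_mul_cos_pos he0 he1 u).ne'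
    fin_cases i <;> simp [keplerMom] <;> fun_prop
  simp only [Matrix.mulVec, dotProduct, Fin.sum_univ_three]
  have h0 := h 0
  have h1 := h 1
  have h2 := h 2
  fun_prop

/-- With the outer planet frozen at momentum `v`, averaging over the inner one alone already kills
the scalar product. -/
theorem integral_dotProduct_sub {e : ℝ} (he0 : 0 ≤ e) (he1 : e < 1) {y : ℝ → Fin 3 → ℝ}
    (hy : ∀ k, Continuous fun u => y u k)
    (hy0 : ∀ k, ∫ u in (0 : ℝ)..(2 * Real.pi), y u k * (1 - e * Real.cos u) = 0)
    (v : Fin 3 → ℝ) (c : ℝ) {H : ℝ → ℝ} (hH : Continuous H) :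
    ∫ u in (0 : ℝ)..(2 * Real.pi),
      (v ⬝ᵥ y u / c - H (trueAnomaly e u)) * (1 - e * Real.cos u) =
      -∫ θ in (0 : ℝ)..(2 * Real.pi),
        H θ * (((1 - e ^ 2) / (1 + e * Real.cos θ)) ^ 2 / √(1 - e ^ 2)) := by
  have hT := continuous_trueAnomaly he0 he1
  have hc : Continuous fun u : ℝ => 1 - e * Real.cos u := by fun_prop
  have hHT : Continuous fun u => H (trueAnomaly e u) * (1 - e * Real.cos u) :=
    (hH.comp hT).mul hc
  have h : ∀ u, v ⬝ᵥ y u / c * (1 - e * Real.cos u) =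
      ∑ k, v k / c * (y u k * (1 - e * Real.cos u)) := fun u => by
    rw [dotProduct, Finset.sum_div, Finset.sum_mul]
    exact Finset.sum_congr rfl fun k _ => by ring
  have hk : ∀ k, Continuous fun u => v k / c * (y u k * (1 - e * Real.cos u)) := fun k =>
    continuous_const.mul ((hy k).mul hc)
  simp_rw [sub_mul, h]
  rw [intervalIntegral.integral_sub
      ((continuous_finsetSum _ fun k _ => hk k).intervalIntegrable _ _)
      (hHT.intervalIntegrable _ _),
    intervalIntegral.integral_finsetSum fun k _ => (hk k).intervalIntegrable _ _,
    integral_comp_trueAnomaly he0 he1 hH]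
  simp only [intervalIntegral.integral_const_mul, hy0, mul_zero, Finset.sum_const_zero, zero_sub]

theorem Admissible.one_add_eccCos_pos {Λ : Fin 2 → ℝ} {z : Fin 3 ⊕ Fin 3 → ℝ}
    (h : Admissible Λ z) (j : Fin 2) (θ : ℝ) : 0 < 1 + eccCos Λ z j θ := by
  fin_cases j
  · simp only [Fin.zero_eta, ← ecc_mul_cos_zero (h.pos 0) (h.circ_pos 0)]
    exact one_add_mul_cos_pos (ecc_nonneg _) (ecc_lt_one (h.pos 0) (h.circ_pos 0)) _
  · simp only [Fin.mk_one, ← ecc_mul_cos_one (h.pos 1) (h.circ_pos 1)]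
    exact one_add_mul_cos_pos (ecc_nonneg _) (ecc_lt_one (h.pos 1) (h.circ_pos 1)) _

theorem Admissible.continuous_orbitRadius {Λ : Fin 2 → ℝ} {z : Fin 3 ⊕ Fin 3 → ℝ}
    (h : Admissible Λ z) (j : Fin 2) : Continuous (orbitRadius Λ z j) := by
  unfold orbitRadius
  refine continuous_const.div ?_ fun θ => (h.one_add_eccCos_pos j θ).ne'
  unfold eccCos
  fun_prop

theorem Admissible.continuous_distSq {Λ : Fin 2 → ℝ} {z : Fin 3 ⊕ Fin 3 → ℝ}
    (h : Admissible Λ z) (a : Fin 2 → ℝ) :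
    Continuous fun p : ℝ × ℝ => distSq a Λ z p.1 p.2 := by
  have h0 := h.continuous_orbitRadius 0
  have h1 := h.continuous_orbitRadius 1
  unfold distSq nodeSin
  fun_prop

theorem eccCos_add_two_pi (Λ : Fin 2 → ℝ) (z : Fin 3 ⊕ Fin 3 → ℝ) (j : Fin 2) (θ : ℝ) :
    eccCos Λ z j (θ + 2 * Real.pi) = eccCos Λ z j θ := by
  simp [eccCos]

theorem orbitRadius_add_two_pi (Λ : Fin 2 → ℝ) (z : Fin 3 ⊕ Fin 3 → ℝ) (j : Fin 2) (θ : ℝ) :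
    orbitRadius Λ z j (θ + 2 * Real.pi) = orbitRadius Λ z j θ := by
  simp [orbitRadius, eccCos_add_two_pi]

theorem orbitDensity_add_two_pi_left (a Λ : Fin 2 → ℝ) (z : Fin 3 ⊕ Fin 3 → ℝ) (θ₀ θ₁ : ℝ) :
    orbitDensity a Λ z (θ₀ + 2 * Real.pi) θ₁ = orbitDensity a Λ z θ₀ θ₁ := by
  simp [orbitDensity, distSq, orbitRadius_add_two_pi, nodeSin, add_sub_right_comm]

theorem orbitDensity_add_two_pi_right (a Λ : Fin 2 → ℝ) (z : Fin 3 ⊕ Fin 3 → ℝ) (θ₀ θ₁ : ℝ) :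
    orbitDensity a Λ z θ₀ (θ₁ + 2 * Real.pi) = orbitDensity a Λ z θ₀ θ₁ := by
  simp [orbitDensity, distSq, orbitRadius_add_two_pi, nodeSin, ← sub_sub]

theorem integral_comp_add_of_periodic {g : ℝ → ℝ} {T : ℝ} (hg : Function.Periodic g T) (c : ℝ) :
    ∫ x in (0 : ℝ)..T, g (x + c) = ∫ x in (0 : ℝ)..T, g x := by
  rw [intervalIntegral.integral_comp_add_right, zero_add, add_comm T c,
    hg.intervalIntegral_add_eq c 0, zero_add]

theorem integral_comp_sub_of_periodic {g : ℝ → ℝ} {T : ℝ} (hg : Function.Periodic g T) (c : ℝ) :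
    ∫ x in (0 : ℝ)..T, g (c - x) = ∫ x in (0 : ℝ)..T, g x := by
  rw [intervalIntegral.integral_comp_sub_left, sub_zero]
  have h := hg.intervalIntegral_add_eq (c - T) 0
  rw [sub_add_cancel, zero_add] at h
  exact h

/-- The average of the perturbing function, as an integral over the true longitudes. -/
theorem averaged_eq_integral {m₀ μ : ℝ} {m Λ : Fin 2 → ℝ} {z : Fin 3 ⊕ Fin 3 → ℝ}
    (h : Admissible Λ z) (hD : ∀ θ₀ θ₁, 0 < distSq (semiAxis m₀ μ m Λ) Λ z θ₀ θ₁) :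
    averaged m₀ μ m Λ z = -(m 0 * m 1 / (2 * Real.pi) ^ 2) *
      ∫ θ₀ in (0 : ℝ)..(2 * Real.pi), ∫ θ₁ in (0 : ℝ)..(2 * Real.pi),
        orbitDensity (semiAxis m₀ μ m Λ) Λ z θ₀ θ₁ := by
  set a := semiAxis m₀ μ m Λ with ha
  set R₀ := orbitRotation Λ z 0
  set R₁ := orbitRotation Λ z 1
  set e₀ := ecc Λ z 0 with he₀
  set e₁ := ecc Λ z 1 with he₁
  have n0 : 0 ≤ e₀ := ecc_nonneg 0
  have n1 : 0 ≤ e₁ := ecc_nonneg 1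
  have l0 : e₀ < 1 := ecc_lt_one (h.pos 0) (h.circ_pos 0)
  have l1 : e₁ < 1 := ecc_lt_one (h.pos 1) (h.circ_pos 1)
  set y₀ : ℝ → Fin 3 → ℝ := fun u =>
    R₀.mulVec (keplerMom (redMass m₀ μ m 0) (totMass m₀ μ m 0) (a 0) e₀ u) with hy₀
  set y₁ : ℝ → Fin 3 → ℝ := fun u =>
    R₁.mulVec (keplerMom (redMass m₀ μ m 1) (totMass m₀ μ m 1) (a 1) e₁ u) with hy₁
  set P : ℝ → ℝ → ℝ := fun u₀ u₁ => y₀ u₀ ⬝ᵥ y₁ u₁ / m₀ - m 0 * m 1 /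
    √(∑ k : Fin 3, (R₀.mulVec (keplerPos (a 0) e₀ u₀) k -
      R₁.mulVec (keplerPos (a 1) e₁ u₁) k) ^ 2) with hP
  set V : ℝ → ℝ → ℝ := fun θ₀ θ₁ => m 0 * m 1 /
    √(distSq a Λ z (longitudeShift z 0 - θ₀) (θ₁ + longitudeShift z 1)) with hV
  have hVc : Continuous fun p : ℝ × ℝ => V p.1 p.2 := by
    refine continuous_const.div ?_ fun p => (Real.sqrt_pos.2 (hD _ _)).ne'
    exact Real.continuous_sqrt.comp ((h.continuous_distSq a).comp
      (f := fun p : ℝ × ℝ => (longitudeShift z 0 - p.1, p.2 + longitudeShift z 1)) (by fun_prop))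
  have hPV : ∀ u₀ u₁, P u₀ u₁ = y₀ u₀ ⬝ᵥ y₁ u₁ / m₀ -
      V (trueAnomaly e₀ u₀) (trueAnomaly e₁ u₁) := fun u₀ u₁ => by
    simp only [hP, hV, ← h.sum_sq_sub a u₀ u₁, R₀, R₁, he₀, he₁]
  have hpert : ∀ l₁ l₂, perturbation m₀ μ m Λ ![l₁, l₂] z =
      P (eccAnomaly e₀ (l₁ + Complex.arg (Complex.I * tCoord z 0)))
        (eccAnomaly e₁ (l₂ + -Complex.arg (tCoord z 1))) := fun l₁ l₂ => by
    -- The node angle cancels in both mean anomalies: each is the mean longitude plus a phase.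
    have a0 : meanAnomaly ![l₁, l₂] z 0 = l₁ + Complex.arg (Complex.I * tCoord z 0) := by
      simp [meanAnomaly, periArg]
      ring
    have a1 : meanAnomaly ![l₁, l₂] z 1 = l₂ + -Complex.arg (tCoord z 1) := by
      simp [meanAnomaly, periArg]
      ring
    simp only [perturbation, momentum, position, a0, a1, hP, hy₀, hy₁, R₀, R₁, he₀, he₁, ha]
  have hP0 : ∀ u₁, Function.Periodic (fun u₀ => P u₀ u₁) (2 * Real.pi) := fun u₁ u₀ => by
    simp only [hP, hy₀, orbitRotation_mulVec_keplerPos_periodic,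
      orbitRotation_mulVec_keplerMom_periodic]
  have hP1 : ∀ u₀, Function.Periodic (fun u₁ => P u₀ u₁) (2 * Real.pi) := fun u₀ u₁ => by
    simp only [hP, hy₁, orbitRotation_mulVec_keplerPos_periodic,
      orbitRotation_mulVec_keplerMom_periodic]
  set w₀ : ℝ → ℝ := fun θ => ((1 - e₀ ^ 2) / (1 + e₀ * Real.cos θ)) ^ 2 / √(1 - e₀ ^ 2) with hw₀
  set w₁ : ℝ → ℝ := fun θ => ((1 - e₁ ^ 2) / (1 + e₁ * Real.cos θ)) ^ 2 / √(1 - e₁ ^ 2) with hw₁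
  have hw₁c : Continuous w₁ := by
    refine ((continuous_const.div (by fun_prop) fun θ => ?_).pow 2).div_const _
    exact (one_add_mul_cos_pos n1 l1 θ).ne'
  have hin : ∀ u₀, ∫ u₁ in (0 : ℝ)..(2 * Real.pi), P u₀ u₁ * (1 - e₁ * Real.cos u₁) =
      -∫ θ₁ in (0 : ℝ)..(2 * Real.pi), V (trueAnomaly e₀ u₀) θ₁ * w₁ θ₁ := fun u₀ => by
    have hVc' : Continuous fun θ₁ => V (trueAnomaly e₀ u₀) θ₁ :=
      hVc.comp (f := fun θ₁ => (trueAnomaly e₀ u₀, θ₁)) (by fun_prop)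
    simp_rw [hPV]
    exact integral_dotProduct_sub n1 l1
      (fun k => continuous_mulVec_keplerMom n1 l1 R₁ _ _ _ k)
      (fun k => integral_mulVec_keplerMom n1 l1 _ _ _ R₁ k) (y₀ u₀) m₀ hVc'
  have hHc : Continuous fun θ₀ => ∫ θ₁ in (0 : ℝ)..(2 * Real.pi), V θ₀ θ₁ * w₁ θ₁ := by
    refine intervalIntegral.continuous_parametric_intervalIntegral_of_continuous' ?_ _ _
    exact hVc.mul (hw₁c.comp continuous_snd)
  have hdens : ∀ θ₀ θ₁, V θ₀ θ₁ * w₁ θ₁ * w₀ θ₀ = m 0 * m 1 *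
      orbitDensity a Λ z (longitudeShift z 0 - θ₀) (θ₁ + longitudeShift z 1) := fun θ₀ θ₁ => by
    have c0 : eccCos Λ z 0 (longitudeShift z 0 - θ₀) = e₀ * Real.cos θ₀ := by
      rw [← ecc_mul_cos_zero (h.pos 0) (h.circ_pos 0)]
      simp [longitudeShift, he₀]
    have c1 : eccCos Λ z 1 (θ₁ + longitudeShift z 1) = e₁ * Real.cos θ₁ := by
      rw [← ecc_mul_cos_one (h.pos 1) (h.circ_pos 1)]
      simp [longitudeShift, he₁]
    simp only [hV, hw₀, hw₁, orbitDensity, orbitRadius, c0, c1,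
      Real.sqrt_sq (h.circ_pos _).le, one_sub_ecc_sq (h.pos _) (h.circ_pos _),
      he₀, he₁]
    ring
  have hper0 : Function.Periodic (fun u₀ => ∫ u₁ in (0 : ℝ)..(2 * Real.pi),
      P u₀ u₁ * (1 - e₁ * Real.cos u₁)) (2 * Real.pi) := fun u₀ => by
    simp only [fun u₁ => hP0 u₁ u₀]
  rw [averaged]
  simp_rw [hpert]
  simp_rw [fun u₀ => integral_comp_eccAnomaly n1 l1 (hP1 u₀) (-Complex.arg (tCoord z 1))]
  rw [integral_comp_eccAnomaly n0 l0 hper0]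
  simp_rw [hin, neg_mul]
  rw [intervalIntegral.integral_neg, integral_comp_trueAnomaly n0 l0 hHc]
  simp_rw [← intervalIntegral.integral_mul_const]
  -- From anomalies to longitudes: a shift for the inner planet here, a reflection for the outer one
  -- in `hout`, both harmless on a full period.
  have hin2 : ∀ θ₀, ∫ θ₁ in (0 : ℝ)..(2 * Real.pi), V θ₀ θ₁ * w₁ θ₁ * w₀ θ₀ =
      m 0 * m 1 * ∫ θ₁ in (0 : ℝ)..(2 * Real.pi),
        orbitDensity a Λ z (longitudeShift z 0 - θ₀) θ₁ := fun θ₀ => by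
    simp_rw [hdens]
    rw [intervalIntegral.integral_const_mul, integral_comp_add_of_periodic
      (g := fun θ₁ => orbitDensity a Λ z (longitudeShift z 0 - θ₀) θ₁)]
    exact fun θ₁ => orbitDensity_add_two_pi_right a Λ z _ θ₁
  have hout : ∫ θ₀ in (0 : ℝ)..(2 * Real.pi), ∫ θ₁ in (0 : ℝ)..(2 * Real.pi),
      V θ₀ θ₁ * w₁ θ₁ * w₀ θ₀ = m 0 * m 1 * ∫ θ₀ in (0 : ℝ)..(2 * Real.pi),
        ∫ θ₁ in (0 : ℝ)..(2 * Real.pi), orbitDensity a Λ z θ₀ θ₁ := by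
    simp_rw [hin2]
    rw [intervalIntegral.integral_const_mul, integral_comp_sub_of_periodic
      (g := fun θ₀ => ∫ θ₁ in (0 : ℝ)..(2 * Real.pi), orbitDensity a Λ z θ₀ θ₁)]
    intro θ₀
    simp only [orbitDensity_add_two_pi_left]
  rw [hout]
  ring

/-! ### Double integrals depending on parameters -/

section DoubleIntegral

variable {E : Type} [NormedAddCommGroup E] [NormedSpace ℝ E]

theorem isOpen_setOf_contDiffAt {F : Type*} [NormedAddCommGroup F] [NormedSpace ℝ F]
    (G : E → F) (n : ℕ) : IsOpen {p | ContDiffAt ℝ n G p} :=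
  isOpen_iff_mem_nhds.2 fun p (hp : ContDiffAt ℝ n G p) => hp.eventually (by simp)

theorem contDiffAt_integral_integral [FiniteDimensional ℝ E] {G : (E × ℝ) × ℝ → ℝ} {n : ℕ}
    {z : E} {T : ℝ} (hT : 0 ≤ T)
    (h : ∀ θ₀ ∈ Set.Icc 0 T, ∀ θ₁ ∈ Set.Icc 0 T, ContDiffAt ℝ n G ((z, θ₀), θ₁)) :
    ContDiffAt ℝ n (fun z => ∫ θ₀ in (0 : ℝ)..T, ∫ θ₁ in (0 : ℝ)..T, G ((z, θ₀), θ₁)) z := by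
  have hW := isOpen_setOf_contDiffAt G n
  have hG : ContDiffOn ℝ n G {p | ContDiffAt ℝ n G p} := fun p (hp : ContDiffAt ℝ n G p) =>
    hp.contDiffWithinAt
  have hW1 := isOpen_setOf_forall_prod_mem hW (isCompact_Icc (a := 0) (b := T))
  have hG1 := contDiffOn_integral hW hT n hG
  exact (contDiffOn_integral hW1 hT n hG1).contDiffAt
    ((isOpen_setOf_forall_prod_mem hW1 isCompact_Icc).mem_nhds h)

theorem hasDerivAt_integral_integral {G : (ℝ × ℝ) × ℝ → ℝ} {W : Set ((ℝ × ℝ) × ℝ)}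
    (hW : IsOpen W) (hG : ContDiffOn ℝ 1 G W) {r T : ℝ} (hT : 0 ≤ T)
    (h : ∀ θ₀ ∈ Set.Icc 0 T, ∀ θ₁ ∈ Set.Icc 0 T, ((r, θ₀), θ₁) ∈ W) :
    HasDerivAt (fun r => ∫ θ₀ in (0 : ℝ)..T, ∫ θ₁ in (0 : ℝ)..T, G ((r, θ₀), θ₁))
      (∫ θ₀ in (0 : ℝ)..T, ∫ θ₁ in (0 : ℝ)..T, fderiv ℝ G ((r, θ₀), θ₁) ((1, 0), 0)) r := by
  have hW1 := isOpen_setOf_forall_prod_mem hW (isCompact_Icc (a := 0) (b := T))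
  have hG1 := contDiffOn_integral hW hT 1 (by exact_mod_cast hG)
  have key := hasDerivAt_integral_of_contDiffOn hW1 (by exact_mod_cast hG1) hT (r := r)
    (fun θ₀ h₀ => h θ₀ h₀)
  refine key.congr_deriv (intervalIntegral.integral_congr fun θ₀ h₀ => ?_)
  rw [Set.uIcc_of_le hT] at h₀
  have hf' : ContinuousOn
      (fun p => (fderiv ℝ G p).comp (ContinuousLinearMap.inl ℝ (ℝ × ℝ) ℝ)) W :=
    (hG.continuousOn_fderiv_of_isOpen hW le_rfl).clm_comp continuousOn_const
  simp only [(hasFDerivAt_integral_of_contDiffOn hW hG hT (h θ₀ h₀)).fderiv]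
  rw [ContinuousLinearMap.intervalIntegral_apply (intervalIntegrable_section hf' hT (h θ₀ h₀))]
  simp

/-- The first derivative is a double integral of the same kind for every parameter near the origin,
so the rule for one differentiation can be applied again. -/
theorem deriv_deriv_integral_integral {G : (ℝ × ℝ) × ℝ → ℝ} {T : ℝ} (hT : 0 ≤ T)
    (h : ∀ θ₀ ∈ Set.Icc 0 T, ∀ θ₁ ∈ Set.Icc 0 T, ContDiffAt ℝ 2 G ((0, θ₀), θ₁)) :
    deriv (deriv fun r => ∫ θ₀ in (0 : ℝ)..T, ∫ θ₁ in (0 : ℝ)..T, G ((r, θ₀), θ₁)) 0 =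
      ∫ θ₀ in (0 : ℝ)..T, ∫ θ₁ in (0 : ℝ)..T,
        deriv (deriv fun r => G ((r, θ₀), θ₁)) 0 := by
  set W : Set ((ℝ × ℝ) × ℝ) := {p | ContDiffAt ℝ (2 : ℕ) G p} with hWdef
  have hW : IsOpen W := isOpen_setOf_contDiffAt G 2
  have hG : ContDiffOn ℝ 2 G W := fun p (hp : ContDiffAt ℝ 2 G p) =>
    hp.contDiffWithinAt
  have hline : ∀ (H : (ℝ × ℝ) × ℝ → ℝ) (r θ₀ θ₁ : ℝ), DifferentiableAt ℝ H ((r, θ₀), θ₁) →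
      HasDerivAt (fun r => H ((r, θ₀), θ₁)) (fderiv ℝ H ((r, θ₀), θ₁) ((1, 0), 0)) r := by
    intro H r θ₀ θ₁ hH
    have h1 : HasDerivAt (fun r : ℝ => ((r, θ₀), θ₁)) ((1, 0), 0) r :=
      ((hasDerivAt_id r).prodMk (hasDerivAt_const r θ₀)).prodMk (hasDerivAt_const r θ₁)
    exact hH.hasFDerivAt.comp_hasDerivAt r h1
  set G' : (ℝ × ℝ) × ℝ → ℝ := fun p => fderiv ℝ G p ((1, 0), 0) with hG'
  have hG'c : ContDiffOn ℝ 1 G' W := by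
    have h2 : (2 : WithTop ℕ∞) = 1 + 1 := by norm_num
    rw [h2, contDiffOn_succ_iff_fderiv_of_isOpen hW] at hG
    exact hG.2.2.clm_apply contDiffOn_const
  have hdG : ∀ p ∈ W, DifferentiableAt ℝ G p := 
    fun p (hp : ContDiffAt ℝ 2 G p) => hp.differentiableAt (by norm_num)
  have hdG' : ∀ p ∈ W, DifferentiableAt ℝ G' p := fun p hp =>
    (hG'c.differentiableOn one_ne_zero).differentiableAt (hW.mem_nhds hp)
  have hU : ∀ᶠ r : ℝ in 𝓝 0, ∀ θ₀ ∈ Set.Icc 0 T, ∀ θ₁ ∈ Set.Icc 0 T, ((r, θ₀), θ₁) ∈ W :=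
    (isOpen_setOf_forall_prod_mem (isOpen_setOf_forall_prod_mem hW isCompact_Icc)
      isCompact_Icc).mem_nhds h
  have h1 : deriv (fun r => ∫ θ₀ in (0 : ℝ)..T, ∫ θ₁ in (0 : ℝ)..T, G ((r, θ₀), θ₁)) =ᶠ[𝓝 0]
      fun r => ∫ θ₀ in (0 : ℝ)..T, ∫ θ₁ in (0 : ℝ)..T, G' ((r, θ₀), θ₁) := by
    filter_upwards [hU] with r hr
    exact (hasDerivAt_integral_integral hW (hG.of_le (by norm_num)) hT hr).deriv
  rw [h1.deriv_eq, (hasDerivAt_integral_integral hW hG'c hT h).deriv]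
  refine intervalIntegral.integral_congr fun θ₀ h₀ => intervalIntegral.integral_congr
    fun θ₁ h₁ => ?_
  rw [Set.uIcc_of_le hT] at h₀ h₁
  have h2 : deriv (fun r => G ((r, θ₀), θ₁)) =ᶠ[𝓝 0] fun r => G' ((r, θ₀), θ₁) := by
    filter_upwards [hU] with r hr
    exact (hline G r θ₀ θ₁ (hdG _ (hr θ₀ h₀ θ₁ h₁))).deriv
  simp only [h2.deriv_eq]
  exact (hline G' 0 θ₀ θ₁ (hdG' _ (h θ₀ h₀ θ₁ h₁))).deriv.symm

end DoubleIntegral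

/-! ### Second-order expansions -/

/-- `f r = a + b r + c r² + o(r²)` as `r → 0`. -/
def HasJet (f : ℝ → ℝ) (a b c : ℝ) : Prop :=
  (fun r => f r - (a + b * r + c * r ^ 2)) =o[𝓝 0] fun r : ℝ => r ^ 2

namespace HasJet

variable {f g : ℝ → ℝ} {a b c a' b' c' : ℝ}

theorem poly (a b c : ℝ) : HasJet (fun r => a + b * r + c * r ^ 2) a b c := by
  simp [HasJet]

theorem const (a : ℝ) : HasJet (fun _ => a) a 0 0 := by
  simpa using poly a 0 0

theorem congr' (hf : HasJet f a b c) (h : f =ᶠ[𝓝 0] g) : HasJet g a b c :=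
  IsLittleO.congr' hf (by filter_upwards [h] with r hr; rw [hr]) EventuallyEq.rfl

theorem coeff (hf : HasJet f a b c) (ha : a = a') (hb : b = b') (hc : c = c') :
    HasJet f a' b' c' := by
  subst ha hb hc; exact hf

theorem add (hf : HasJet f a b c) (hg : HasJet g a' b' c') :
    HasJet (fun r => f r + g r) (a + a') (b + b') (c + c') :=
  (IsLittleO.add hf hg).congr_left fun r => by ring

theorem sub (hf : HasJet f a b c) (hg : HasJet g a' b' c') :
    HasJet (fun r => f r - g r) (a - a') (b - b') (c - c') :=
  (IsLittleO.sub hf hg).congr_left fun r => by ring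

theorem poly_isBigO_one (a b c : ℝ) :
    (fun r : ℝ => a + b * r + c * r ^ 2) =O[𝓝 0] fun _ => (1 : ℝ) :=
  (ContinuousAt.tendsto (by fun_prop)).isBigO_one ℝ

theorem sq_isBigO_one : (fun r : ℝ => r ^ 2) =O[𝓝 0] fun _ => (1 : ℝ) :=
  (ContinuousAt.tendsto (by fun_prop)).isBigO_one ℝ

theorem isBigO_one (hf : HasJet f a b c) : f =O[𝓝 0] fun _ => (1 : ℝ) :=
  ((hf.isBigO.trans sq_isBigO_one).add (poly_isBigO_one a b c)).congr_left fun r => by ring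

theorem cube_isLittleO : (fun r : ℝ => r ^ 3) =o[𝓝 0] fun r : ℝ => r ^ 2 :=
  isLittleO_pow_pow (by norm_num)

theorem mul (hf : HasJet f a b c) (hg : HasJet g a' b' c') :
    HasJet (fun r => f r * g r) (a * a') (a * b' + b * a') (a * c' + b * b' + c * a') := by
  have h1 := (hf.isBigO_one.mul_isLittleO hg)
  have h2 := (IsLittleO.mul_isBigO hf (poly_isBigO_one a' b' c'))
  have h3 : (fun r : ℝ => r ^ 3 * ((b * c' + c * b') + c * c' * r + 0 * r ^ 2)) =o[𝓝 0]
      fun r : ℝ => r ^ 2 * 1 := cube_isLittleO.mul_isBigO (poly_isBigO_one _ _ _)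
  simp only [one_mul, mul_one] at h1 h2 h3
  exact ((h1.add h2).add h3).congr_left fun r => by ring

theorem sq (hf : HasJet f a b c) :
    HasJet (fun r => f r ^ 2) (a ^ 2) (2 * a * b) (b ^ 2 + 2 * a * c) :=
  ((hf.mul hf).congr' (Eventually.of_forall fun r => (pow_two _).symm)).coeff
    (by ring) (by ring) (by ring)

theorem const_mul (k : ℝ) (hf : HasJet f a b c) :
    HasJet (fun r => k * f r) (k * a) (k * b) (k * c) :=
  ((const k).mul hf).coeff rfl (by ring) (by ring)

/-- The coefficients of the difference vanish one after the other: divide by `r ^ k` off the origin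
and let `r` tend to zero. -/
theorem unique (hf : HasJet f a b c) (hg : HasJet f a' b' c') : a = a' ∧ b = b' ∧ c = c' := by
  have h0 : (fun r : ℝ => (a - a') + (b - b') * r + (c - c') * r ^ 2) =o[𝓝 0]
      fun r : ℝ => r ^ 2 := (IsLittleO.sub hg hf).congr_left fun r => by ring
  have key : ∀ (k : ℕ) (x y z : ℝ), k ≤ 2 →
      (fun r : ℝ => r ^ k * (x + y * r + z * r ^ 2)) =o[𝓝 0] (fun r : ℝ => r ^ 2) → x = 0 := by
    intro k x y z hk h
    have h1 : (fun r : ℝ => r ^ k * (x + y * r + z * r ^ 2)) =o[𝓝[≠] 0] fun r : ℝ => r ^ k * 1 := by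
      refine (h.mono nhdsWithin_le_nhds).trans_isBigO ?_
      refine IsBigO.mono ?_ nhdsWithin_le_nhds
      simp only [mul_one]
      rcases hk.lt_or_eq with hk | rfl
      · exact (isLittleO_pow_pow hk).isBigO
      · exact isBigO_refl _ _
    have h2 : (fun r : ℝ => x + y * r + z * r ^ 2) =o[𝓝[≠] 0] fun _ => (1 : ℝ) := by
      rw [isLittleO_iff] at h1 ⊢
      intro ε hε
      filter_upwards [h1 hε, self_mem_nhdsWithin] with r hr hr0
      rw [norm_mul, norm_mul, mul_left_comm] at hr
      have : 0 < ‖r ^ k‖ := norm_pos_iff.2 (pow_ne_zero _ hr0)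
      exact le_of_mul_le_mul_left hr this
    rw [isLittleO_one_iff] at h2
    have h3 : Tendsto (fun r : ℝ => x + y * r + z * r ^ 2) (𝓝[≠] 0) (𝓝 x) := by
      have : ContinuousAt (fun r : ℝ => x + y * r + z * r ^ 2) 0 := by fun_prop
      simpa using this.tendsto.mono_left nhdsWithin_le_nhds
    exact tendsto_nhds_unique h3 h2
  have ha := key 0 (a - a') (b - b') (c - c') (by norm_num) (h0.congr_left fun r => by ring)
  rw [ha] at h0
  have hb := key 1 (b - b') (c - c') 0 (by norm_num) (h0.congr_left fun r => by ring)
  rw [hb] at h0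
  have hc := key 2 (c - c') 0 0 (by norm_num) (h0.congr_left fun r => by ring)
  exact ⟨by linarith, by linarith, by linarith⟩

/-- The derivative of the remainder is `o(r)`, so the mean value inequality makes the remainder
`o(r²)`. -/
theorem of_contDiffAt (hf : ContDiffAt ℝ 2 f 0) :
    HasJet f (f 0) (deriv f 0) (deriv (deriv f) 0 / 2) := by
  set B := deriv (deriv f) 0 with hB
  have hev : ∀ᶠ r in 𝓝 0, DifferentiableAt ℝ f r := by
    filter_upwards [hf.eventually (by simp)] with z hz
    exact hz.differentiableAt (by norm_num)
  have h1 : HasDerivAt (deriv f) B 0 :=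
    ((contDiffAt_succ_iff_hasFDerivAt.1 hf).elim fun f' hf' => by
      obtain ⟨⟨u, hu, hfu⟩, hc⟩ := hf'
      have hd : deriv f =ᶠ[𝓝 0] fun r => f' r 1 := by
        filter_upwards [hu] with r hr
        exact (hfu r hr).hasDerivAt.deriv
      have : DifferentiableAt ℝ (fun r => f' r 1) 0 :=
        (hc.differentiableAt one_ne_zero).clm_apply (differentiableAt_const _)
      exact (hd.differentiableAt_iff.2 this).hasDerivAt)
  have hpd : ∀ r : ℝ, HasDerivAt (fun r => f 0 + deriv f 0 * r + B / 2 * r ^ 2)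
      (deriv f 0 + B * r) r := fun r => by
    have := (((hasDerivAt_id r).const_mul (deriv f 0)).const_add (f 0)).add
      (((hasDerivAt_id r).pow 2).const_mul (B / 2))
    refine this.congr_deriv ?_
    simp
    ring
  have hdo : deriv (fun r => f r - (f 0 + deriv f 0 * r + B / 2 * r ^ 2)) =ᶠ[𝓝 0]
      fun r => deriv f r - (deriv f 0 + B * r) := by
    filter_upwards [hev] with r hr
    exact (hr.hasDerivAt.sub (hpd r)).deriv
  have hsmall : (fun r => deriv f r - (deriv f 0 + B * r)) =o[𝓝 0] fun r : ℝ => r := by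
    have := h1.isLittleO
    simp only [sub_zero, smul_eq_mul] at this
    exact this.congr_left fun r => by ring
  rw [HasJet, isLittleO_iff]
  intro ε hε
  obtain ⟨δ, hδ, hball⟩ := Metric.nhds_basis_ball.mem_iff.1
    ((hev.and (isLittleO_iff.1 hsmall hε)).and hdo)
  filter_upwards [Metric.ball_mem_nhds 0 hδ] with r hr
  have hr' : ‖r‖ < δ := by simpa using hr
  have hmem : ∀ w ∈ Metric.closedBall (0 : ℝ) ‖r‖, ‖w‖ ≤ ‖r‖ ∧ w ∈ Metric.ball (0 : ℝ) δ :=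
    fun w hw => by
      have : ‖w‖ ≤ ‖r‖ := by simpa using hw
      exact ⟨this, by simpa using this.trans_lt hr'⟩
  have := (convex_closedBall (0 : ℝ) ‖r‖).norm_image_sub_le_of_norm_deriv_le
    (f := fun r => f r - (f 0 + deriv f 0 * r + B / 2 * r ^ 2)) (C := ε * ‖r‖) (x := 0) (y := r)
    (fun w hw => ((hball (hmem w hw).2).1.1.hasDerivAt.sub (hpd w)).differentiableAt)
    (fun w hw => ?_) (by simp) (by simp)
  · simpa [pow_two, mul_assoc] using this
  · rw [(hball (hmem w hw).2).2]
    exact (hball (hmem w hw).2).1.2.trans (by gcongr; exact (hmem w hw).1)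

theorem deriv_deriv_eq (hf : HasJet f a b c) (hd : ContDiffAt ℝ 2 f 0) :
    deriv (deriv f) 0 = 2 * c := by
  have := (unique hf (of_contDiffAt hd)).2.2
  linarith

theorem isBigO_sub (hf : HasJet f a b c) : (fun r => f r - a) =O[𝓝 0] fun r : ℝ => r := by
  have h2 : (fun r : ℝ => r ^ 2) =O[𝓝 0] fun r : ℝ => r := by
    simpa using (isLittleO_pow_pow (𝕜 := ℝ) (show 1 < 2 by norm_num)).isBigO
  have h3 : (fun r : ℝ => r * (b + c * r + 0 * r ^ 2)) =O[𝓝 0] fun r : ℝ => r * 1 :=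
    (isBigO_refl _ _).mul (poly_isBigO_one _ _ _)
  simp only [mul_one] at h3
  exact ((hf.isBigO.trans h2).add h3).congr_left fun r => by ring

theorem tendsto (hf : HasJet f a b c) : Tendsto f (𝓝 0) (𝓝 a) := by
  have h := hf.isBigO_sub.trans_tendsto tendsto_id
  simpa using h.add_const a

theorem comp {φ : ℝ → ℝ} {p₀ p₁ p₂ : ℝ} (hφ : HasJet (fun h => φ (a + h)) p₀ p₁ p₂)
    (hf : HasJet f a b c) :
    HasJet (fun r => φ (f r)) p₀ (p₁ * b) (p₁ * c + p₂ * b ^ 2) := by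
  have ht : Tendsto (fun r => f r - a) (𝓝 0) (𝓝 0) := by
    simpa using hf.tendsto.sub_const a
  have h1 : (fun r => φ (f r) - (p₀ + p₁ * (f r - a) + p₂ * (f r - a) ^ 2)) =o[𝓝 0]
      fun r : ℝ => r ^ 2 := by
    have := (IsLittleO.comp_tendsto hφ ht).trans_isBigO (hf.isBigO_sub.pow 2)
    refine this.congr_left fun r => ?_
    simp
  have h2 : HasJet (fun r => f r - a) 0 b c := by simpa using hf.sub (const a)
  have h3 := ((h2.const_mul p₁).add (h2.sq.const_mul p₂)).add (const p₀)
  exact (h1.add h3).congr_left fun r => by ring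

theorem inv (hf : HasJet f a b c) (ha : a ≠ 0) :
    HasJet (fun r => (f r)⁻¹) a⁻¹ (-b / a ^ 2) (b ^ 2 / a ^ 3 - c / a ^ 2) := by
  have hφ : HasJet (fun h => (a + h)⁻¹) a⁻¹ (-1 / a ^ 2) (1 / a ^ 3) := by
    -- The remainder of the expansion of `1/(a + h)` is exactly `h³` times this bounded function.
    have hb : (fun h : ℝ => -(a ^ 3 * (a + h))⁻¹) =O[𝓝 0] fun _ => (1 : ℝ) := by
      refine (ContinuousAt.tendsto (x := 0) ?_).isBigO_one ℝ
      refine (ContinuousAt.inv₀ (by fun_prop) ?_).neg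
      simp [ha]
    have hne : ∀ᶠ h : ℝ in 𝓝 0, a + h ≠ 0 := by
      have : ContinuousAt (fun h : ℝ => a + h) 0 := by fun_prop
      exact this.eventually_ne (by simpa using ha)
    have := cube_isLittleO.mul_isBigO hb
    simp only [mul_one] at this
    refine this.congr' ?_ EventuallyEq.rfl
    filter_upwards [hne] with h hh
    field_simp
    ring
  exact (comp (φ := fun x => x⁻¹) hφ hf).coeff rfl (by ring) (by ring)

/-- Smoothness supplies some jet of the root at `a`; squaring it and comparing with `a + h` by
uniqueness determines the coefficients. -/
theorem sqrt (hf : HasJet f a b c) (ha : 0 < a) :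
    HasJet (fun r => √(f r)) (√a) (b / (2 * √a)) (c / (2 * √a) - b ^ 2 / (8 * √a ^ 3)) := by
  have hs : 0 < √a := Real.sqrt_pos.2 ha
  have hss : √a ^ 2 = a := Real.sq_sqrt ha.le
  have hc : ContDiffAt ℝ 2 (fun h => √(a + h)) 0 := by
    refine ContDiffAt.sqrt (by fun_prop) ?_
    simpa using ha.ne'
  obtain ⟨p₀, p₁, p₂, hp⟩ : ∃ p₀ p₁ p₂, HasJet (fun h => √(a + h)) p₀ p₁ p₂ :=
    ⟨_, _, _, of_contDiffAt hc⟩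
  have hp0 : p₀ = √a := by
    have h1 := hc.continuousAt.tendsto
    simp only [add_zero] at h1
    exact tendsto_nhds_unique hp.tendsto h1
  have hpos : ∀ᶠ h : ℝ in 𝓝 0, 0 ≤ a + h := by
    have : ContinuousAt (fun h : ℝ => a + h) 0 := by fun_prop
    filter_upwards [this.eventually (lt_mem_nhds (show 0 < a + 0 by simpa using ha))] with h hh
    exact hh.le
  have h2 : HasJet (fun h => a + h) (p₀ ^ 2) (2 * p₀ * p₁) (p₁ ^ 2 + 2 * p₀ * p₂) := by
    refine hp.sq.congr' ?_
    filter_upwards [hpos] with h hh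
    exact Real.sq_sqrt hh
  have h3 : HasJet (fun h => a + h) a 1 0 := by simpa using poly a 1 0
  obtain ⟨-, e1, e2⟩ := unique h2 h3
  rw [hp0] at e1 e2
  have hp1 : p₁ = 1 / (2 * √a) := by field_simp; linarith
  have hp2 : p₂ = -1 / (8 * √a ^ 3) := by
    rw [hp1] at e2
    field_simp at e2 ⊢
    linarith
  exact (comp (φ := fun x => √x) hp hf).coeff hp0 (by rw [hp1]; ring) (by rw [hp1, hp2]; ring)

/-- The expansion of `1 / √f`. -/
theorem inv_sqrt (hf : HasJet f a b c) (ha : 0 < a) :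
    HasJet (fun r => (√(f r))⁻¹) (√a)⁻¹ (-(b * (√a)⁻¹ ^ 3 / 2))
      (3 / 8 * b ^ 2 * (√a)⁻¹ ^ 5 - c * (√a)⁻¹ ^ 3 / 2) := by
  have hs : 0 < √a := Real.sqrt_pos.2 ha
  refine ((hf.sqrt ha).inv hs.ne').coeff rfl ?_ ?_
  · field_simp
  · field_simp
    ring

end HasJet

/-! ### Regularity of the weighted inverse distance near the origin -/

/-- The squared distance of the planets on circular coplanar orbits. -/
def circDistSq (a : Fin 2 → ℝ) (θ : ℝ) : ℝ := a 0 ^ 2 + a 1 ^ 2 - 2 * a 0 * a 1 * Real.cos θ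

theorem circDistSq_pos {a : Fin 2 → ℝ} (h1 : 0 < a 1) (h01 : a 1 < a 0) (θ : ℝ) :
    0 < circDistSq a θ := by
  have h := mul_nonneg (mul_pos (h1.trans h01) h1).le (sub_nonneg.2 (Real.cos_le_one θ))
  have h2 := pow_pos (sub_pos.2 h01) 2
  rw [circDistSq]
  nlinarith

section Regularity

variable {a Λ : Fin 2 → ℝ}

theorem circ_zero (Λ : Fin 2 → ℝ) (j : Fin 2) : circ Λ 0 j = 1 := by simp [circ]

theorem eccCos_zero (Λ : Fin 2 → ℝ) (j : Fin 2) (θ : ℝ) : eccCos Λ 0 j θ = 0 := by simp [eccCos]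

theorem orbitRadius_zero (Λ : Fin 2 → ℝ) (j : Fin 2) (θ : ℝ) : orbitRadius Λ 0 j θ = 1 := by
  simp [orbitRadius, circ_zero, eccCos_zero]

theorem distSq_zero (a Λ : Fin 2 → ℝ) (θ₀ θ₁ : ℝ) :
    distSq a Λ 0 θ₀ θ₁ = circDistSq a (θ₀ - θ₁) := by
  simp [distSq, orbitRadius_zero, nodeSin, circDistSq]

theorem contDiff_circ (Λ : Fin 2 → ℝ) (j : Fin 2) {n : ℕ} :
    ContDiff ℝ n fun z => circ Λ z j := by
  unfold circ
  fun_prop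

theorem contDiffAt_orbitRadius (hΛ : ∀ j, 0 < Λ j) (j : Fin 2) (θ : ℝ) {n : ℕ} :
    ContDiffAt ℝ n (fun p : (Fin 3 ⊕ Fin 3 → ℝ) × ℝ => orbitRadius Λ p.1 j p.2) (0, θ) := by
  have hc : ContDiff ℝ n fun p : (Fin 3 ⊕ Fin 3 → ℝ) × ℝ => circ Λ p.1 j :=
    (contDiff_circ Λ j).comp contDiff_fst
  have hs : ContDiffAt ℝ n
      (fun p : (Fin 3 ⊕ Fin 3 → ℝ) × ℝ => √((1 + circ Λ p.1 j) / (2 * Λ j))) (0, θ) := by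
    refine ContDiffAt.sqrt ((contDiff_const.add hc).div_const _).contDiffAt ?_
    have := hΛ j
    simp only [circ_zero]
    positivity
  have hl : ContDiff ℝ n (fun p : (Fin 3 ⊕ Fin 3 → ℝ) × ℝ =>
      p.1 (.inl j.castSucc) * Real.cos p.2 + orient j * p.1 (.inr j.castSucc) * Real.sin p.2) := by
    have h1 : ContDiff ℝ n fun p : (Fin 3 ⊕ Fin 3 → ℝ) × ℝ => Real.cos p.2 :=
      Real.contDiff_cos.comp contDiff_snd
    have h2 : ContDiff ℝ n fun p : (Fin 3 ⊕ Fin 3 → ℝ) × ℝ => Real.sin p.2 :=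
      Real.contDiff_sin.comp contDiff_snd
    fun_prop
  refine ContDiffAt.div (hc.contDiffAt.pow 2) (contDiffAt_const.add (hs.mul hl.contDiffAt)) ?_
  change 1 + eccCos Λ 0 j θ ≠ 0
  simp [eccCos_zero]

theorem contDiffAt_tilt (hΛ : ∀ j, 0 < Λ j) {n : ℕ} : ContDiffAt ℝ n (tilt Λ) 0 := by
  have h0 := contDiff_circ Λ 0 (n := n)
  have h1 := contDiff_circ Λ 1 (n := n)
  unfold tilt nodeSq
  refine ContDiffAt.div (by fun_prop) (by fun_prop) ?_
  simp only [circ_zero]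
  have := hΛ 0
  have := hΛ 1
  positivity

theorem contDiffAt_distSq (hΛ : ∀ j, 0 < Λ j) (a : Fin 2 → ℝ) (θ₀ θ₁ : ℝ) {n : ℕ} :
    ContDiffAt ℝ n (fun p : ((Fin 3 ⊕ Fin 3 → ℝ) × ℝ) × ℝ => distSq a Λ p.1.1 p.1.2 p.2)
      ((0, θ₀), θ₁) := by
  have r0 : ContDiffAt ℝ n (fun p : ((Fin 3 ⊕ Fin 3 → ℝ) × ℝ) × ℝ =>
      orbitRadius Λ p.1.1 0 p.1.2) ((0, θ₀), θ₁) :=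
    (contDiffAt_orbitRadius hΛ 0 θ₀).comp ((0, θ₀), θ₁) contDiffAt_fst
  have r1 : ContDiffAt ℝ n (fun p : ((Fin 3 ⊕ Fin 3 → ℝ) × ℝ) × ℝ =>
      orbitRadius Λ p.1.1 1 p.2) ((0, θ₀), θ₁) :=
    (contDiffAt_orbitRadius hΛ 1 θ₁).comp ((0, θ₀), θ₁)
      (f := fun p : ((Fin 3 ⊕ Fin 3 → ℝ) × ℝ) × ℝ => (p.1.1, p.2)) (by fun_prop)
  have ht : ContDiffAt ℝ n (fun p : ((Fin 3 ⊕ Fin 3 → ℝ) × ℝ) × ℝ => tilt Λ p.1.1)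
      ((0, θ₀), θ₁) :=
    (contDiffAt_tilt hΛ).comp ((0, θ₀), θ₁)
      (f := fun p : ((Fin 3 ⊕ Fin 3 → ℝ) × ℝ) × ℝ => p.1.1) (by fun_prop)
  have hn0 : ContDiff ℝ n (fun p : ((Fin 3 ⊕ Fin 3 → ℝ) × ℝ) × ℝ => nodeSin p.1.1 p.1.2) := by
    unfold nodeSin
    have h1 : ContDiff ℝ n fun p : ((Fin 3 ⊕ Fin 3 → ℝ) × ℝ) × ℝ => Real.cos p.1.2 :=
      Real.contDiff_cos.comp (by fun_prop)
    have h2 : ContDiff ℝ n fun p : ((Fin 3 ⊕ Fin 3 → ℝ) × ℝ) × ℝ => Real.sin p.1.2 :=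
      Real.contDiff_sin.comp (by fun_prop)
    fun_prop
  have hn1 : ContDiff ℝ n (fun p : ((Fin 3 ⊕ Fin 3 → ℝ) × ℝ) × ℝ => nodeSin p.1.1 p.2) := by
    unfold nodeSin
    have h1 : ContDiff ℝ n fun p : ((Fin 3 ⊕ Fin 3 → ℝ) × ℝ) × ℝ => Real.cos p.2 :=
      Real.contDiff_cos.comp (by fun_prop)
    have h2 : ContDiff ℝ n fun p : ((Fin 3 ⊕ Fin 3 → ℝ) × ℝ) × ℝ => Real.sin p.2 :=
      Real.contDiff_sin.comp (by fun_prop)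
    fun_prop
  have hcos : ContDiff ℝ n fun p : ((Fin 3 ⊕ Fin 3 → ℝ) × ℝ) × ℝ => Real.cos (p.1.2 - p.2) :=
    Real.contDiff_cos.comp (by fun_prop)
  have hn0' := hn0.contDiffAt (x := ((0, θ₀), θ₁))
  have hn1' := hn1.contDiffAt (x := ((0, θ₀), θ₁))
  have hcos' := hcos.contDiffAt (x := ((0, θ₀), θ₁))
  unfold distSq
  fun_prop

/-- At the origin the orbits are circles of radii `a 1 < a 0`; neither the distance nor any other
denominator vanishes. -/
theorem contDiffAt_orbitDensity (hΛ : ∀ j, 0 < Λ j) (h1 : 0 < a 1) (h01 : a 1 < a 0)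
    (θ₀ θ₁ : ℝ) {n : ℕ} :
    ContDiffAt ℝ n (fun p : ((Fin 3 ⊕ Fin 3 → ℝ) × ℝ) × ℝ =>
      orbitDensity a Λ p.1.1 p.1.2 p.2) ((0, θ₀), θ₁) := by
  have r0 : ContDiffAt ℝ n (fun p : ((Fin 3 ⊕ Fin 3 → ℝ) × ℝ) × ℝ =>
      orbitRadius Λ p.1.1 0 p.1.2) ((0, θ₀), θ₁) :=
    (contDiffAt_orbitRadius hΛ 0 θ₀).comp ((0, θ₀), θ₁) contDiffAt_fst
  have r1 : ContDiffAt ℝ n (fun p : ((Fin 3 ⊕ Fin 3 → ℝ) × ℝ) × ℝ =>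
      orbitRadius Λ p.1.1 1 p.2) ((0, θ₀), θ₁) :=
    (contDiffAt_orbitRadius hΛ 1 θ₁).comp ((0, θ₀), θ₁)
      (f := fun p : ((Fin 3 ⊕ Fin 3 → ℝ) × ℝ) × ℝ => (p.1.1, p.2)) (by fun_prop)
  have c0 : ContDiffAt ℝ n (fun p : ((Fin 3 ⊕ Fin 3 → ℝ) × ℝ) × ℝ => circ Λ p.1.1 0)
      ((0, θ₀), θ₁) := ((contDiff_circ Λ 0).comp (by fun_prop)).contDiffAt
  have c1 : ContDiffAt ℝ n (fun p : ((Fin 3 ⊕ Fin 3 → ℝ) × ℝ) × ℝ => circ Λ p.1.1 1)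
      ((0, θ₀), θ₁) := ((contDiff_circ Λ 1).comp (by fun_prop)).contDiffAt
  have hD := circDistSq_pos h1 h01 (θ₀ - θ₁)
  rw [← distSq_zero a Λ] at hD
  unfold orbitDensity
  refine ContDiffAt.div (ContDiffAt.div (by fun_prop) (by fun_prop) ?_)
    ((contDiffAt_distSq hΛ a θ₀ θ₁).sqrt hD.ne') (Real.sqrt_pos.2 hD).ne'
  simp [circ_zero]

theorem eventually_admissible (hΛ : 0 < Λ 0) (hΛ' : Λ 0 < Λ 1) :
    ∀ᶠ z in 𝓝 (0 : Fin 3 ⊕ Fin 3 → ℝ), Admissible Λ z := by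
  have hpos : ∀ j, 0 < Λ j := fun j => by
    fin_cases j
    · exact hΛ
    · exact hΛ.trans hΛ'
  have hc : ∀ j, Continuous fun z => circ Λ z j := fun j => by unfold circ; fun_prop
  have h0 := hc 0
  have h1 := hc 1
  have hn : Continuous nodeSq := by unfold nodeSq; fun_prop
  have hn0 : nodeSq 0 = 0 := by simp [nodeSq]
  have e0 : ∀ᶠ z in 𝓝 (0 : Fin 3 ⊕ Fin 3 → ℝ), 0 < circ Λ z 0 :=
    h0.continuousAt.eventually (lt_mem_nhds (by simp [circ_zero]))
  have e1 : ∀ᶠ z in 𝓝 (0 : Fin 3 ⊕ Fin 3 → ℝ), 0 < circ Λ z 1 :=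
    h1.continuousAt.eventually (lt_mem_nhds (by simp [circ_zero]))
  have e2 : ∀ᶠ z in 𝓝 (0 : Fin 3 ⊕ Fin 3 → ℝ), 0 < Λ 1 * circ Λ z 1 - Λ 0 * circ Λ z 0 :=
    (show Continuous fun z => Λ 1 * circ Λ z 1 - Λ 0 * circ Λ z 0 by fun_prop).continuousAt.eventually
      (lt_mem_nhds (by simpa [circ_zero] using hΛ'))
  have e3 : ∀ᶠ z in 𝓝 (0 : Fin 3 ⊕ Fin 3 → ℝ), 0 < 2 * (Λ 0 * circ Λ z 0) - nodeSq z :=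
    (show Continuous fun z => 2 * (Λ 0 * circ Λ z 0) - nodeSq z by fun_prop).continuousAt.eventually
      (lt_mem_nhds (by simpa [circ_zero, hn0] using hΛ))
  filter_upwards [e0, e1, e2, e3] with z z0 z1 z2 z3
  refine ⟨hpos, fun j => ?_, by linarith, by linarith⟩
  fin_cases j
  · exact z0
  · exact z1

/-- Positivity at `z = 0` persists near it uniformly on the compact square of longitudes, and
periodicity extends it to all longitudes. -/
theorem eventually_distSq_pos (hΛ : ∀ j, 0 < Λ j) (h1 : 0 < a 1) (h01 : a 1 < a 0) :
    ∀ᶠ z in 𝓝 (0 : Fin 3 ⊕ Fin 3 → ℝ), ∀ θ₀ θ₁, 0 < distSq a Λ z θ₀ θ₁ := by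
  have hev : ∀ᶠ z in 𝓝 (0 : Fin 3 ⊕ Fin 3 → ℝ), ∀ θ₀ ∈ Set.Icc 0 (2 * Real.pi),
      ∀ θ₁ ∈ Set.Icc 0 (2 * Real.pi), 0 < distSq a Λ z θ₀ θ₁ := by
    refine isCompact_Icc.eventually_forall_of_forall_eventually
      (P := fun z θ₀ => ∀ θ₁ ∈ Set.Icc 0 (2 * Real.pi), 0 < distSq a Λ z θ₀ θ₁) fun θ₀ _ => ?_
    refine isCompact_Icc.eventually_forall_of_forall_eventually
      (P := fun (p : (Fin 3 ⊕ Fin 3 → ℝ) × ℝ) θ₁ => 0 < distSq a Λ p.1 p.2 θ₁) fun θ₁ _ => ?_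
    have hD := circDistSq_pos h1 h01 (θ₀ - θ₁)
    rw [← distSq_zero a Λ] at hD
    exact (contDiffAt_distSq hΛ a θ₀ θ₁ (n := 0)).continuousAt.eventually (lt_mem_nhds hD)
  filter_upwards [hev] with z hz θ₀ θ₁
  have p1 : ∀ θ₀, Function.Periodic (fun θ₁ => distSq a Λ z θ₀ θ₁) (2 * Real.pi) := fun θ₀ θ₁ => by
    simp [distSq, orbitRadius_add_two_pi, nodeSin, ← sub_sub]
  have p0 : ∀ θ₁, Function.Periodic (fun θ₀ => distSq a Λ z θ₀ θ₁) (2 * Real.pi) := fun θ₁ θ₀ => by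
    simp [distSq, orbitRadius_add_two_pi, nodeSin, add_sub_right_comm]
  obtain ⟨φ₀, h₀, e₀⟩ := (p0 θ₁).exists_mem_Ico₀ Real.two_pi_pos θ₀
  obtain ⟨φ₁, h₁, e₁⟩ := (p1 φ₀).exists_mem_Ico₀ Real.two_pi_pos θ₁
  rw [e₀, e₁]
  exact hz φ₀ ⟨h₀.1, h₀.2.le⟩ φ₁ ⟨h₁.1, h₁.2.le⟩

end Regularity

/-! ### Second-order expansion of the weighted inverse distance -/

/-- `e j ² / 4` to second order. -/
def quarterEccSq (Λ : Fin 2 → ℝ) (z : Fin 3 ⊕ Fin 3 → ℝ) (j : Fin 2) : ℝ :=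
  (z (.inl j.castSucc) ^ 2 + z (.inr j.castSucc) ^ 2) / (4 * Λ j)

/-- The linear part of `eccCos`. -/
def eccLin (Λ : Fin 2 → ℝ) (z : Fin 3 ⊕ Fin 3 → ℝ) (j : Fin 2) (θ : ℝ) : ℝ :=
  (√(Λ j))⁻¹ *
    (z (.inl j.castSucc) * Real.cos θ + orient j * z (.inr j.castSucc) * Real.sin θ)

section Expansion

variable {a Λ : Fin 2 → ℝ} (z : Fin 3 ⊕ Fin 3 → ℝ)

theorem hasJet_circ {j : Fin 2} (hΛ : 0 < Λ j) :
    HasJet (fun r => circ Λ (r • z) j) 1 0 (-2 * quarterEccSq Λ z j) := by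
  refine (HasJet.poly 1 0 (-2 * quarterEccSq Λ z j)).congr' (Eventually.of_forall fun r => ?_)
  simp only [circ, quarterEccSq, Pi.smul_apply, smul_eq_mul]
  field_simp
  ring

theorem hasJet_orbitRadius {j : Fin 2} (hΛ : 0 < Λ j) (θ : ℝ) :
    HasJet (fun r => orbitRadius Λ (r • z) j θ) 1 (-eccLin Λ z j θ)
      (eccLin Λ z j θ ^ 2 - 4 * quarterEccSq Λ z j) := by
  have hc := hasJet_circ z hΛ
  have hs := ((((HasJet.const 1).add hc).const_mul (2 * Λ j)⁻¹).sqrt (by positivity))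
  have hl := HasJet.poly 0
    (z (.inl j.castSucc) * Real.cos θ + orient j * z (.inr j.castSucc) * Real.sin θ) 0
  have he : HasJet (fun r => 1 + eccCos Λ (r • z) j θ) 1 (eccLin Λ z j θ) 0 := by
    refine (((HasJet.const 1).add (hs.mul hl)).congr' (Eventually.of_forall fun r => ?_)).coeff
      (by ring) ?_ (by ring)
    · simp only [eccCos, Pi.smul_apply, smul_eq_mul]
      rw [div_eq_inv_mul]
      ring
    · have : (2 * Λ j)⁻¹ * (1 + 1) = (Λ j)⁻¹ := by field_simp; norm_num
      rw [this, Real.sqrt_inv, eccLin]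
      ring
  refine ((hc.sq.mul (he.inv one_ne_zero)).congr' (Eventually.of_forall fun r => ?_)).coeff
    (by norm_num) (by ring) (by ring)
  simp only [orbitRadius, div_eq_mul_inv]

/-- The product of the two sines is already quadratic, so only the value `1/Λ 0 - 1/Λ 1` of `tilt`
at the origin matters. -/
theorem hasJet_tilt_mul (hΛ : ∀ j, 0 < Λ j) (θ₀ θ₁ : ℝ) :
    HasJet (fun r => tilt Λ (r • z) / 2 * nodeSin (r • z) θ₀ * nodeSin (r • z) θ₁) 0 0
      ((1 / Λ 0 - 1 / Λ 1) / 2 * nodeSin z θ₀ * nodeSin z θ₁) := by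
  have h0 := hΛ 0
  have h1 := hΛ 1
  have hc : ContDiffAt ℝ 2 (fun r : ℝ => tilt Λ (r • z)) 0 := by
    have h2 : ContDiffAt ℝ 2 (tilt Λ) ((0 : ℝ) • z) := by
      rw [zero_smul]; exact contDiffAt_tilt hΛ (n := 2)
    exact h2.comp (0 : ℝ) (f := fun r : ℝ => r • z) (by fun_prop)
  have ht := HasJet.of_contDiffAt hc
  refine ((ht.mul (HasJet.poly 0 0 (nodeSin z θ₀ * nodeSin z θ₁ / 2))).congr'
    (Eventually.of_forall fun r => ?_)).coeff (by ring) (by ring) ?_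
  · simp only [nodeSin, Pi.smul_apply, smul_eq_mul]
    ring
  · have : tilt Λ ((0 : ℝ) • z) = 1 / Λ 0 - 1 / Λ 1 := by
      simp only [zero_smul, tilt, circ_zero, nodeSq, Pi.zero_apply]
      field_simp
      ring
    rw [this]
    ring

/-- The coefficient of `r²` in the weighted inverse distance along the line through `z`. -/
def densityCoeff (a Λ : Fin 2 → ℝ) (z : Fin 3 ⊕ Fin 3 → ℝ) (θ₀ θ₁ : ℝ) : ℝ :=
  (3 * eccLin Λ z 0 θ₀ ^ 2 - 6 * quarterEccSq Λ z 0 + 3 * eccLin Λ z 1 θ₁ ^ 2 -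
      6 * quarterEccSq Λ z 1 + 4 * eccLin Λ z 0 θ₀ * eccLin Λ z 1 θ₁) *
      (√(circDistSq a (θ₀ - θ₁)))⁻¹ +
    (3 / 8 * (2 * a 0 * a 1 * Real.cos (θ₀ - θ₁) * (eccLin Λ z 0 θ₀ + eccLin Λ z 1 θ₁) -
      2 * a 0 ^ 2 * eccLin Λ z 0 θ₀ - 2 * a 1 ^ 2 * eccLin Λ z 1 θ₁) ^ 2) *
      (√(circDistSq a (θ₀ - θ₁)))⁻¹ ^ 5 +
    ((eccLin Λ z 0 θ₀ + eccLin Λ z 1 θ₁) *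
      (2 * a 0 * a 1 * Real.cos (θ₀ - θ₁) * (eccLin Λ z 0 θ₀ + eccLin Λ z 1 θ₁) -
        2 * a 0 ^ 2 * eccLin Λ z 0 θ₀ - 2 * a 1 ^ 2 * eccLin Λ z 1 θ₁) -
      (a 0 ^ 2 * (3 * eccLin Λ z 0 θ₀ ^ 2 - 8 * quarterEccSq Λ z 0) +
        a 1 ^ 2 * (3 * eccLin Λ z 1 θ₁ ^ 2 - 8 * quarterEccSq Λ z 1)) / 2 +
      a 0 * a 1 * (Real.cos (θ₀ - θ₁) * (eccLin Λ z 0 θ₀ ^ 2 - 4 * quarterEccSq Λ z 0 +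
        eccLin Λ z 1 θ₁ ^ 2 - 4 * quarterEccSq Λ z 1 + eccLin Λ z 0 θ₀ * eccLin Λ z 1 θ₁) -
        (1 / Λ 0 - 1 / Λ 1) / 2 * nodeSin z θ₀ * nodeSin z θ₁)) *
      (√(circDistSq a (θ₀ - θ₁)))⁻¹ ^ 3

/-- The linear coefficient is left unspecified, since only the second derivative is used. -/
theorem hasJet_orbitDensity (hΛ : ∀ j, 0 < Λ j) (h1 : 0 < a 1) (h01 : a 1 < a 0) (θ₀ θ₁ : ℝ) :
    ∃ b, HasJet (fun r => orbitDensity a Λ (r • z) θ₀ θ₁) (√(circDistSq a (θ₀ - θ₁)))⁻¹ b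
      (densityCoeff a Λ z θ₀ θ₁) := by
  have s0 := hasJet_circ z (hΛ 0)
  have s1 := hasJet_circ z (hΛ 1)
  have r0 := hasJet_orbitRadius z (hΛ 0) θ₀
  have r1 := hasJet_orbitRadius z (hΛ 1) θ₁
  have ht := hasJet_tilt_mul z hΛ θ₀ θ₁
  have hD := (((r0.const_mul (a 0)).sq.add (r1.const_mul (a 1)).sq).sub
    (((r0.const_mul (a 0)).mul (r1.const_mul (a 1))).mul
      (((HasJet.const (Real.cos (θ₀ - θ₁))).sub ht).const_mul 2)))
  have hD' := hD.coeff (a' := circDistSq a (θ₀ - θ₁))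
    (b' := 2 * a 0 * a 1 * Real.cos (θ₀ - θ₁) * (eccLin Λ z 0 θ₀ + eccLin Λ z 1 θ₁) -
        2 * a 0 ^ 2 * eccLin Λ z 0 θ₀ - 2 * a 1 ^ 2 * eccLin Λ z 1 θ₁)
    (c' := (a 0 ^ 2 * (3 * eccLin Λ z 0 θ₀ ^ 2 - 8 * quarterEccSq Λ z 0) +
        a 1 ^ 2 * (3 * eccLin Λ z 1 θ₁ ^ 2 - 8 * quarterEccSq Λ z 1)) -
      2 * a 0 * a 1 * (Real.cos (θ₀ - θ₁) * (eccLin Λ z 0 θ₀ ^ 2 - 4 * quarterEccSq Λ z 0 +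
        eccLin Λ z 1 θ₁ ^ 2 - 4 * quarterEccSq Λ z 1 + eccLin Λ z 0 θ₀ * eccLin Λ z 1 θ₁) -
        (1 / Λ 0 - 1 / Λ 1) / 2 * nodeSin z θ₀ * nodeSin z θ₁))
    (by rw [circDistSq]; ring) (by ring) (by ring)
  have hK := hD'.inv_sqrt (circDistSq_pos h1 h01 _)
  have hG := ((r0.sq.mul r1.sq).mul ((s0.mul s1).inv (by norm_num))).mul hK
  refine ⟨_, (hG.congr' (Eventually.of_forall fun r => ?_)).coeff (by norm_num) rfl ?_⟩
  · simp only [orbitDensity, distSq, div_eq_mul_inv]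
    congr 3
    ring_nf
  · rw [densityCoeff]
    ring

end Expansion

/-! ### Averages of the second-order coefficient -/

section Averages

variable {a Λ : Fin 2 → ℝ}

theorem hasDerivAt_circDistSq (a : Fin 2 → ℝ) (θ : ℝ) :
    HasDerivAt (circDistSq a) (2 * a 0 * a 1 * Real.sin θ) θ := by
  have h := ((Real.hasDerivAt_cos θ).const_mul (2 * a 0 * a 1)).const_sub (a 0 ^ 2 + a 1 ^ 2)
  exact h.congr_deriv (by ring)

/-- The inverse distance on circular coplanar orbits. -/
def circInvDist (a : Fin 2 → ℝ) (θ : ℝ) : ℝ := (√(circDistSq a θ))⁻¹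

theorem hasDerivAt_circInvDist (h1 : 0 < a 1) (h01 : a 1 < a 0) (θ : ℝ) :
    HasDerivAt (circInvDist a) (-(a 0 * a 1 * Real.sin θ * circInvDist a θ ^ 3)) θ := by
  have hD := circDistSq_pos h1 h01 θ
  have hs := Real.sqrt_pos.2 hD
  refine (((hasDerivAt_circDistSq a θ).sqrt hD.ne').inv hs.ne').congr_deriv ?_
  rw [circInvDist]
  field_simp

theorem continuous_circInvDist (h1 : 0 < a 1) (h01 : a 1 < a 0) : Continuous (circInvDist a) :=
  continuous_iff_continuousAt.2 fun θ => (hasDerivAt_circInvDist h1 h01 θ).continuousAt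

theorem circInvDist_sq_mul (h1 : 0 < a 1) (h01 : a 1 < a 0) (θ : ℝ) :
    circInvDist a θ ^ 2 * circDistSq a θ = 1 := by
  have hD := circDistSq_pos h1 h01 θ
  rw [circInvDist, inv_pow, Real.sq_sqrt hD.le, inv_mul_cancel₀ hD.ne']

/-- The angular average of `r² ∂_r² + 2 r ∂_r`, applied to the inverse distance. -/
def radialLaplacian (a : Fin 2 → ℝ) (θ : ℝ) : ℝ :=
  2 * a 0 * a 1 * Real.cos θ * circInvDist a θ ^ 3 -
    3 * (a 0 * a 1) ^ 2 * Real.sin θ ^ 2 * circInvDist a θ ^ 5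

theorem continuous_radialLaplacian (h1 : 0 < a 1) (h01 : a 1 < a 0) :
    Continuous (radialLaplacian a) := by
  have := continuous_circInvDist h1 h01
  unfold radialLaplacian
  fun_prop

/-- The two integrands differ by the derivative of the periodic function `a 0 * a 1 * sin θ * K³`,
with `K` the inverse distance. -/
theorem integral_radialLaplacian (h1 : 0 < a 1) (h01 : a 1 < a 0) :
    ∫ θ in (0 : ℝ)..(2 * Real.pi), radialLaplacian a θ =
      a 0 * a 1 * ∫ θ in (0 : ℝ)..(2 * Real.pi), Real.cos θ * circInvDist a θ ^ 3 := by
  have hK := continuous_circInvDist h1 h01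
  have hW := continuous_radialLaplacian h1 h01
  have hd : ∀ θ, HasDerivAt (fun θ => a 0 * a 1 * (Real.sin θ * circInvDist a θ ^ 3))
      (radialLaplacian a θ - a 0 * a 1 * (Real.cos θ * circInvDist a θ ^ 3)) θ := fun θ => by
    refine (((Real.hasDerivAt_sin θ).mul ((hasDerivAt_circInvDist h1 h01 θ).pow 3)).const_mul
      (a 0 * a 1)).congr_deriv ?_
    rw [radialLaplacian]
    simp
    ring
  have key := intervalIntegral.integral_eq_sub_of_hasDerivAt (a := 0) (b := 2 * Real.pi)
    (fun θ _ => hd θ) (Continuous.intervalIntegrable (by fun_prop) _ _)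
  rw [intervalIntegral.integral_sub (hW.intervalIntegrable _ _)
    (Continuous.intervalIntegrable (by fun_prop) _ _), intervalIntegral.integral_const_mul] at key
  simp at key
  linarith

/-- Again the difference of the integrands has a periodic primitive. This is where the second
Laplace coefficient arises. -/
theorem integral_cos_mul_sub (h1 : 0 < a 1) (h01 : a 1 < a 0) :
    ∫ θ in (0 : ℝ)..(2 * Real.pi), Real.cos θ * (2 * circInvDist a θ - radialLaplacian a θ) =
      -(a 0 * a 1 * ∫ θ in (0 : ℝ)..(2 * Real.pi), Real.cos (2 * θ) * circInvDist a θ ^ 3) := by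
  have hK := continuous_circInvDist h1 h01
  have hW := continuous_radialLaplacian h1 h01
  have hd : ∀ θ, HasDerivAt (fun θ => 2 * (Real.sin θ * circInvDist a θ) -
        a 0 * a 1 * (Real.sin θ * Real.cos θ * circInvDist a θ ^ 3))
      (Real.cos θ * (2 * circInvDist a θ - radialLaplacian a θ) +
        a 0 * a 1 * (Real.cos (2 * θ) * circInvDist a θ ^ 3)) θ := fun θ => by
    refine ((((Real.hasDerivAt_sin θ).mul (hasDerivAt_circInvDist h1 h01 θ)).const_mul 2).sub
      ((((Real.hasDerivAt_sin θ).mul (Real.hasDerivAt_cos θ)).mul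
        ((hasDerivAt_circInvDist h1 h01 θ).pow 3)).const_mul (a 0 * a 1))).congr_deriv ?_
    rw [radialLaplacian, Real.cos_two_mul]
    simp
    linear_combination (-(a 0 * a 1 * circInvDist a θ ^ 3)) * Real.sin_sq_add_cos_sq θ
  have key := intervalIntegral.integral_eq_sub_of_hasDerivAt (a := 0) (b := 2 * Real.pi)
    (fun θ _ => hd θ) (Continuous.intervalIntegrable (by fun_prop) _ _)
  rw [intervalIntegral.integral_add (Continuous.intervalIntegrable (by fun_prop) _ _)
    (Continuous.intervalIntegrable (by fun_prop) _ _), intervalIntegral.integral_const_mul] at key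
  simp at key
  linarith

/-- The integrand is odd; the explicit primitive is periodic. It rules out a mixed term `η₁ξ₂ +
ξ₁η₂` in the quadratic part. -/
theorem integral_sin_mul_sub (h1 : 0 < a 1) (h01 : a 1 < a 0) :
    ∫ θ in (0 : ℝ)..(2 * Real.pi),
      Real.sin θ * (2 * circInvDist a θ - radialLaplacian a θ) = 0 := by
  have hK := continuous_circInvDist h1 h01
  have hW := continuous_radialLaplacian h1 h01
  have h0 := h1.trans h01
  have hd : ∀ θ, HasDerivAt (fun θ => 2 / (a 0 * a 1) * √(circDistSq a θ) -
        a 0 * a 1 * (Real.sin θ ^ 2 * circInvDist a θ ^ 3))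
      (Real.sin θ * (2 * circInvDist a θ - radialLaplacian a θ)) θ := fun θ => by
    refine ((((hasDerivAt_circDistSq a θ).sqrt (circDistSq_pos h1 h01 θ).ne').const_mul
      (2 / (a 0 * a 1))).sub ((((Real.hasDerivAt_sin θ).pow 2).mul
        ((hasDerivAt_circInvDist h1 h01 θ).pow 3)).const_mul (a 0 * a 1))).congr_deriv ?_
    have hs := Real.sqrt_pos.2 (circDistSq_pos h1 h01 θ)
    have e : 2 / (a 0 * a 1) * (2 * a 0 * a 1 * Real.sin θ / (2 * √(circDistSq a θ))) =
        2 * Real.sin θ * circInvDist a θ := by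
      rw [circInvDist]; field_simp
    rw [e, radialLaplacian]
    simp
    ring
  have key := intervalIntegral.integral_eq_sub_of_hasDerivAt (a := 0) (b := 2 * Real.pi)
    (fun θ _ => hd θ) (Continuous.intervalIntegrable (by fun_prop) _ _)
  rw [key]
  simp [circDistSq]

theorem integral_trig_quadratic (x y x' y' : ℝ) :
    ∫ θ in (0 : ℝ)..(2 * Real.pi),
      (x * Real.cos θ + y * Real.sin θ) * (x' * Real.cos θ + y' * Real.sin θ) =
      Real.pi * (x * x' + y * y') := by
  have hd : ∀ θ, HasDerivAt (fun θ => (x * x' + y * y') / 2 * θ +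
      (x * x' - y * y') / 2 * (Real.sin θ * Real.cos θ) + (x * y' + y * x') / 2 * Real.sin θ ^ 2)
      ((x * Real.cos θ + y * Real.sin θ) * (x' * Real.cos θ + y' * Real.sin θ)) θ := fun θ => by
    refine ((((hasDerivAt_id θ).const_mul ((x * x' + y * y') / 2)).add
      (((Real.hasDerivAt_sin θ).mul (Real.hasDerivAt_cos θ)).const_mul
        ((x * x' - y * y') / 2))).add
      (((Real.hasDerivAt_sin θ).pow 2).const_mul ((x * y' + y * x') / 2))).congr_deriv ?_
    simp
    linear_combination (-(x * x' + y * y') / 2) * Real.sin_sq_add_cos_sq θ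
  rw [intervalIntegral.integral_eq_sub_of_hasDerivAt (fun θ _ => hd θ)
    (Continuous.intervalIntegrable (by fun_prop) _ _)]
  simp
  ring

/-- The average of the second-order coefficient over simultaneous rotations of both planets. -/
theorem integral_densityCoeff_rotation (hΛ : ∀ j, 0 < Λ j) (h1 : 0 < a 1) (h01 : a 1 < a 0)
    (z : Fin 3 ⊕ Fin 3 → ℝ) (θ : ℝ) :
    ∫ φ in (0 : ℝ)..(2 * Real.pi), densityCoeff a Λ z φ (φ - θ) =
      2 * Real.pi * (quarterEccSq Λ z 0 + quarterEccSq Λ z 1) * radialLaplacian a θ +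
      Real.pi * ((√(Λ 0))⁻¹ * (√(Λ 1))⁻¹) *
        ((z (.inl 0) * z (.inl 1) - z (.inr 0) * z (.inr 1)) *
            (Real.cos θ * (2 * circInvDist a θ - radialLaplacian a θ)) +
          (z (.inl 0) * z (.inr 1) + z (.inr 0) * z (.inl 1)) *
            (Real.sin θ * (2 * circInvDist a θ - radialLaplacian a θ))) -
      Real.pi * (1 / Λ 0 - 1 / Λ 1) / 2 * (z (.inl 2) ^ 2 + z (.inr 2) ^ 2) *
        (a 0 * a 1) * (Real.cos θ * circInvDist a θ ^ 3) := by
  set K := circInvDist a θ with hK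
  set C := Real.cos θ with hC
  set S := Real.sin θ with hS
  set L₀ := (√(Λ 0))⁻¹ with hL₀
  set L₁ := (√(Λ 1))⁻¹ with hL₁
  set A := 2 * a 0 * a 1 * C - 2 * a 0 ^ 2 with hA
  set B := 2 * a 0 * a 1 * C - 2 * a 1 ^ 2 with hB
  -- The coefficient is regrouped as a form in the two linear parts `eccLin` (`α`, `β`, `γ`), a part
  -- free of `φ` (`δ`) and the node term (`ε`).
  set α := 3 * K + 3 / 8 * A ^ 2 * K ^ 5 + (A - 3 / 2 * a 0 ^ 2 + a 0 * a 1 * C) * K ^ 3 with hα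
  set β := 3 * K + 3 / 8 * B ^ 2 * K ^ 5 + (B - 3 / 2 * a 1 ^ 2 + a 0 * a 1 * C) * K ^ 3 with hβ
  set γ := 4 * K + 3 / 4 * A * B * K ^ 5 + (A + B + a 0 * a 1 * C) * K ^ 3 with hγ
  set δ := -6 * (quarterEccSq Λ z 0 + quarterEccSq Λ z 1) * K +
    (4 * a 0 ^ 2 * quarterEccSq Λ z 0 + 4 * a 1 ^ 2 * quarterEccSq Λ z 1 -
      4 * a 0 * a 1 * C * (quarterEccSq Λ z 0 + quarterEccSq Λ z 1)) * K ^ 3 with hδ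
  set ε := -(a 0 * a 1) * ((1 / Λ 0 - 1 / Λ 1) / 2) * K ^ 3 with hε
  have e0 : ∀ φ, eccLin Λ z 0 φ = L₀ * z (.inl 0) * Real.cos φ + L₀ * z (.inr 0) * Real.sin φ := by
    intro φ
    simp only [eccLin, orient, Fin.castSucc_zero, Matrix.cons_val_zero]
    ring
  have hone : (Fin.castSucc (1 : Fin 2) : Fin 3) = 1 := rfl
  have e1 : ∀ φ, eccLin Λ z 1 (φ - θ) = L₁ * (z (.inl 1) * C + z (.inr 1) * S) * Real.cos φ +
      L₁ * (z (.inl 1) * S - z (.inr 1) * C) * Real.sin φ := by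
    intro φ
    simp only [eccLin, orient, hone, Matrix.cons_val_one, Matrix.cons_val_fin_one, Real.cos_sub,
      Real.sin_sub]
    ring
  have n0 : ∀ φ, nodeSin z φ = z (.inr 2) * Real.cos φ + (-z (.inl 2)) * Real.sin φ := by
    intro φ
    rw [nodeSin]; ring
  have n1 : ∀ φ, nodeSin z (φ - θ) = (z (.inr 2) * C + z (.inl 2) * S) * Real.cos φ +
      (z (.inr 2) * S - z (.inl 2) * C) * Real.sin φ := by
    intro φ
    rw [nodeSin, Real.cos_sub, Real.sin_sub]; ring
  have hexp : ∀ φ, densityCoeff a Λ z φ (φ - θ) =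
      α * (eccLin Λ z 0 φ * eccLin Λ z 0 φ) + β * (eccLin Λ z 1 (φ - θ) * eccLin Λ z 1 (φ - θ)) +
        γ * (eccLin Λ z 0 φ * eccLin Λ z 1 (φ - θ)) + δ +
        ε * (nodeSin z φ * nodeSin z (φ - θ)) := by
    intro φ
    rw [densityCoeff, sub_sub_cancel, ← circInvDist, ← hK]
    ring
  simp_rw [hexp]
  simp only [e0, e1, n1]
  simp only [n0]
  have hsub : ∀ x y x' y' k : ℝ, IntervalIntegrable (fun φ => k *
      ((x * Real.cos φ + y * Real.sin φ) * (x' * Real.cos φ + y' * Real.sin φ)))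
      MeasureTheory.volume 0 (2 * Real.pi) := fun x y x' y' k =>
    Continuous.intervalIntegrable (by fun_prop) _ _
  rw [intervalIntegral.integral_add ((((hsub _ _ _ _ _).add (hsub _ _ _ _ _)).add
      (hsub _ _ _ _ _)).add intervalIntegrable_const) (hsub _ _ _ _ _),
    intervalIntegral.integral_add (((hsub _ _ _ _ _).add (hsub _ _ _ _ _)).add
      (hsub _ _ _ _ _)) intervalIntegrable_const,
    intervalIntegral.integral_add ((hsub _ _ _ _ _).add (hsub _ _ _ _ _)) (hsub _ _ _ _ _),
    intervalIntegral.integral_add (hsub _ _ _ _ _) (hsub _ _ _ _ _)]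
  simp only [intervalIntegral.integral_const_mul, integral_trig_quadratic,
    intervalIntegral.integral_const, smul_eq_mul, sub_zero]
  have hL0 : L₀ ^ 2 * (z (.inl 0) ^ 2 + z (.inr 0) ^ 2) = 4 * quarterEccSq Λ z 0 := by
    have := hΛ 0
    rw [hL₀, inv_pow, Real.sq_sqrt this.le, quarterEccSq, Fin.castSucc_zero]
    field_simp
  have hL1 : L₁ ^ 2 * (z (.inl 1) ^ 2 + z (.inr 1) ^ 2) = 4 * quarterEccSq Λ z 1 := by
    have := hΛ 1
    rw [hL₁, inv_pow, Real.sq_sqrt this.le, quarterEccSq, hone]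
    field_simp
  have hSC : S ^ 2 + C ^ 2 = 1 := Real.sin_sq_add_cos_sq θ
  have hKD : K ^ 2 * (a 0 ^ 2 + a 1 ^ 2 - 2 * a 0 * a 1 * C) = 1 := circInvDist_sq_mul h1 h01 θ
  have hW : radialLaplacian a θ = 2 * a 0 * a 1 * C * K ^ 3 -
    3 * (a 0 * a 1) ^ 2 * S ^ 2 * K ^ 5 := rfl
  -- The mean square of `eccLin` over `φ` is `2 * quarterEccSq`, so `α` combines with its share of
  -- `δ`; using `K² · circDistSq = 1`, both planets yield the same function of `θ`.
  have i0 : 2 * α - 6 * K + (4 * a 0 ^ 2 - 4 * a 0 * a 1 * C) * K ^ 3 = radialLaplacian a θ := by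
    rw [hW, hα, hA]
    linear_combination (3 * a 0 ^ 2 * K ^ 3) * hKD + (3 * (a 0 * a 1) ^ 2 * K ^ 5) * hSC
  have i1 : 2 * β - 6 * K + (4 * a 1 ^ 2 - 4 * a 0 * a 1 * C) * K ^ 3 = radialLaplacian a θ := by
    rw [hW, hβ, hB]
    linear_combination (3 * a 1 ^ 2 * K ^ 3) * hKD + (3 * (a 0 * a 1) ^ 2 * K ^ 5) * hSC
  have i2 : γ = 2 * K - radialLaplacian a θ := by
    rw [hW, hγ, hA, hB]
    linear_combination (-2 * K - 3 * a 0 * a 1 * C * K ^ 3) * hKD +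
      (-3 * (a 0 * a 1) ^ 2 * K ^ 5) * hSC
  rw [← i2]
  have hone2 : (L₁ * (z (.inl 1) * C + z (.inr 1) * S)) * (L₁ * (z (.inl 1) * C + z (.inr 1) * S)) +
      (L₁ * (z (.inl 1) * S - z (.inr 1) * C)) * (L₁ * (z (.inl 1) * S - z (.inr 1) * C)) =
      4 * quarterEccSq Λ z 1 := by
    rw [← hL1]
    linear_combination (L₁ ^ 2 * (z (.inl 1) ^ 2 + z (.inr 1) ^ 2)) * hSC
  have hone1 : L₀ * z (.inl 0) * (L₀ * z (.inl 0)) + L₀ * z (.inr 0) * (L₀ * z (.inr 0)) =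
      4 * quarterEccSq Λ z 0 := by
    rw [← hL0]; ring
  rw [hone1, hone2, hδ, hε]
  linear_combination (2 * Real.pi * quarterEccSq Λ z 0) * i0 +
    (2 * Real.pi * quarterEccSq Λ z 1) * i1

theorem continuous_densityCoeff (h1 : 0 < a 1) (h01 : a 1 < a 0) (z : Fin 3 ⊕ Fin 3 → ℝ) :
    Continuous fun p : ℝ × ℝ => densityCoeff a Λ z p.1 p.2 := by
  have hK : Continuous fun p : ℝ × ℝ => (√(circDistSq a (p.1 - p.2)))⁻¹ :=
    (continuous_circInvDist h1 h01).comp (f := fun p : ℝ × ℝ => p.1 - p.2) (by fun_prop)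
  unfold densityCoeff eccLin nodeSin
  fun_prop

theorem densityCoeff_add_two_pi_right (z : Fin 3 ⊕ Fin 3 → ℝ) (θ₀ θ₁ : ℝ) :
    densityCoeff a Λ z θ₀ (θ₁ + 2 * Real.pi) = densityCoeff a Λ z θ₀ θ₁ := by
  simp [densityCoeff, eccLin, nodeSin, circDistSq, ← sub_sub]

/-- Substitute `θ₁ = θ₀ - θ` and exchange the integrals: the rotation average comes first, then the
integral over the difference of longitudes. -/
theorem integral_integral_densityCoeff (hΛ : ∀ j, 0 < Λ j) (h1 : 0 < a 1) (h01 : a 1 < a 0)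
    (z : Fin 3 ⊕ Fin 3 → ℝ) :
    ∫ θ₀ in (0 : ℝ)..(2 * Real.pi), ∫ θ₁ in (0 : ℝ)..(2 * Real.pi), densityCoeff a Λ z θ₀ θ₁ =
      Real.pi * (a 0 * a 1) *
        ((2 * (quarterEccSq Λ z 0 + quarterEccSq Λ z 1) -
          (1 / Λ 0 - 1 / Λ 1) / 2 * (z (.inl 2) ^ 2 + z (.inr 2) ^ 2)) *
          (∫ θ in (0 : ℝ)..(2 * Real.pi), Real.cos θ * circInvDist a θ ^ 3) -
        (z (.inl 0) * z (.inl 1) - z (.inr 0) * z (.inr 1)) * ((√(Λ 0))⁻¹ * (√(Λ 1))⁻¹) *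
          ∫ θ in (0 : ℝ)..(2 * Real.pi), Real.cos (2 * θ) * circInvDist a θ ^ 3) := by
  have hc := continuous_densityCoeff (Λ := Λ) h1 h01 z
  have hK := continuous_circInvDist h1 h01
  have hW := continuous_radialLaplacian h1 h01
  have hshift : ∀ θ₀, ∫ θ₁ in (0 : ℝ)..(2 * Real.pi), densityCoeff a Λ z θ₀ θ₁ =
      ∫ θ in (0 : ℝ)..(2 * Real.pi), densityCoeff a Λ z θ₀ (θ₀ - θ) := fun θ₀ =>
    (integral_comp_sub_of_periodic (g := fun θ₁ => densityCoeff a Λ z θ₀ θ₁)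
      (fun θ₁ => densityCoeff_add_two_pi_right z θ₀ θ₁) θ₀).symm
  simp_rw [hshift]
  have hc' : Continuous fun p : ℝ × ℝ => densityCoeff a Λ z p.1 (p.1 - p.2) :=
    hc.comp (f := fun p : ℝ × ℝ => (p.1, p.1 - p.2)) (by fun_prop)
  have hint : MeasureTheory.IntegrableOn
      (Function.uncurry fun θ₀ θ => densityCoeff a Λ z θ₀ (θ₀ - θ))
      (Set.uIoc 0 (2 * Real.pi) ×ˢ Set.uIoc 0 (2 * Real.pi)) MeasureTheory.volume :=
    (hc'.continuousOn.integrableOn_compact (isCompact_uIcc.prod isCompact_uIcc)).mono_set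
      (Set.prod_mono Set.uIoc_subset_uIcc Set.uIoc_subset_uIcc)
  rw [MeasureTheory.intervalIntegral_intervalIntegral_swap hint]
  simp_rw [integral_densityCoeff_rotation hΛ h1 h01 z]
  have c1 : Continuous fun θ => Real.cos θ * (2 * circInvDist a θ - radialLaplacian a θ) := by
    fun_prop
  have c2 : Continuous fun θ => Real.sin θ * (2 * circInvDist a θ - radialLaplacian a θ) := by
    fun_prop
  have c3 : Continuous fun θ => Real.cos θ * circInvDist a θ ^ 3 := by fun_prop
  rw [intervalIntegral.integral_sub (Continuous.intervalIntegrable (by fun_prop) _ _)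
      (Continuous.intervalIntegrable (by fun_prop) _ _),
    intervalIntegral.integral_add (Continuous.intervalIntegrable (by fun_prop) _ _)
      (Continuous.intervalIntegrable (by fun_prop) _ _)]
  simp only [intervalIntegral.integral_const_mul]
  rw [intervalIntegral.integral_add (Continuous.intervalIntegrable (by fun_prop) _ _)
      (Continuous.intervalIntegrable (by fun_prop) _ _)]
  simp only [intervalIntegral.integral_const_mul]
  rw [integral_radialLaplacian h1 h01, integral_cos_mul_sub h1 h01, integral_sin_mul_sub h1 h01]
  ring

end Averages

/-! ### Linear algebra of the linearised vector field -/

section Spectrum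

/-- The vectors `v ± w⁻¹ T v` are zero or eigenvectors for `±w`, and `v` is half their sum. -/
theorem mem_iSup_eigenspace_of_sq {V : Type*} [AddCommGroup V] [Module ℂ V]
    (T : Module.End ℂ V) {v : V} {w : ℂ} (hw : w ≠ 0) (h : T (T v) = w ^ 2 • v) :
    v ∈ ⨆ w : ℂ, Module.End.eigenspace T w := by
  have hp : v + w⁻¹ • T v ∈ ⨆ w : ℂ, Module.End.eigenspace T w := by
    refine Submodule.mem_iSup_of_mem w (Module.End.mem_eigenspace_iff.2 ?_)
    rw [map_add, map_smul, h, smul_add, smul_smul, smul_smul, mul_inv_cancel₀ hw, one_smul]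
    have : w⁻¹ * w ^ 2 = w := by field_simp
    rw [this, add_comm]
  have hm : v - w⁻¹ • T v ∈ ⨆ w : ℂ, Module.End.eigenspace T w := by
    refine Submodule.mem_iSup_of_mem (-w) (Module.End.mem_eigenspace_iff.2 ?_)
    rw [map_sub, map_smul, h, smul_sub, smul_smul, smul_smul, neg_mul, mul_inv_cancel₀ hw]
    have : w⁻¹ * w ^ 2 = w := by field_simp
    rw [this]
    module
  have : v = (1 / 2 : ℂ) • (v + w⁻¹ • T v) + (1 / 2 : ℂ) • (v - w⁻¹ • T v) := by module
  rw [this]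
  exact add_mem (Submodule.smul_mem _ _ hp) (Submodule.smul_mem _ _ hm)

/-- Since `(T² - w₁²)(T² - w₂²)` kills `v` and `w₁² ≠ w₂²`, `v` splits into parts on which `T²` is
scalar. -/
theorem mem_iSup_eigenspace_of_quartic {V : Type*} [AddCommGroup V] [Module ℂ V]
    (T : Module.End ℂ V) {v : V} {w₁ w₂ : ℂ} (h₁ : w₁ ≠ 0) (h₂ : w₂ ≠ 0)
    (hne : w₁ ^ 2 ≠ w₂ ^ 2)
    (h : T (T (T (T v))) = (w₁ ^ 2 + w₂ ^ 2) • T (T v) - (w₁ ^ 2 * w₂ ^ 2) • v) :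
    v ∈ ⨆ w : ℂ, Module.End.eigenspace T w := by
  have e1 : T (T v) - w₂ ^ 2 • v ∈ ⨆ w : ℂ, Module.End.eigenspace T w := by
    refine mem_iSup_eigenspace_of_sq T h₁ ?_
    simp only [map_sub, map_smul, h]
    module
  have e2 : T (T v) - w₁ ^ 2 • v ∈ ⨆ w : ℂ, Module.End.eigenspace T w := by
    refine mem_iSup_eigenspace_of_sq T h₂ ?_
    simp only [map_sub, map_smul, h]
    module
  have hd : w₁ ^ 2 - w₂ ^ 2 ≠ 0 := sub_ne_zero.2 hne
  have : v = (w₁ ^ 2 - w₂ ^ 2)⁻¹ • ((T (T v) - w₂ ^ 2 • v) - (T (T v) - w₁ ^ 2 • v)) := by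
    rw [sub_sub_sub_cancel_left, ← sub_smul, smul_smul, inv_mul_cancel₀ hd, one_smul]
  rw [this]
  exact Submodule.smul_mem _ _ (sub_mem e1 e2)

theorem re_eq_zero_of_sq_eq_neg {w : ℂ} {x : ℝ} (hx : 0 < x) (h : w ^ 2 = -(x : ℂ)) :
    w.re = 0 ∧ w ≠ 0 := by
  have hre := congrArg Complex.re h
  have him := congrArg Complex.im h
  simp [pow_two] at hre him
  constructor
  · by_contra h0
    have him0 : w.im = 0 := by
      have : w.re * w.im = 0 := by linarith
      exact (mul_eq_zero.1 this).resolve_left h0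
    rw [him0] at hre
    nlinarith
  · rintro rfl
    simp at hre
    linarith

theorem im_eq_zero_of_sq_eq {w : ℂ} {x : ℝ} (hx : 0 ≤ x) (h : w ^ 2 = (x : ℂ)) : w.im = 0 := by
  have hre := congrArg Complex.re h
  have him := congrArg Complex.im h
  simp [pow_two] at hre him
  by_contra h0
  have hre0 : w.re = 0 := by
    have : w.re * w.im = 0 := by linarith
    exact (mul_eq_zero.1 this).resolve_right h0
  rw [hre0] at hre
  have : 0 < w.im * w.im := mul_self_pos.2 h0
  linarith

/-- The Hessian of `A (η₁² + ξ₁²) / 2 + D (η₂² + ξ₂²) / 2 + g (η₁ η₂ - ξ₁ ξ₂) + h (p² + q²) / 2`. -/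
def secularHessian (A D g h : ℝ) : Matrix (Fin 3 ⊕ Fin 3) (Fin 3 ⊕ Fin 3) ℝ :=
  Matrix.fromBlocks !![A, g, 0; g, D, 0; 0, 0, h] 0 0 !![A, -g, 0; -g, D, 0; 0, 0, h]

variable {A D g h : ℝ}

theorem toLin'_secular_apply (x y : Fin 3 → ℂ) :
    Matrix.toLin' ((Matrix.J (Fin 3) ℝ * secularHessian A D g h).map (fun r : ℝ => (r : ℂ)))
      (Sum.elim x y) =
    Sum.elim ![-(A * y 0 - g * y 1), -(-g * y 0 + D * y 1), -(h * y 2)]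
      ![A * x 0 + g * x 1, g * x 0 + D * x 1, h * x 2] := by
  have hJ : Matrix.J (Fin 3) ℝ * secularHessian A D g h =
      Matrix.fromBlocks 0 (-!![A, -g, 0; -g, D, 0; 0, 0, h]) !![A, g, 0; g, D, 0; 0, 0, h] 0 := by
    simp [Matrix.J, secularHessian, Matrix.fromBlocks_multiply]
  rw [hJ, Matrix.toLin'_apply, Matrix.fromBlocks_map, Matrix.fromBlocks_mulVec]
  ext k
  rcases k with k | k <;> fin_cases k <;>
    simp [Matrix.mulVec, dotProduct, Fin.sum_univ_three] <;> ring

/-- `x₁`, `x₂` are the squared frequencies. The discriminant of their quadratic equation factors as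
`(A - D)² ((A + D)² - 4g²)`, which is positive. -/
theorem exists_secular_frequencies (hAD : A ≠ D) (hg : g ^ 2 < A * D) :
    ∃ x₁ x₂ : ℝ, 0 < x₁ ∧ 0 < x₂ ∧ x₁ ≠ x₂ ∧ x₁ + x₂ = A ^ 2 + D ^ 2 - 2 * g ^ 2 ∧
      x₁ * x₂ = (A * D - g ^ 2) ^ 2 := by
  set τ := A ^ 2 + D ^ 2 - 2 * g ^ 2 with hτ
  have hsq : 0 < (A - D) ^ 2 := by
    have := sub_ne_zero.2 hAD
    positivity
  have hdisc : 0 < τ ^ 2 - 4 * (A * D - g ^ 2) ^ 2 := by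
    have : τ ^ 2 - 4 * (A * D - g ^ 2) ^ 2 = (A - D) ^ 2 * ((A + D) ^ 2 - 4 * g ^ 2) := by
      rw [hτ]; ring
    rw [this]
    refine mul_pos hsq ?_
    nlinarith
  have hτ0 : 0 < τ := by nlinarith
  set d := √(τ ^ 2 - 4 * (A * D - g ^ 2) ^ 2) with hd
  have hd0 : 0 < d := Real.sqrt_pos.2 hdisc
  have hd2 : d ^ 2 = τ ^ 2 - 4 * (A * D - g ^ 2) ^ 2 := Real.sq_sqrt hdisc.le
  have hΔ : 0 < (A * D - g ^ 2) ^ 2 := pow_pos (sub_pos.2 hg) 2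
  have hdτ : d < τ := by nlinarith
  refine ⟨(τ + d) / 2, (τ - d) / 2, by linarith, by linarith, by linarith, by ring, ?_⟩
  linear_combination (-1 / 4 : ℝ) * hd2

theorem sqrt_mul_I_sq {x : ℝ} (hx : 0 < x) : ((√x : ℝ) * Complex.I) ^ 2 = -(x : ℂ) := by
  rw [mul_pow, Complex.I_sq, ← Complex.ofReal_pow, Real.sq_sqrt hx.le]
  ring

theorem sqrt_mul_I_ne_zero {x : ℝ} (hx : 0 < x) : ((√x : ℝ) : ℂ) * Complex.I ≠ 0 :=
  mul_ne_zero (Complex.ofReal_ne_zero.2 (Real.sqrt_pos.2 hx).ne') Complex.I_ne_zero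

theorem iSup_eigenspace_secular (hAD : A ≠ D) (hg : g ^ 2 < A * D)
    (hh : 0 < h) :
    (⨆ w : ℂ, Module.End.eigenspace (Matrix.toLin'
      ((Matrix.J (Fin 3) ℝ * secularHessian A D g h).map (fun r : ℝ => (r : ℂ)))) w) = ⊤ := by
  obtain ⟨x₁, x₂, h1, h2, hne, hsum, hprod⟩ := exists_secular_frequencies hAD hg
  have hsum' : (x₁ : ℂ) + x₂ = A ^ 2 + D ^ 2 - 2 * g ^ 2 := by exact_mod_cast hsum
  have hprod' : (x₁ : ℂ) * x₂ = (A * D - g ^ 2) ^ 2 := by exact_mod_cast hprod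
  rw [eq_top_iff]
  rintro v -
  set T := Matrix.toLin'
      ((Matrix.J (Fin 3) ℝ * secularHessian A D g h).map (fun r : ℝ => (r : ℂ))) with hT
  have hv : v = Sum.elim ![v (.inl 0), v (.inl 1), 0] ![v (.inr 0), v (.inr 1), 0] +
      Sum.elim ![0, 0, v (.inl 2)] ![0, 0, v (.inr 2)] := by
    ext k
    rcases k with k | k <;> fin_cases k <;> simp
  rw [hv]
  -- The oscillator `(p, q)` decouples; on the other four variables `T⁴ + (x₁ + x₂) T² + x₁ x₂ = 0`.
  refine add_mem ?_ ?_
  · refine mem_iSup_eigenspace_of_quartic T (sqrt_mul_I_ne_zero h1) (sqrt_mul_I_ne_zero h2) ?_ ?_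
    · rw [sqrt_mul_I_sq h1, sqrt_mul_I_sq h2]
      exact fun e => hne (by exact_mod_cast neg_injective e)
    · rw [sqrt_mul_I_sq h1, sqrt_mul_I_sq h2, neg_mul_neg, hprod', ← neg_add, hsum']
      simp only [hT, toLin'_secular_apply]
      ext k
      rcases k with k | k <;> fin_cases k <;> simp <;> ring
  · refine mem_iSup_eigenspace_of_sq T (w := (h : ℂ) * Complex.I) ?_ ?_
    · exact mul_ne_zero (Complex.ofReal_ne_zero.2 hh.ne') Complex.I_ne_zero
    · simp only [hT, toLin'_secular_apply]
      ext k
      rcases k with k | k <;> fin_cases k <;> simp [mul_pow] <;> ring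

theorem eigenvalue_secular (hAD : A ≠ D) (hg : g ^ 2 < A * D)
    (hh : 0 < h) {w : ℂ} (hw : Module.End.HasEigenvalue (Matrix.toLin'
      ((Matrix.J (Fin 3) ℝ * secularHessian A D g h).map (fun r : ℝ => (r : ℂ)))) w) :
    w.re = 0 ∧ w ≠ 0 := by
  obtain ⟨x₁, x₂, h1, h2, -, hsum, hprod⟩ := exists_secular_frequencies hAD hg
  have hsum' : (x₁ : ℂ) + x₂ = A ^ 2 + D ^ 2 - 2 * g ^ 2 := by exact_mod_cast hsum
  have hprod' : (x₁ : ℂ) * x₂ = (A * D - g ^ 2) ^ 2 := by exact_mod_cast hprod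
  obtain ⟨v, hv⟩ := hw.exists_hasEigenvector
  have hTv := hv.apply_eq_smul
  have hv0 := hv.2
  have hve : v = Sum.elim (fun i => v (.inl i)) (fun i => v (.inr i)) := by
    ext k; rcases k with k | k <;> rfl
  rw [hve, toLin'_secular_apply] at hTv
  have q0 := congrFun hTv (.inl 0)
  have q1 := congrFun hTv (.inl 1)
  have q2 := congrFun hTv (.inl 2)
  have p0 := congrFun hTv (.inr 0)
  have p1 := congrFun hTv (.inr 1)
  have p2 := congrFun hTv (.inr 2)
  simp only [Sum.elim_inl, Sum.elim_inr, Pi.smul_apply, smul_eq_mul, Matrix.cons_val_zero,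
    Matrix.cons_val_one, Matrix.cons_val] at q0 q1 q2 p0 p1 p2
  have key : (w ^ 2 = -(x₁ : ℂ) ∨ w ^ 2 = -(x₂ : ℂ)) ∨ w ^ 2 = -((h ^ 2 : ℝ) : ℂ) := by
    by_contra hcon
    rw [not_or, not_or] at hcon
    obtain ⟨⟨n1, n2⟩, n3⟩ := hcon
    have m1 : w ^ 2 + x₁ ≠ 0 := fun e => n1 (eq_neg_of_add_eq_zero_left e)
    have m2 : w ^ 2 + x₂ ≠ 0 := fun e => n2 (eq_neg_of_add_eq_zero_left e)
    have m3 : w ^ 2 + (h : ℂ) ^ 2 ≠ 0 := fun e => n3 (by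
      push_cast; exact eq_neg_of_add_eq_zero_left e)
    have m12 : w ^ 4 + (A ^ 2 + D ^ 2 - 2 * g ^ 2) * w ^ 2 + (A * D - g ^ 2) ^ 2 ≠ 0 := by
      have : w ^ 4 + (A ^ 2 + D ^ 2 - 2 * g ^ 2) * w ^ 2 + ((A : ℂ) * D - g ^ 2) ^ 2 =
          (w ^ 2 + x₁) * (w ^ 2 + x₂) := by
        rw [← hprod', ← hsum']; ring
      rw [this]
      exact mul_ne_zero m1 m2
    have r2 : v (.inl 2) = 0 := by
      have : (w ^ 2 + (h : ℂ) ^ 2) * v (.inl 2) = 0 := by linear_combination -w * q2 + h * p2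
      exact (mul_eq_zero.1 this).resolve_left m3
    have t2 : v (.inr 2) = 0 := by
      have : (w ^ 2 + (h : ℂ) ^ 2) * v (.inr 2) = 0 := by linear_combination -w * p2 - h * q2
      exact (mul_eq_zero.1 this).resolve_left m3
    -- The square of the linearised field does not mix the `η` and `ξ` blocks; eliminating within
    -- each block produces the factor that is nonzero by `m12`.
    have a0 : w ^ 2 * v (.inl 0) = -(A ^ 2 - g ^ 2) * v (.inl 0) - g * (A - D) * v (.inl 1) := by
      linear_combination -w * q0 + A * p0 - g * p1
    have a1 : w ^ 2 * v (.inl 1) = g * (A - D) * v (.inl 0) - (D ^ 2 - g ^ 2) * v (.inl 1) := by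
      linear_combination -w * q1 - g * p0 + D * p1
    have b0 : w ^ 2 * v (.inr 0) = -(A ^ 2 - g ^ 2) * v (.inr 0) + g * (A - D) * v (.inr 1) := by
      linear_combination -w * p0 - A * q0 - g * q1
    have b1 : w ^ 2 * v (.inr 1) = -g * (A - D) * v (.inr 0) - (D ^ 2 - g ^ 2) * v (.inr 1) := by
      linear_combination -w * p1 - g * q0 - D * q1
    have r0 : v (.inl 0) = 0 := by
      refine (mul_eq_zero.1 (?_ : (w ^ 4 + (A ^ 2 + D ^ 2 - 2 * g ^ 2) * w ^ 2 +
        (A * D - g ^ 2) ^ 2) * v (.inl 0) = 0)).resolve_left m12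
      linear_combination (w ^ 2 + D ^ 2 - g ^ 2) * a0 - g * (A - D) * a1
    have r1 : v (.inl 1) = 0 := by
      refine (mul_eq_zero.1 (?_ : (w ^ 4 + (A ^ 2 + D ^ 2 - 2 * g ^ 2) * w ^ 2 +
        (A * D - g ^ 2) ^ 2) * v (.inl 1) = 0)).resolve_left m12
      linear_combination (w ^ 2 + A ^ 2 - g ^ 2) * a1 + g * (A - D) * a0
    have t0 : v (.inr 0) = 0 := by
      refine (mul_eq_zero.1 (?_ : (w ^ 4 + (A ^ 2 + D ^ 2 - 2 * g ^ 2) * w ^ 2 +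
        (A * D - g ^ 2) ^ 2) * v (.inr 0) = 0)).resolve_left m12
      linear_combination (w ^ 2 + D ^ 2 - g ^ 2) * b0 + g * (A - D) * b1
    have t1 : v (.inr 1) = 0 := by
      refine (mul_eq_zero.1 (?_ : (w ^ 4 + (A ^ 2 + D ^ 2 - 2 * g ^ 2) * w ^ 2 +
        (A * D - g ^ 2) ^ 2) * v (.inr 1) = 0)).resolve_left m12
      linear_combination (w ^ 2 + A ^ 2 - g ^ 2) * b1 - g * (A - D) * b0
    refine hv0 ?_
    ext k
    rcases k with k | k <;> fin_cases k <;> simpa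
  rcases key with (hk | hk) | hk
  · exact re_eq_zero_of_sq_eq_neg h1 hk
  · exact re_eq_zero_of_sq_eq_neg h2 hk
  · exact re_eq_zero_of_sq_eq_neg (pow_pos hh 2) hk

/-- The off-diagonal entries are imaginary, but only their product enters the characteristic
polynomial, which is therefore real, with discriminant `(A + D)² - 4g²`. -/
theorem eigenvalue_sigma_real (hg : g ^ 2 < A * D) {w : ℂ}
    (hw : Module.End.HasEigenvalue (Matrix.toLin'
      !![((-A : ℝ) : ℂ), -Complex.I * (g : ℂ); -Complex.I * (g : ℂ), (D : ℂ)]) w) :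
    w.im = 0 := by
  obtain ⟨v, hv⟩ := hw.exists_hasEigenvector
  have hTv := hv.apply_eq_smul
  rw [Matrix.toLin'_apply] at hTv
  have q0 := congrFun hTv 0
  have q1 := congrFun hTv 1
  simp [Matrix.mulVec, dotProduct, Fin.sum_univ_two] at q0 q1
  have hI := Complex.I_sq
  have hchar : w ^ 2 - (D - A) * w + (g ^ 2 - A * D) = 0 := by
    by_contra hne
    refine hv.2 ?_
    ext k
    fin_cases k
    · refine (mul_eq_zero.1 (?_ : (w ^ 2 - (D - A) * w + (g ^ 2 - A * D)) * v 0 = 0)).resolve_left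
        hne
      linear_combination (-w + D) * q0 + Complex.I * g * q1 + g ^ 2 * v 0 * hI
    · refine (mul_eq_zero.1 (?_ : (w ^ 2 - (D - A) * w + (g ^ 2 - A * D)) * v 1 = 0)).resolve_left
        hne
      linear_combination (-w - A) * q1 + Complex.I * g * q0 + g ^ 2 * v 1 * hI
  have hsq : (2 * w - (D - A)) ^ 2 = (((A + D) ^ 2 - 4 * g ^ 2 : ℝ) : ℂ) := by
    push_cast
    linear_combination 4 * hchar
  have him := im_eq_zero_of_sq_eq (by nlinarith [sq_nonneg (A - D)]) hsq
  simp at him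
  exact him

end Spectrum

/-! ### Positivity of the Laplace coefficients -/

section Positivity

variable {a : Fin 2 → ℝ}

theorem circInvDist_pos (h1 : 0 < a 1) (h01 : a 1 < a 0) (θ : ℝ) : 0 < circInvDist a θ :=
  inv_pos.2 (Real.sqrt_pos.2 (circDistSq_pos h1 h01 θ))

theorem circInvDist_lt (h1 : 0 < a 1) (h01 : a 1 < a 0) {θ φ : ℝ}
    (h : Real.cos θ < Real.cos φ) : circInvDist a θ < circInvDist a φ := by
  refine (inv_lt_inv₀ (Real.sqrt_pos.2 (circDistSq_pos h1 h01 θ))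
    (Real.sqrt_pos.2 (circDistSq_pos h1 h01 φ))).2
    (Real.sqrt_lt_sqrt (circDistSq_pos h1 h01 φ).le ?_)
  have := mul_lt_mul_of_pos_left h (mul_pos (h1.trans h01) h1)
  rw [circDistSq, circDistSq]
  linarith

/-- The inverse distance increases with `cos θ`; this drives both comparisons of Laplace
coefficients. -/
theorem mul_pow_sub_pow_nonneg (h1 : 0 < a 1) (h01 : a 1 < a 0) (θ φ : ℝ) (n : ℕ) :
    0 ≤ (Real.cos θ - Real.cos φ) * (circInvDist a θ ^ n - circInvDist a φ ^ n) := by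
  have hθ := circInvDist_pos h1 h01 θ
  have hφ := circInvDist_pos h1 h01 φ
  rcases lt_trichotomy (Real.cos θ) (Real.cos φ) with h | h | h
  · exact mul_nonneg_of_nonpos_of_nonpos (by linarith)
      (sub_nonpos.2 (pow_le_pow_left₀ hθ.le (circInvDist_lt h1 h01 h).le n))
  · simp [h]
  · exact mul_nonneg (by linarith)
      (sub_nonneg.2 (pow_le_pow_left₀ hφ.le (circInvDist_lt h1 h01 h).le n))

theorem integral_cos_two_mul_pos (h1 : 0 < a 1) (h01 : a 1 < a 0) :
    0 < ∫ θ in (0 : ℝ)..(2 * Real.pi), Real.cos (2 * θ) * circInvDist a θ ^ 3 := by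
  have hK := continuous_circInvDist h1 h01
  set k := circInvDist a (Real.pi / 2) with hk
  -- Integration by parts turns `cos 2θ K³` into a multiple of `sin² θ cos θ K⁵`. As `sin² θ cos θ`
  -- has mean zero, `K⁵` may be lowered by its value at `π/2`, where `cos θ` changes sign.
  have hd : ∀ θ, HasDerivAt (fun θ => Real.sin θ * Real.cos θ * circInvDist a θ ^ 3 +
        a 0 * a 1 * k ^ 5 * Real.sin θ ^ 3)
      (Real.cos (2 * θ) * circInvDist a θ ^ 3 - 3 * (a 0 * a 1) *
        (Real.sin θ ^ 2 * Real.cos θ * (circInvDist a θ ^ 5 - k ^ 5))) θ := fun θ => by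
    refine ((((Real.hasDerivAt_sin θ).mul (Real.hasDerivAt_cos θ)).mul
      ((hasDerivAt_circInvDist h1 h01 θ).pow 3)).add
      (((Real.hasDerivAt_sin θ).pow 3).const_mul (a 0 * a 1 * k ^ 5))).congr_deriv ?_
    rw [Real.cos_two_mul]
    simp
    linear_combination (-circInvDist a θ ^ 3) * Real.sin_sq_add_cos_sq θ
  have key := intervalIntegral.integral_eq_sub_of_hasDerivAt (a := 0) (b := 2 * Real.pi)
    (fun θ _ => hd θ) (Continuous.intervalIntegrable (by fun_prop) _ _)
  rw [intervalIntegral.integral_sub (Continuous.intervalIntegrable (by fun_prop) _ _)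
    (Continuous.intervalIntegrable (by fun_prop) _ _), intervalIntegral.integral_const_mul] at key
  have hpos : 0 < ∫ θ in (0 : ℝ)..(2 * Real.pi),
      Real.sin θ ^ 2 * Real.cos θ * (circInvDist a θ ^ 5 - k ^ 5) := by
    refine intervalIntegral.integral_pos Real.two_pi_pos (Continuous.continuousOn (by fun_prop))
      (fun θ _ => ?_) ⟨Real.pi / 4, ⟨by positivity, by linarith [Real.pi_pos]⟩, ?_⟩
    · have h := mul_pow_sub_pow_nonneg h1 h01 θ (Real.pi / 2) 5
      rw [Real.cos_pi_div_two, sub_zero] at h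
      rw [mul_assoc]
      exact mul_nonneg (sq_nonneg _) h
    · have hlt : k < circInvDist a (Real.pi / 4) := by
        refine circInvDist_lt h1 h01 ?_
        rw [Real.cos_pi_div_two, Real.cos_pi_div_four]
        positivity
      have := pow_lt_pow_left₀ hlt (circInvDist_pos h1 h01 _).le (n := 5) (by norm_num)
      rw [Real.sin_pi_div_four, Real.cos_pi_div_four]
      exact mul_pos (by positivity) (sub_pos.2 this)
  have h0 := mul_pos (mul_pos three_pos (mul_pos (h1.trans h01) h1)) hpos
  simp at key
  linarith

theorem integral_cos_two_mul_lt (h1 : 0 < a 1) (h01 : a 1 < a 0) :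
    ∫ θ in (0 : ℝ)..(2 * Real.pi), Real.cos (2 * θ) * circInvDist a θ ^ 3 <
      ∫ θ in (0 : ℝ)..(2 * Real.pi), Real.cos θ * circInvDist a θ ^ 3 := by
  have hK := continuous_circInvDist h1 h01
  -- `cos θ - cos 2θ = 2 (1 - cos θ)(cos θ + 1/2)` changes sign where `cos θ = -1/2`; having mean
  -- zero, it allows `K³` to be replaced by `K³ - k³`.
  set φ := Real.arccos (-(1 / 2)) with hφ
  have hcos : Real.cos φ = -(1 / 2) := Real.cos_arccos (by norm_num) (by norm_num)
  set k := circInvDist a φ with hk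
  have hpos : 0 < ∫ θ in (0 : ℝ)..(2 * Real.pi),
      2 * (1 - Real.cos θ) * ((Real.cos θ - Real.cos φ) * (circInvDist a θ ^ 3 - k ^ 3)) := by
    refine intervalIntegral.integral_pos Real.two_pi_pos (Continuous.continuousOn (by fun_prop))
      (fun θ _ => ?_) ⟨Real.pi / 2, ⟨by positivity, by linarith [Real.pi_pos]⟩, ?_⟩
    · exact mul_nonneg (by linarith [Real.cos_le_one θ]) (mul_pow_sub_pow_nonneg h1 h01 θ φ 3)
    · have hlt : k < circInvDist a (Real.pi / 2) := by
        refine circInvDist_lt h1 h01 ?_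
        rw [Real.cos_pi_div_two, hcos]
        norm_num
      have := pow_lt_pow_left₀ hlt (circInvDist_pos h1 h01 _).le (n := 3) (by norm_num)
      rw [Real.cos_pi_div_two, hcos]
      have := sub_pos.2 this
      positivity
  have hsplit : ∀ θ, 2 * (1 - Real.cos θ) *
      ((Real.cos θ - Real.cos φ) * (circInvDist a θ ^ 3 - k ^ 3)) =
      Real.cos θ * circInvDist a θ ^ 3 - Real.cos (2 * θ) * circInvDist a θ ^ 3 -
        k ^ 3 * (Real.cos θ - Real.cos (2 * θ)) := fun θ => by
    rw [Real.cos_two_mul, hcos]; ring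
  have hzero : ∫ θ in (0 : ℝ)..(2 * Real.pi), (Real.cos θ - Real.cos (2 * θ)) = 0 := by
    have hd : ∀ θ, HasDerivAt (fun θ => Real.sin θ - Real.sin θ * Real.cos θ)
        (Real.cos θ - Real.cos (2 * θ)) θ := fun θ => by
      refine ((Real.hasDerivAt_sin θ).sub
        ((Real.hasDerivAt_sin θ).mul (Real.hasDerivAt_cos θ))).congr_deriv ?_
      rw [Real.cos_two_mul]
      linear_combination Real.sin_sq_add_cos_sq θ
    rw [intervalIntegral.integral_eq_sub_of_hasDerivAt (fun θ _ => hd θ)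
      (Continuous.intervalIntegrable (by fun_prop) _ _)]
    simp
  simp_rw [hsplit] at hpos
  rw [intervalIntegral.integral_sub (Continuous.intervalIntegrable (by fun_prop) _ _)
      (Continuous.intervalIntegrable (by fun_prop) _ _),
    intervalIntegral.integral_sub (Continuous.intervalIntegrable (by fun_prop) _ _)
      (Continuous.intervalIntegrable (by fun_prop) _ _),
    intervalIntegral.integral_const_mul, hzero] at hpos
  linarith

theorem one_sub_add_rpow_eq (h1 : 0 < a 1) (h01 : a 1 < a 0) (θ : ℝ) :
    (a 0 ^ 3)⁻¹ / (1 - 2 * (a 1 / a 0) * Real.cos θ + (a 1 / a 0) ^ 2) ^ (3 / 2 : ℝ) =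
      circInvDist a θ ^ 3 := by
  have h0 := h1.trans h01
  have hD := circDistSq_pos h1 h01 θ
  have e : circDistSq a θ = a 0 ^ 2 * (1 - 2 * (a 1 / a 0) * Real.cos θ + (a 1 / a 0) ^ 2) := by
    rw [circDistSq]
    field_simp
    ring
  have hx : 0 < 1 - 2 * (a 1 / a 0) * Real.cos θ + (a 1 / a 0) ^ 2 := by
    rw [e] at hD
    exact pos_of_mul_pos_right hD (by positivity)
  have hr : ∀ x : ℝ, 0 < x → x ^ (3 / 2 : ℝ) = √x ^ 3 := fun x hx => by
    rw [Real.sqrt_eq_rpow, ← Real.rpow_natCast, ← Real.rpow_mul hx.le]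
    norm_num
  rw [hr _ hx, circInvDist, e, Real.sqrt_mul (by positivity), Real.sqrt_sq h0.le]
  field_simp

theorem laplaceCoeff_eq (h1 : 0 < a 1) (h01 : a 1 < a 0) (k : ℤ) :
    laplaceCoeff (3 / 2) k (a 1 / a 0) = a 0 ^ 3 / (2 * Real.pi) *
      ∫ θ in (0 : ℝ)..(2 * Real.pi), Real.cos (k * θ) * circInvDist a θ ^ 3 := by
  have h0 := h1.trans h01
  rw [laplaceCoeff]
  simp_rw [← one_sub_add_rpow_eq h1 h01]
  have : ∀ θ : ℝ, Real.cos (k * θ) * ((a 0 ^ 3)⁻¹ /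
      (1 - 2 * (a 1 / a 0) * Real.cos θ + (a 1 / a 0) ^ 2) ^ (3 / 2 : ℝ)) = (a 0 ^ 3)⁻¹ *
      (Real.cos (k * θ) /
        (1 - 2 * (a 1 / a 0) * Real.cos θ + (a 1 / a 0) ^ 2) ^ (3 / 2 : ℝ)) := fun θ => by ring
  simp_rw [this]
  rw [intervalIntegral.integral_const_mul]
  field_simp

end Positivity

/-! ### The inequality between the secular coefficients -/

section Secular

variable {m₀ μ : ℝ} {m Λ : Fin 2 → ℝ}

theorem mul_integral_cos_eq_secS (h1 : 0 < semiAxis m₀ μ m Λ 1)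
    (h01 : semiAxis m₀ μ m Λ 1 < semiAxis m₀ μ m Λ 0) :
    m 0 * m 1 * (semiAxis m₀ μ m Λ 0 * semiAxis m₀ μ m Λ 1) *
      (∫ θ in (0 : ℝ)..(2 * Real.pi), Real.cos θ * circInvDist (semiAxis m₀ μ m Λ) θ ^ 3) =
      -(4 * Real.pi * secS m₀ μ m Λ) := by
  have h0 := h1.trans h01
  rw [secS, axisRatio, laplaceCoeff_eq h1 h01]
  simp only [Int.cast_one, one_mul]
  field_simp
  ring

theorem mul_integral_cos_two_eq_secST (h1 : 0 < semiAxis m₀ μ m Λ 1)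
    (h01 : semiAxis m₀ μ m Λ 1 < semiAxis m₀ μ m Λ 0) :
    m 0 * m 1 * (semiAxis m₀ μ m Λ 0 * semiAxis m₀ μ m Λ 1) *
      (∫ θ in (0 : ℝ)..(2 * Real.pi),
        Real.cos (2 * θ) * circInvDist (semiAxis m₀ μ m Λ) θ ^ 3) =
      4 * Real.pi * secST m₀ μ m Λ := by
  have h0 := h1.trans h01
  rw [secST, axisRatio, laplaceCoeff_eq h1 h01]
  simp only [Int.cast_ofNat]
  field_simp
  ring

/-- This gives all the spectral information: the sign of `s`, `s̃ ≠ 0`, and `s̃² < s²`. -/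
theorem secST_pos_and_lt (hm : ∀ j, 0 < m j) (h1 : 0 < semiAxis m₀ μ m Λ 1)
    (h01 : semiAxis m₀ μ m Λ 1 < semiAxis m₀ μ m Λ 0) :
    0 < secST m₀ μ m Λ ∧ secST m₀ μ m Λ < -secS m₀ μ m Λ := by
  have hc : 0 < m 0 * m 1 * (semiAxis m₀ μ m Λ 0 * semiAxis m₀ μ m Λ 1) :=
    mul_pos (mul_pos (hm 0) (hm 1)) (mul_pos (h1.trans h01) h1)
  have e1 := mul_integral_cos_eq_secS h1 h01
  have e2 := mul_integral_cos_two_eq_secST h1 h01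
  have p := mul_pos hc (integral_cos_two_mul_pos h1 h01)
  have q := mul_lt_mul_of_pos_left (integral_cos_two_mul_lt h1 h01) hc
  rw [e2] at p q
  rw [e1] at q
  have hpi : 0 < 4 * Real.pi := by positivity
  constructor
  · exact pos_of_mul_pos_right p hpi.le
  · refine lt_of_mul_lt_mul_left (?_ : 4 * Real.pi * _ < 4 * Real.pi * _) hpi.le
    linarith

end Secular

/-! ### The averaged perturbing function near the origin -/

section Evenness

variable (a Λ : Fin 2 → ℝ) (z : Fin 3 ⊕ Fin 3 → ℝ)

theorem orbitRadius_neg (j : Fin 2) (θ : ℝ) :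
    orbitRadius Λ (-z) j (θ + Real.pi) = orbitRadius Λ z j θ := by
  simp [orbitRadius, eccCos, circ]

/-- Changing the sign of `z` reverses both perihelia and the node, that is, turns the whole
configuration by half a turn about `C`. -/
theorem orbitDensity_neg (θ₀ θ₁ : ℝ) :
    orbitDensity a Λ (-z) (θ₀ + Real.pi) (θ₁ + Real.pi) = orbitDensity a Λ z θ₀ θ₁ := by
  have hn : ∀ θ, nodeSin (-z) (θ + Real.pi) = nodeSin z θ := fun θ => by simp [nodeSin]
  have hc : ∀ j, circ Λ (-z) j = circ Λ z j := fun j => by simp [circ]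
  have ht : tilt Λ (-z) = tilt Λ z := by simp [tilt, hc, nodeSq]
  simp only [orbitDensity, distSq, orbitRadius_neg, hn, hc, ht, add_sub_add_right_eq_sub]

theorem integral_integral_orbitDensity_neg :
    ∫ θ₀ in (0 : ℝ)..(2 * Real.pi), ∫ θ₁ in (0 : ℝ)..(2 * Real.pi),
        orbitDensity a Λ (-z) θ₀ θ₁ =
      ∫ θ₀ in (0 : ℝ)..(2 * Real.pi), ∫ θ₁ in (0 : ℝ)..(2 * Real.pi),
        orbitDensity a Λ z θ₀ θ₁ := by
  rw [← integral_comp_add_of_periodic (c := Real.pi) fun θ₀ => by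
    simp only [orbitDensity_add_two_pi_left]]
  refine intervalIntegral.integral_congr fun θ₀ _ => ?_
  rw [← integral_comp_add_of_periodic (c := Real.pi) fun θ₁ => by
    simp only [orbitDensity_add_two_pi_right]]
  simp only [orbitDensity_neg]

end Evenness

/-- Polarisation: a symmetric bilinear form is determined by its values on the diagonal. -/
theorem hessian_eq_of_forall {n : ℕ} {f : (Fin n ⊕ Fin n → ℝ) → ℝ} {z₀ : Fin n ⊕ Fin n → ℝ}
    (hf : ContDiffAt ℝ 2 f z₀) {M : Matrix (Fin n ⊕ Fin n) (Fin n ⊕ Fin n) ℝ} (hM : M.IsSymm)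
    (h : ∀ z, fderiv ℝ (fderiv ℝ f) z₀ z z = z ⬝ᵥ M.mulVec z) : hessian f z₀ = M := by
  have hs : IsSymmSndFDerivAt ℝ f z₀ := hf.isSymmSndFDerivAt (by simp)
  ext i j
  set u : Fin n ⊕ Fin n → ℝ := Pi.single i 1
  set v : Fin n ⊕ Fin n → ℝ := Pi.single j 1
  have e := h (u + v)
  have huv : u ⬝ᵥ M.mulVec v = M i j := by simp [u, v]
  have hvu : v ⬝ᵥ M.mulVec u = M i j := by simp [u, v, hM.apply i j]
  simp only [map_add, add_apply, Matrix.mulVec_add, dotProduct_add,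
    add_dotProduct, h, hs.eq v u, huv, hvu] at e
  rw [hessian, Matrix.of_apply]
  linarith

/-! ### Hessian, Taylor expansion and ellipticity of the average -/

section Secular

variable {m₀ μ : ℝ} {m Λ : Fin 2 → ℝ}

theorem semiAxis_pos (hm₀ : 0 < m₀) (hμ : 0 < μ) {j : Fin 2} (hm : 0 < m j) (hΛ : 0 < Λ j) :
    0 < semiAxis m₀ μ m Λ j := by
  rw [semiAxis, redMass, totMass]
  positivity

/-- The Hessian at the origin of the averaged perturbing function. -/
def averagedHessian (m₀ μ : ℝ) (m Λ : Fin 2 → ℝ) : Matrix (Fin 3 ⊕ Fin 3) (Fin 3 ⊕ Fin 3) ℝ :=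
  secularHessian (secS m₀ μ m Λ / Λ 0) (secS m₀ μ m Λ / Λ 1) (secST m₀ μ m Λ / √(Λ 0 * Λ 1))
    ((1 / Λ 1 - 1 / Λ 0) * secS m₀ μ m Λ)

theorem secularHessian_isSymm (A D g h : ℝ) : (secularHessian A D g h).IsSymm := by
  refine Matrix.IsSymm.fromBlocks ?_ (by simp) ?_ <;>
  · ext i j
    fin_cases i <;> fin_cases j <;> rfl

theorem dotProduct_secularHessian_mulVec (A D g h : ℝ) (z : Fin 3 ⊕ Fin 3 → ℝ) :
    z ⬝ᵥ (secularHessian A D g h).mulVec z =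
      A * (z (.inl 0) ^ 2 + z (.inr 0) ^ 2) + D * (z (.inl 1) ^ 2 + z (.inr 1) ^ 2) +
        2 * g * (z (.inl 0) * z (.inl 1) - z (.inr 0) * z (.inr 1)) +
        h * (z (.inl 2) ^ 2 + z (.inr 2) ^ 2) := by
  simp [secularHessian, Matrix.mulVec, dotProduct, Fin.sum_univ_three]
  ring

theorem secularQuadratic_eq (z : Fin 3 ⊕ Fin 3 → ℝ) :
    secularQuadratic m₀ μ m Λ z =
      ((1 / 2 * (z ⬝ᵥ (averagedHessian m₀ μ m Λ).mulVec z) : ℝ) : ℂ) := by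
  have h2 : ((√2 : ℝ) : ℂ) ^ 2 = 2 := by
    rw [← Complex.ofReal_pow, Real.sq_sqrt zero_le_two]; norm_num
  have hs : ((√2 : ℝ) : ℂ) ≠ 0 := fun h => by simp [h] at h2
  have hI := Complex.I_sq
  rw [averagedHessian, dotProduct_secularHessian_mulVec, secularQuadratic]
  simp only [Fin.sum_univ_two, sigma, tCoord, tStar, varsigma]
  simp
  field_simp
  simp only [h2]
  ring_nf
  simp only [hI]
  ring

theorem averaged_eventuallyEq (hΛ : 0 < Λ 0) (hΛ' : Λ 0 < Λ 1) (h1 : 0 < semiAxis m₀ μ m Λ 1)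
    (h01 : semiAxis m₀ μ m Λ 1 < semiAxis m₀ μ m Λ 0) :
    averaged m₀ μ m Λ =ᶠ[𝓝 0] fun z => -(m 0 * m 1 / (2 * Real.pi) ^ 2) *
      ∫ θ₀ in (0 : ℝ)..(2 * Real.pi), ∫ θ₁ in (0 : ℝ)..(2 * Real.pi),
        orbitDensity (semiAxis m₀ μ m Λ) Λ z θ₀ θ₁ := by
  filter_upwards [eventually_admissible hΛ hΛ', eventually_distSq_pos
    (Fin.forall_fin_two.2 ⟨hΛ, hΛ.trans hΛ'⟩) h1 h01] with z hz hD
  exact averaged_eq_integral hz hD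

/-- The formula defining `averaged` is not smooth in `z`, but near the origin it equals an integral
of a smooth density. -/
theorem contDiffAt_averaged (hΛ : 0 < Λ 0) (hΛ' : Λ 0 < Λ 1) (h1 : 0 < semiAxis m₀ μ m Λ 1)
    (h01 : semiAxis m₀ μ m Λ 1 < semiAxis m₀ μ m Λ 0) (n : ℕ) :
    ContDiffAt ℝ n (averaged m₀ μ m Λ) 0 := by
  refine ContDiffAt.congr_of_eventuallyEq (contDiffAt_const.mul ?_)
    (averaged_eventuallyEq hΛ hΛ' h1 h01)
  exact contDiffAt_integral_integral (z := (0 : Fin 3 ⊕ Fin 3 → ℝ))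
    (G := fun p : ((Fin 3 ⊕ Fin 3 → ℝ) × ℝ) × ℝ =>
      orbitDensity (semiAxis m₀ μ m Λ) Λ p.1.1 p.1.2 p.2) Real.two_pi_pos.le
    fun θ₀ _ θ₁ _ => contDiffAt_orbitDensity (Fin.forall_fin_two.2 ⟨hΛ, hΛ.trans hΛ'⟩) h1 h01 θ₀ θ₁

theorem averaged_eventually_even (hΛ : 0 < Λ 0) (hΛ' : Λ 0 < Λ 1)
    (h1 : 0 < semiAxis m₀ μ m Λ 1) (h01 : semiAxis m₀ μ m Λ 1 < semiAxis m₀ μ m Λ 0) :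
    ∀ᶠ z in 𝓝 0, averaged m₀ μ m Λ (-z) = averaged m₀ μ m Λ z := by
  have hneg : Tendsto (fun z : Fin 3 ⊕ Fin 3 → ℝ => -z) (𝓝 0) (𝓝 0) := by
    simpa using (continuous_neg (G := Fin 3 ⊕ Fin 3 → ℝ)).tendsto 0
  have h := averaged_eventuallyEq hΛ hΛ' h1 h01
  filter_upwards [h, hneg.eventually h] with z hz hz'
  rw [hz', hz, integral_integral_orbitDensity_neg]

theorem deriv_deriv_integral_orbitDensity {a : Fin 2 → ℝ} (hΛ : ∀ j, 0 < Λ j) (h1 : 0 < a 1)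
    (h01 : a 1 < a 0) (z : Fin 3 ⊕ Fin 3 → ℝ) :
    deriv (deriv fun r : ℝ => ∫ θ₀ in (0 : ℝ)..(2 * Real.pi), ∫ θ₁ in (0 : ℝ)..(2 * Real.pi),
        orbitDensity a Λ (r • z) θ₀ θ₁) 0 =
      2 * ∫ θ₀ in (0 : ℝ)..(2 * Real.pi), ∫ θ₁ in (0 : ℝ)..(2 * Real.pi),
        densityCoeff a Λ z θ₀ θ₁ := by
  have hc : ∀ θ₀ θ₁, ContDiffAt ℝ 2 (fun p : (ℝ × ℝ) × ℝ =>
      orbitDensity a Λ (p.1.1 • z) p.1.2 p.2) ((0, θ₀), θ₁) := fun θ₀ θ₁ => by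
    have h : ContDiffAt ℝ 2 (fun p : ((Fin 3 ⊕ Fin 3 → ℝ) × ℝ) × ℝ =>
        orbitDensity a Λ p.1.1 p.1.2 p.2) ((((0 : ℝ) • z), θ₀), θ₁) := by
      rw [zero_smul]
      exact contDiffAt_orbitDensity hΛ h1 h01 θ₀ θ₁
    have hp : ContDiffAt ℝ 2 (fun p : (ℝ × ℝ) × ℝ => ((p.1.1 • z, p.1.2), p.2))
      ((0, θ₀), θ₁) := by fun_prop
    exact h.comp (f := fun p : (ℝ × ℝ) × ℝ => ((p.1.1 • z, p.1.2), p.2)) ((0, θ₀), θ₁) hp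
  have hd : ∀ θ₀ θ₁, deriv (deriv fun r : ℝ => orbitDensity a Λ (r • z) θ₀ θ₁) 0 =
      2 * densityCoeff a Λ z θ₀ θ₁ := fun θ₀ θ₁ => by
    obtain ⟨b, hb⟩ := hasJet_orbitDensity z hΛ h1 h01 θ₀ θ₁
    exact hb.deriv_deriv_eq ((hc θ₀ θ₁).comp (f := fun r : ℝ => ((r, θ₀), θ₁)) 0 (by fun_prop))
  rw [deriv_deriv_integral_integral (G := fun p : (ℝ × ℝ) × ℝ =>
    orbitDensity a Λ (p.1.1 • z) p.1.2 p.2) Real.two_pi_pos.le fun θ₀ _ θ₁ _ => hc θ₀ θ₁]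
  simp only [hd, intervalIntegral.integral_const_mul]

theorem fderiv_fderiv_averaged (hΛ : 0 < Λ 0) (hΛ' : Λ 0 < Λ 1)
    (h1 : 0 < semiAxis m₀ μ m Λ 1) (h01 : semiAxis m₀ μ m Λ 1 < semiAxis m₀ μ m Λ 0)
    (z : Fin 3 ⊕ Fin 3 → ℝ) :
    fderiv ℝ (fderiv ℝ (averaged m₀ μ m Λ)) 0 z z =
      z ⬝ᵥ (averagedHessian m₀ μ m Λ).mulVec z := by
  have hpos : ∀ j, 0 < Λ j := Fin.forall_fin_two.2 ⟨hΛ, hΛ.trans hΛ'⟩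
  have hc := contDiffAt_averaged hΛ hΛ' h1 h01 2
  have he := averaged_eventuallyEq hΛ hΛ' h1 h01
  rw [he.fderiv.fderiv_eq, ← deriv_deriv_line (hc.congr_of_eventuallyEq he.symm) z]
  have hd : deriv (fun r : ℝ => -(m 0 * m 1 / (2 * Real.pi) ^ 2) *
      ∫ θ₀ in (0 : ℝ)..(2 * Real.pi), ∫ θ₁ in (0 : ℝ)..(2 * Real.pi),
        orbitDensity (semiAxis m₀ μ m Λ) Λ (r • z) θ₀ θ₁) =
      fun r => -(m 0 * m 1 / (2 * Real.pi) ^ 2) * deriv (fun r : ℝ =>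
      ∫ θ₀ in (0 : ℝ)..(2 * Real.pi), ∫ θ₁ in (0 : ℝ)..(2 * Real.pi),
        orbitDensity (semiAxis m₀ μ m Λ) Λ (r • z) θ₀ θ₁) r := by
    funext r
    rw [deriv_const_mul_field]
  rw [hd, deriv_const_mul_field, deriv_deriv_integral_orbitDensity hpos h1 h01,
    integral_integral_densityCoeff hpos h1 h01, averagedHessian,
    dotProduct_secularHessian_mulVec, Real.sqrt_mul hΛ.le]
  have e1 := mul_integral_cos_eq_secS h1 h01
  have e2 := mul_integral_cos_two_eq_secST h1 h01
  set I₁ := ∫ θ in (0 : ℝ)..(2 * Real.pi), Real.cos θ * circInvDist (semiAxis m₀ μ m Λ) θ ^ 3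
  set I₂ := ∫ θ in (0 : ℝ)..(2 * Real.pi),
    Real.cos (2 * θ) * circInvDist (semiAxis m₀ μ m Λ) θ ^ 3
  set s := secS m₀ μ m Λ
  set st := secST m₀ μ m Λ
  have hp := Real.pi_ne_zero
  have s1 : s = -(m 0 * m 1 * (semiAxis m₀ μ m Λ 0 * semiAxis m₀ μ m Λ 1) * I₁) /
      (4 * Real.pi) := by field_simp; linarith
  have s2 : st = m 0 * m 1 * (semiAxis m₀ μ m Λ 0 * semiAxis m₀ μ m Λ 1) * I₂ /
      (4 * Real.pi) := by field_simp; linarith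
  have l0 := (hpos 0).ne'
  have l1 := (hpos 1).ne'
  have r0 := (Real.sqrt_pos.2 (hpos 0)).ne'
  have r1 := (Real.sqrt_pos.2 (hpos 1)).ne'
  rw [s1, s2]
  simp only [quarterEccSq, Fin.castSucc_zero, Fin.castSucc_one]
  field_simp
  ring

theorem hessian_averaged (hΛ : 0 < Λ 0) (hΛ' : Λ 0 < Λ 1) (h1 : 0 < semiAxis m₀ μ m Λ 1)
    (h01 : semiAxis m₀ μ m Λ 1 < semiAxis m₀ μ m Λ 0) :
    hessian (averaged m₀ μ m Λ) 0 = averagedHessian m₀ μ m Λ :=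
  hessian_eq_of_forall (contDiffAt_averaged hΛ hΛ' h1 h01 2) (secularHessian_isSymm _ _ _ _)
    (fderiv_fderiv_averaged hΛ hΛ' h1 h01)

theorem averaged_isBigO (hΛ : 0 < Λ 0) (hΛ' : Λ 0 < Λ 1) (h1 : 0 < semiAxis m₀ μ m Λ 1)
    (h01 : semiAxis m₀ μ m Λ 1 < semiAxis m₀ μ m Λ 0) :
    (fun z : Fin 3 ⊕ Fin 3 → ℝ => (averaged m₀ μ m Λ z : ℂ) -
      (((averaged m₀ μ m Λ 0 : ℝ) : ℂ) + secularQuadratic m₀ μ m Λ z)) =O[𝓝 0]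
        fun z => ‖z‖ ^ 4 := by
  have h := isBigO_even_taylor (contDiffAt_averaged hΛ hΛ' h1 h01 4)
    (averaged_eventually_even hΛ hΛ' h1 h01)
  refine IsBigO.congr_left (f₁ := fun z => ((averaged m₀ μ m Λ z - averaged m₀ μ m Λ 0 -
    1 / 2 * fderiv ℝ (fderiv ℝ (averaged m₀ μ m Λ)) 0 z z : ℝ) : ℂ)) ?_ fun z => ?_
  -- The real estimate is carried to `ℂ` by the isometric embedding.
  · exact (Complex.isometry_ofReal.norm_map_of_map_zero Complex.ofReal_zero |> fun hn =>
      h.norm_left.congr_left fun z => (hn _).symm).of_norm_left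
  · rw [secularQuadratic_eq,
      fderiv_fderiv_averaged hΛ hΛ' h1 h01]
    push_cast
    ring

theorem sq_secST_div_lt (hm : ∀ j, 0 < m j) (hΛ : ∀ j, 0 < Λ j)
    (h1 : 0 < semiAxis m₀ μ m Λ 1) (h01 : semiAxis m₀ μ m Λ 1 < semiAxis m₀ μ m Λ 0) :
    (secST m₀ μ m Λ / √(Λ 0 * Λ 1)) ^ 2 < secS m₀ μ m Λ / Λ 0 * (secS m₀ μ m Λ / Λ 1) := by
  obtain ⟨hp, hlt⟩ := secST_pos_and_lt hm h1 h01
  have h0 := mul_pos (hΛ 0) (hΛ 1)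
  rw [div_pow, Real.sq_sqrt h0.le, div_mul_div_comm, div_lt_div_iff_of_pos_right h0]
  nlinarith

theorem isEllipticEquilibrium_averaged (hm : ∀ j, 0 < m j) (hΛ : 0 < Λ 0) (hΛ' : Λ 0 < Λ 1)
    (h1 : 0 < semiAxis m₀ μ m Λ 1) (h01 : semiAxis m₀ μ m Λ 1 < semiAxis m₀ μ m Λ 0) :
    IsEllipticEquilibrium (averaged m₀ μ m Λ) 0 := by
  have hpos : ∀ j, 0 < Λ j := Fin.forall_fin_two.2 ⟨hΛ, hΛ.trans hΛ'⟩
  obtain ⟨hp, hlt⟩ := secST_pos_and_lt hm h1 h01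
  have hs : secS m₀ μ m Λ < 0 := by linarith
  have hg := sq_secST_div_lt hm hpos h1 h01
  -- Both uses of `Λ 0 < Λ 1`: the diagonal entries differ, so the frequencies are distinct, and
  -- with `s < 0` the `(p, q)` oscillator has positive coefficient.
  have hAD : secS m₀ μ m Λ / Λ 0 ≠ secS m₀ μ m Λ / Λ 1 := fun h =>
    hΛ'.ne (inv_injective (mul_left_cancel₀ hs.ne h))
  have hh : 0 < (1 / Λ 1 - 1 / Λ 0) * secS m₀ μ m Λ :=
    mul_pos_of_neg_of_neg (sub_neg.2 (one_div_lt_one_div_of_lt hΛ hΛ')) hs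
  have hl : linearization (averaged m₀ μ m Λ) 0 =
      Matrix.J (Fin 3) ℝ * averagedHessian m₀ μ m Λ := by
    rw [linearization, hessian_averaged hΛ hΛ' h1 h01]
  exact {
    contDiffAt := contDiffAt_averaged hΛ hΛ' h1 h01 2
    critical := fderiv_zero_of_even (averaged_eventually_even hΛ hΛ' h1 h01)
    eigenvalue := fun w hw => by
      rw [hl] at hw
      exact eigenvalue_secular hAD hg hh hw
    diagonalizable := by
      rw [hl]
      exact iSup_eigenspace_secular hAD hg hh }

end Secular

end Retrograde

end

theorem mainTheorem8 (m₀ μ : ℝ) (m Λ : Fin 2 → ℝ)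
    (hm₀ : 0 < m₀) (hμ : 0 < μ) (hm : ∀ j, 0 < m j)
    (hΛ : 0 < Λ 0) (hΛ' : Λ 0 < Λ 1)
    (ha : Retrograde.semiAxis m₀ μ m Λ 1 < Retrograde.semiAxis m₀ μ m Λ 0) :
    -- `σ(Λ)` is the matrix of quadratic coefficients of the averaged perturbing function
    (∃ C₀ : ℝ,
      (fun z : Fin 3 ⊕ Fin 3 → ℝ =>
        (Retrograde.averaged m₀ μ m Λ z : ℂ) -
          ((C₀ : ℂ) + Retrograde.secularQuadratic m₀ μ m Λ z))
        =O[𝓝 0] fun z => ‖z‖ ^ 4) ∧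
    -- it is symmetric and not real
    (Retrograde.sigma m₀ μ m Λ).IsSymm ∧
    (¬ ∃ B : Matrix (Fin 2) (Fin 2) ℝ,
      Retrograde.sigma m₀ μ m Λ = B.map (fun r : ℝ => (r : ℂ))) ∧
    -- its eigenvalues are real
    (∀ w : ℂ, Module.End.HasEigenvalue (Matrix.toLin' (Retrograde.sigma m₀ μ m Λ)) w →
      w.im = 0) ∧
    -- the origin is an elliptic equilibrium of the averaged perturbing function
    Retrograde.IsEllipticEquilibrium (Retrograde.averaged m₀ μ m Λ) 0 := by
  have hpos : ∀ j, 0 < Λ j := Fin.forall_fin_two.2 ⟨hΛ, hΛ.trans hΛ'⟩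
  have h1 : 0 < Retrograde.semiAxis m₀ μ m Λ 1 := Retrograde.semiAxis_pos hm₀ hμ (hm 1) (hpos 1)
  obtain ⟨hp, hlt⟩ := Retrograde.secST_pos_and_lt hm h1 ha
  refine ⟨⟨_, Retrograde.averaged_isBigO hΛ hΛ' h1 ha⟩, ?_, ?_, fun w hw => ?_,
    Retrograde.isEllipticEquilibrium_averaged hm hΛ hΛ' h1 ha⟩
  · ext i j
    fin_cases i <;> fin_cases j <;> rfl
  · rintro ⟨B, hB⟩
    -- A real matrix would force the imaginary off-diagonal entry, hence `s̃`, to vanish.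
    have h := congrArg Complex.im (congrFun (congrFun hB 0) 1)
    have hr : Retrograde.secST m₀ μ m Λ / √(Λ 0 * Λ 1) = 0 := by
      simpa [Retrograde.sigma] using h
    exact (div_pos hp (Real.sqrt_pos.2 (mul_pos (hpos 0) (hpos 1)))).ne' hr
  · exact Retrograde.eigenvalue_sigma_real (Retrograde.sq_secST_div_lt hm hpos h1 ha) hw
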